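/- Let $n\ge 1$ and let $\mathfrak q(n)$ be the queer Lie superalgebra over $\mathbb C$, i.e. all block matrices $\begin{pmatrix}A&B\\B&A\end{pmatrix}$ with $A,B\in\mathbb C^{n\times n}$ (even part $B=0$, odd part $A=0$), with standard triangular decomposition $\mathfrak n\oplus\mathfrak h\oplus\mathfrak n^-$ ($\mathfrak n$: $A,B$ strictly upper triangular). Let $\zeta:\mathfrak n_{\bar 0}\to\mathbb C$ be a Lie algebra character, and let $\mathfrak l$ be the Levi subalgebra of $\mathfrak q(n)$ whose even part is generated by $\mathfrak h_{\bar 0}$ and the root spaces $\mathfrak g_{\bar 0}^{\pm\alpha}$ for the positive roots $\alpha$ with $\zeta(\mathfrak g^\alpha_{\bar 0})\ne 0$, and whose odd part is the parity shift of its even part. Then $\mathfrak l\cong\mathfrak q(n_1)\oplus\cdots\oplus\mathfrak q(n_k)$ is block diagonal. Let $\mathfrak l=\mathfrak a\oplus\mathfrak b$, where $\mathfrak a$ is the sum of some of the summands $\mathfrak q(n_i)$ and $\mathfrak b$ is the sum of the others. For $\mathfrak s\in\{\mathfrak a,\mathfrak b,\mathfrak l\}$ let $\mathcal N_{\mathfrak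 s}(\zeta)$ be the category of finitely generated $\mathfrak s$-supermodules on which $U(\mathfrak s\cap\mathfrak n)$ and the centre $Z(\mathfrak s_{\bar 0})$ of $U(\mathfrak s_{\bar 0})$ act locally finitely and on which $x-\zeta(x)$ acts locally nilpotently for each $x\in\mathfrak s_{\bar 0}\cap\mathfrak n_{\bar 0}$. Submodules are $\mathbb Z_2$-graded, homomorphisms are sums of even and odd ones, and $\cong$ means isomorphic by an even or an odd isomorphism. A simple $\mathfrak s$-supermodule $L$ is of type $\mathtt M$ if $\dim\operatorname{End}_{\mathfrak s}(L)=1$ and of type $\mathtt Q$ if $\dim\operatorname{End}_{\mathfrak s}(L)=2$. For all simple $V_{\mathfrak a}\in\mathcal N_{\mathfrak a}(\zeta)$ and $V_{\mathfrak b}\in\mathcal N_{\mathfrak b}(\zeta)$, the $\mathfrak l$-module $V_{\mathfrak a}\otimes V_{\mathfrak b}$ is either simple or a direct sum of two isomorphic simple modules. It is simple if $V_{\mathfrak a}$ or $V_{\mathfrak b}$ is of type $\mathtt M$, and it is a direct sum of two isomorphic simple modules if both are of type $\mathtt Q$. Let $V_{\mathfrak a}\hat\otimes V_{\mathfrak b}\subseteq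 V_{\mathfrak a}\otimes V_{\mathfrak b}$ denote a simple submodule (it exists). Then the modules $V_{\mathfrak a}\hat\otimes V_{\mathfrak b}$ form a complete irredundant list of simple objects of $\mathcal N_{\mathfrak l}(\zeta)$: each of them is an object of $\mathcal N_{\mathfrak l}(\zeta)$; every simple object of $\mathcal N_{\mathfrak l}(\zeta)$ is isomorphic to some $V_{\mathfrak a}\hat\otimes V_{\mathfrak b}$; and $V_{\mathfrak a}\hat\otimes V_{\mathfrak b}\cong V'_{\mathfrak a}\hat\otimes V'_{\mathfrak b}$ if and only if $V_{\mathfrak a}\cong V'_{\mathfrak a}$ and $V_{\mathfrak b}\cong V'_{\mathfrak b}$ (for any choices of the simple submodules). -/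

import Mathlib

open scoped TensorProduct

universe u

attribute [local instance 100] LieRing.ofAssociativeRing

noncomputable section

namespace Queer

/-! ### The queer Lie superalgebra and its graded subalgebras

An element of `q(n)` is a block matrix `(A B; B A)` with `A, B` complex `n × n` matrices; the even
part is `B = 0` and the odd part is `A = 0`. We identify the even element `(A 0; 0 A)` with `A` and
the odd element `(0 B; B 0)` with `B`. The super bracket of `q(n)` then reads
`[A, A'] = A A' - A' A` (even), `[A, B] = A B - B A` (odd), `[B, B'] = B B' + B' B` (even). -/

/-- Complex `n × n` matrices, which form both the even and the odd part of `q(n)`. -/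
abbrev Mat (n : ℕ) : Type := Matrix (Fin n) (Fin n) ℂ

/-- A graded Lie sub-superalgebra of `q(n)`. -/
structure SubSuperalgebra (n : ℕ) where
  /-- the even part -/
  even : LieSubalgebra ℂ (Mat n)
  /-- the odd part -/
  odd : Submodule ℂ (Mat n)
  even_odd_mem : ∀ x ∈ even, ∀ y ∈ odd, x * y - y * x ∈ odd
  odd_odd_mem : ∀ y ∈ odd, ∀ z ∈ odd, y * z + z * y ∈ even

/-- Strictly upper triangular matrices. The nilradical `n` of the standard Borel subalgebra of
`q(n)` consists of the even and odd elements given by such matrices. -/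
def IsStrictUpper {n : ℕ} (A : Mat n) : Prop := ∀ i j, j ≤ i → A i j = 0

theorem IsStrictUpper.mul {n : ℕ} {A B : Mat n} (hA : IsStrictUpper A) (hB : IsStrictUpper B) :
    IsStrictUpper (A * B) := by
  intro i j hij
  rw [Matrix.mul_apply]
  refine Finset.sum_eq_zero fun k _ => ?_
  rcases le_or_gt k i with h | h
  · rw [hA i k h, zero_mul]
  · rw [hB k j (hij.trans h.le), mul_zero]

/-- The even part of the nilradical, the Lie algebra of strictly upper triangular matrices. -/
def nilEven (n : ℕ) : LieSubalgebra ℂ (Mat n) where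
  carrier := {A | IsStrictUpper A}
  add_mem' := by
    intro A B hA hB i j h
    simp [hA i j h, hB i j h]
  zero_mem' := fun _ _ _ => rfl
  smul_mem' := by
    intro c A hA i j h
    simp [hA i j h]
  lie_mem' := by
    intro A B hA hB i j h
    rw [Ring.lie_def, Matrix.sub_apply, hA.mul hB i j h, hB.mul hA i j h, sub_zero]

theorem single_mem_nilEven {n : ℕ} {i j : Fin n} (h : i < j) :
    Matrix.single i j (1 : ℂ) ∈ nilEven n := by
  intro k l hkl
  rw [Matrix.single_apply, if_neg]
  rintro ⟨rfl, rfl⟩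
  exact absurd h (not_lt.mpr hkl)

/-- Characters of `nilEven n`: linear forms vanishing on brackets. -/
abbrev NilCharacter (n : ℕ) : Type := LieAlgebra.LieCharacter ℂ (nilEven n)

/-! ### The Levi subalgebra attached to a character -/

/-- The positive root `ε_i - ε_j` has a root vector on which `ζ` does not vanish. -/
def Linked {n : ℕ} (ζ : NilCharacter n) (i j : Fin n) : Prop :=
  ∃ h : i < j, ζ ⟨Matrix.single i j 1, single_mem_nilEven h⟩ ≠ 0

/-- The blocks of the Levi subalgebra: classes of the equivalence relation on the indices that is
generated by `Linked ζ`. A root `ε_i - ε_j` is a root of the Levi subalgebra if and only if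
`i` and `j` lie in the same block. -/
abbrev Block {n : ℕ} (ζ : NilCharacter n) : Type := Quot (Linked ζ)

/-- The block of an index. -/
abbrev block {n : ℕ} (ζ : NilCharacter n) (i : Fin n) : Block ζ := Quot.mk _ i

/-- Matrices that are block diagonal for the blocks of `ζ` and supported on the blocks in `T`. -/
def blockMatrices {n : ℕ} (ζ : NilCharacter n) (T : Set (Block ζ)) : Submodule ℂ (Mat n) where
  carrier := {A | ∀ i j, A i j ≠ 0 → block ζ i = block ζ j ∧ block ζ i ∈ T}
  add_mem' := by
    intro A B hA hB i j h
    by_cases h' : A i j = 0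
    · exact hB i j (by simpa [h'] using h)
    · exact hA i j h'
  zero_mem' := fun i j h => absurd rfl h
  smul_mem' := by
    intro c A hA i j h
    exact hA i j fun h' => h (by simp [h'])

theorem mul_mem_blockMatrices {n : ℕ} {ζ : NilCharacter n} {T : Set (Block ζ)} {A B : Mat n}
    (hA : A ∈ blockMatrices ζ T) (hB : B ∈ blockMatrices ζ T) : A * B ∈ blockMatrices ζ T := by
  intro i j h
  rw [Matrix.mul_apply] at h
  obtain ⟨k, -, hk⟩ := Finset.exists_ne_zero_of_sum_ne_zero h
  obtain ⟨h1, h2⟩ := hA i k (left_ne_zero_of_mul hk)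
  exact ⟨h1.trans (hB k j (right_ne_zero_of_mul hk)).1, h2⟩

/-- The sum of those summands `q(n_i)` of the Levi subalgebra whose blocks belong to `T`. -/
def leviPart {n : ℕ} (ζ : NilCharacter n) (T : Set (Block ζ)) : SubSuperalgebra n where
  even :=
    { blockMatrices ζ T with
      lie_mem' := fun hA hB =>
        (blockMatrices ζ T).sub_mem (mul_mem_blockMatrices hA hB) (mul_mem_blockMatrices hB hA) }
  odd := blockMatrices ζ T
  even_odd_mem := fun _ hx _ hy =>
    (blockMatrices ζ T).sub_mem (mul_mem_blockMatrices hx hy) (mul_mem_blockMatrices hy hx)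
  odd_odd_mem := fun _ hy _ hz =>
    (blockMatrices ζ T).add_mem (mul_mem_blockMatrices hy hz) (mul_mem_blockMatrices hz hy)

/-- The Levi subalgebra `l` of `q(n)` attached to `ζ`: its even part is spanned by the diagonal
matrices and by the root spaces of the root subsystem generated by the `α > 0` with
`ζ(g^α) ≠ 0`, and its odd part is the parity shift of the even part. -/
def levi {n : ℕ} (ζ : NilCharacter n) : SubSuperalgebra n := leviPart ζ Set.univ

theorem single_mem_of_block_eq {n : ℕ} (ζ : NilCharacter n) (K : LieSubalgebra ℂ (Mat n))
    (hd : ∀ d, Matrix.diagonal d ∈ K)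
    (hl : ∀ i j, Linked ζ i j → Matrix.single i j 1 ∈ K ∧ Matrix.single j i 1 ∈ K)
    {i j : Fin n} (h : block ζ i = block ζ j) :
    Matrix.single i j (1 : ℂ) ∈ K ∧ Matrix.single j i (1 : ℂ) ∈ K := by
  have h' := Quot.eqvGen_exact h
  clear h
  induction h' with
  | rel i j h => exact hl i j h
  | refl i =>
    have := hd (Pi.single i 1)
    rw [Matrix.diagonal_single] at this
    exact ⟨this, this⟩
  | symm i j h ih => exact ih.symm
  | trans i j k h1 h2 ih1 ih2 =>
    obtain ⟨a, b⟩ := ih1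
    obtain ⟨c, d⟩ := ih2
    by_cases hik : i = k
    · subst hik
      have := hd (Pi.single i 1)
      rw [Matrix.diagonal_single] at this
      exact ⟨this, this⟩
    · have e1 := K.lie_mem a c
      have e2 := K.lie_mem d b
      rw [Ring.lie_def] at e1 e2
      simp only [Matrix.single_mul_single_same, mul_one] at e1 e2
      rw [Matrix.single_mul_single_of_ne (h := Ne.symm hik), sub_zero] at e1
      rw [Matrix.single_mul_single_of_ne (h := hik), sub_zero] at e2
      exact ⟨e1, e2⟩

/-- The even part of `levi ζ` is the Lie algebra generated by the diagonal matrices and the root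
spaces of `±α` for the positive roots `α` with `ζ(g^α) ≠ 0`. -/
theorem levi_even_eq_lieSpan {n : ℕ} (ζ : NilCharacter n) :
    (levi ζ).even = LieSubalgebra.lieSpan ℂ (Mat n) (Set.range Matrix.diagonal ∪
      {A | ∃ i j, Linked ζ i j ∧ (A = Matrix.single i j 1 ∨ A = Matrix.single j i 1)}) := by
  apply le_antisymm
  · intro A hA
    generalize hK : LieSubalgebra.lieSpan ℂ (Mat n) (Set.range Matrix.diagonal ∪
      {A | ∃ i j, Linked ζ i j ∧ (A = Matrix.single i j 1 ∨ A = Matrix.single j i 1)}) = K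
    have hs := LieSubalgebra.subset_lieSpan (R := ℂ) (L := Mat n) (s := Set.range Matrix.diagonal ∪
      {A | ∃ i j, Linked ζ i j ∧ (A = Matrix.single i j 1 ∨ A = Matrix.single j i 1)})
    rw [hK] at hs
    rw [Matrix.matrix_eq_sum_single A]
    refine Submodule.sum_mem (p := K.toSubmodule) fun i _ => Submodule.sum_mem _ fun j _ => ?_
    by_cases h : A i j = 0
    · rw [h, Matrix.single_zero]
      exact Submodule.zero_mem _
    · have h1 := (single_mem_of_block_eq ζ K (fun d => hs (Or.inl ⟨d, rfl⟩))
        (fun i j hij => ⟨hs (Or.inr ⟨i, j, hij, Or.inl rfl⟩),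
          hs (Or.inr ⟨i, j, hij, Or.inr rfl⟩)⟩) (hA i j h).1).1
      simpa [Matrix.smul_single] using K.smul_mem (A i j) h1
  · rw [LieSubalgebra.lieSpan_le]
    rintro A (⟨d, rfl⟩ | ⟨i, j, h, rfl | rfl⟩) k l hkl
    · refine ⟨?_, trivial⟩
      by_cases e : k = l
      · rw [e]
      · exact absurd (Matrix.diagonal_apply_ne _ e) hkl
    all_goals
      rw [Matrix.single_apply] at hkl
      simp only [ne_eq, ite_eq_right_iff, one_ne_zero, imp_false, not_not] at hkl
      obtain ⟨rfl, rfl⟩ := hkl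
    · exact ⟨Quot.sound h, trivial⟩
    · exact ⟨(Quot.sound h).symm, trivial⟩

/-! ### Supermodules -/

/-- A supermodule over `s`, with the `ℤ/2`-grading of the underlying space given by the parity
involution, which is `1` on even and `-1` on odd vectors. -/
structure SMod {n : ℕ} (s : SubSuperalgebra n) where
  /-- the underlying vector space -/
  carrier : Type u
  [addCommGroup : AddCommGroup carrier]
  [module : Module ℂ carrier]
  /-- the parity involution -/
  parity : Module.End ℂ carrier
  /-- the action of even elements -/
  actEven : s.even →ₗ⁅ℂ⁆ Module.End ℂ carrier
  /-- the action of odd elements -/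
  actOdd : s.odd →ₗ[ℂ] Module.End ℂ carrier
  parity_mul_self : parity * parity = 1
  parity_actEven : ∀ x, parity * actEven x = actEven x * parity
  parity_actOdd : ∀ y, parity * actOdd y = -(actOdd y * parity)
  act_even_odd : ∀ (x : s.even) (y : s.odd),
    actOdd ⟨x * y - y * x, s.even_odd_mem x x.2 y y.2⟩ = actEven x * actOdd y - actOdd y * actEven x
  act_odd_odd : ∀ y z : s.odd,
    actEven ⟨y * z + z * y, s.odd_odd_mem y y.2 z z.2⟩ = actOdd y * actOdd z + actOdd z * actOdd y

namespace SMod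

variable {n : ℕ} {s : SubSuperalgebra n}

instance : CoeSort (SMod.{u} s) (Type u) := ⟨SMod.carrier⟩

instance (M : SMod.{u} s) : AddCommGroup M := M.addCommGroup

instance (M : SMod.{u} s) : Module ℂ M := M.module

/-- A subspace stable under the action of `s`. -/
def IsStable (M : SMod.{u} s) (N : Submodule ℂ M) : Prop :=
  (∀ x, ∀ v ∈ N, M.actEven x v ∈ N) ∧ ∀ y, ∀ v ∈ N, M.actOdd y v ∈ N

/-- A graded submodule of a supermodule. -/
structure Sub (M : SMod.{u} s) where
  /-- the underlying subspace -/
  space : Submodule ℂ M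
  parity_mem : ∀ v ∈ space, M.parity v ∈ space
  stable : M.IsStable space

/-- A graded submodule as a supermodule. -/
def Sub.toSMod {M : SMod.{u} s} (N : M.Sub) : SMod.{u} s where
  carrier := N.space
  parity := M.parity.restrict N.parity_mem
  actEven :=
    { toFun := fun x => (M.actEven x).restrict (N.stable.1 x)
      map_add' := fun x y => by ext v; simp
      map_smul' := fun c x => by ext v; simp
      map_lie' := fun {x y} => by ext v; simp [Ring.lie_def] }
  actOdd :=
    { toFun := fun y => (M.actOdd y).restrict (N.stable.2 y)
      map_add' := fun x y => by ext v; simp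
      map_smul' := fun c x => by ext v; simp }
  parity_mul_self := by
    ext v
    simpa using congrArg (fun f => f (v : M)) M.parity_mul_self
  parity_actEven := fun x => by
    ext v
    simpa using congrArg (fun f => f (v : M)) (M.parity_actEven x)
  parity_actOdd := fun y => by
    ext v
    simpa using congrArg (fun f => f (v : M)) (M.parity_actOdd y)
  act_even_odd := fun x y => by
    ext v
    simpa using congrArg (fun f => f (v : M)) (M.act_even_odd x y)
  act_odd_odd := fun y z => by
    ext v
    simpa using congrArg (fun f => f (v : M)) (M.act_odd_odd y z)

/-- A simple supermodule: nonzero, without proper nonzero graded submodules. -/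
def IsSimple (M : SMod.{u} s) : Prop :=
  Nontrivial M ∧ ∀ N : M.Sub, N.space = ⊥ ∨ N.space = ⊤

/-- The homogeneous homomorphisms from `M` to `N`: the even ones for `ε = 1` and the odd ones for
`ε = -1`. A homogeneous homomorphism `f` satisfies `f (x v) = (-1)^{|f||x|} x (f v)`. -/
def homogHom (M N : SMod.{u} s) (ε : ℤˣ) : Submodule ℂ (M →ₗ[ℂ] N) where
  carrier := {f | (∀ v, f (M.parity v) = ε • N.parity (f v)) ∧
    (∀ x v, f (M.actEven x v) = N.actEven x (f v)) ∧
    ∀ y v, f (M.actOdd y v) = ε • N.actOdd y (f v)}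
  add_mem' := by
    rintro f g ⟨hf, hf0, hf1⟩ ⟨hg, hg0, hg1⟩
    exact ⟨fun v => by simp [hf, hg], fun x v => by simp [hf0, hg0],
      fun y v => by simp [hf1, hg1]⟩
  zero_mem' := by simp
  smul_mem' := by
    rintro c f ⟨hf, hf0, hf1⟩
    exact ⟨fun v => by simp [hf, smul_comm c ε], fun x v => by simp [hf0],
      fun y v => by simp [hf1, smul_comm c ε]⟩

/-- The space of all endomorphisms, spanned by the even and the odd ones. -/
def endo (M : SMod.{u} s) : Submodule ℂ (M →ₗ[ℂ] M) := homogHom M M 1 ⊔ homogHom M M (-1)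

/-- Type `M`: the endomorphism space has dimension `1`. -/
def IsTypeM (M : SMod.{u} s) : Prop := Module.finrank ℂ M.endo = 1

/-- Type `Q`: the endomorphism space has dimension `2`. -/
def IsTypeQ (M : SMod.{u} s) : Prop := Module.finrank ℂ M.endo = 2

/-- Isomorphism of supermodules by an even or odd isomorphism, that is, up to parity change. -/
def Iso (M N : SMod.{u} s) : Prop :=
  ∃ (ε : ℤˣ) (e : M ≃ₗ[ℂ] N), (e : M →ₗ[ℂ] N) ∈ homogHom M N ε

/-- `M` is the direct sum of two isomorphic simple graded submodules. -/
def IsDouble (M : SMod.{u} s) : Prop :=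
  ∃ N₁ N₂ : M.Sub, IsCompl N₁.space N₂.space ∧
    N₁.toSMod.IsSimple ∧ N₂.toSMod.IsSimple ∧ Iso N₁.toSMod N₂.toSMod

/-- The objects of the McDowell–Miličić–Soergel type Whittaker category of `s` attached to `ζ`:
finitely generated supermodules on which `U(s ∩ n)` and the centre of `U(s_even)` act locally
finitely, and on which `x - ζ(x)` acts locally nilpotently for every even `x` in `s ∩ n`. -/
structure IsWhittaker (ζ : NilCharacter n) (M : SMod.{u} s) : Prop where
  finitely_generated : ∃ F : Finset M, ∀ N : Submodule ℂ M, M.IsStable N → (F : Set M) ⊆ N → N = ⊤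
  nil_locally_finite : ∀ v : M, ∃ N : Submodule ℂ M, v ∈ N ∧ FiniteDimensional ℂ N ∧
    (∀ x : s.even, IsStrictUpper (x : Mat n) → ∀ w ∈ N, M.actEven x w ∈ N) ∧
    (∀ y : s.odd, IsStrictUpper (y : Mat n) → ∀ w ∈ N, M.actOdd y w ∈ N)
  center_locally_finite : ∀ v : M, ∃ N : Submodule ℂ M, v ∈ N ∧ FiniteDimensional ℂ N ∧
    ∀ z ∈ Subalgebra.center ℂ (UniversalEnvelopingAlgebra ℂ s.even),
      ∀ w ∈ N, UniversalEnvelopingAlgebra.lift ℂ M.actEven z w ∈ N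
  locally_nilpotent : ∀ (x : s.even) (hx : (x : Mat n) ∈ nilEven n), ∀ v : M, ∃ k : ℕ,
    ((M.actEven x - ζ ⟨x, hx⟩ • (1 : Module.End ℂ M)) ^ k) v = 0

end SMod

/-! ### The outer tensor product -/

open Classical in
/-- The part of a matrix in the rows whose blocks lie in `T`. -/
def cut {n : ℕ} (ζ : NilCharacter n) (T : Set (Block ζ)) : Mat n →ₗ[ℂ] Mat n where
  toFun A := Matrix.of fun i j => if block ζ i ∈ T then A i j else 0
  map_add' A B := by
    ext i j
    by_cases h : block ζ i ∈ T <;> simp [h]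
  map_smul' c A := by
    ext i j
    by_cases h : block ζ i ∈ T <;> simp [h]

theorem cut_mem {n : ℕ} {ζ : NilCharacter n} (T : Set (Block ζ)) {A : Mat n}
    (hA : A ∈ blockMatrices ζ Set.univ) : cut ζ T A ∈ blockMatrices ζ T := by
  intro i j h
  by_cases h' : block ζ i ∈ T
  · exact ⟨(hA i j (by simpa [cut, h'] using h)).1, h'⟩
  · exact absurd (by simp [cut, h']) h

theorem cut_mul {n : ℕ} {ζ : NilCharacter n} (T : Set (Block ζ)) {A : Mat n}
    (hA : A ∈ blockMatrices ζ Set.univ) (B : Mat n) :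
    cut ζ T (A * B) = cut ζ T A * cut ζ T B := by
  ext i j
  by_cases h : block ζ i ∈ T
  · simp only [cut, LinearMap.coe_mk, AddHom.coe_mk, Matrix.of_apply, if_pos h, Matrix.mul_apply]
    refine Finset.sum_congr rfl fun k _ => ?_
    by_cases hk : A i k = 0
    · simp [hk]
    · have hk' : block ζ k ∈ T := (hA i k hk).1 ▸ h
      rw [if_pos hk']
  · simp [cut, h, Matrix.mul_apply]

/-- The projection of the even part of the Levi subalgebra onto that of the summand for `T`. -/
def projEven {n : ℕ} (ζ : NilCharacter n) (T : Set (Block ζ)) :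
    (levi ζ).even →ₗ⁅ℂ⁆ (leviPart ζ T).even where
  toFun x := ⟨cut ζ T x, cut_mem T x.2⟩
  map_add' x y := Subtype.ext (map_add (cut ζ T) x.1 y.1)
  map_smul' c x := Subtype.ext (map_smul (cut ζ T) c x.1)
  map_lie' {x y} := Subtype.ext (by
    change cut ζ T (x.1 * y.1 - y.1 * x.1) =
      cut ζ T x.1 * cut ζ T y.1 - cut ζ T y.1 * cut ζ T x.1
    rw [map_sub, cut_mul T x.2, cut_mul T y.2])

/-- The projection of the odd part of the Levi subalgebra onto that of the summand for `T`. -/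
def projOdd {n : ℕ} (ζ : NilCharacter n) (T : Set (Block ζ)) :
    (levi ζ).odd →ₗ[ℂ] (leviPart ζ T).odd where
  toFun x := ⟨cut ζ T x, cut_mem T x.2⟩
  map_add' x y := Subtype.ext (map_add (cut ζ T) x.1 y.1)
  map_smul' c x := Subtype.ext (map_smul (cut ζ T) c x.1)

open TensorProduct in
/-- The tensor product of a supermodule `V` over the summand `a` for `T` and a supermodule `W` over
the complementary summand `b`, as a supermodule over the Levi subalgebra `l = a ⊕ b`:
`x (v ⊗ w) = x_a v ⊗ w + (-1)^{|x||v|} v ⊗ x_b w`. -/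
def tensor {n : ℕ} {ζ : NilCharacter n} {T : Set (Block ζ)}
    (V : SMod.{u} (leviPart ζ T)) (W : SMod.{u} (leviPart ζ Tᶜ)) : SMod.{u} (levi ζ) where
  carrier := V ⊗[ℂ] W
  parity := map V.parity W.parity
  actEven :=
    { toFun := fun x => map (V.actEven (projEven ζ T x)) 1 + map 1 (W.actEven (projEven ζ Tᶜ x))
      map_add' := fun x y => by
        rw [map_add, map_add, map_add, map_add, map_add_left, map_add_right]; abel
      map_smul' := fun c x => by
        simp only [map_smul, map_smul_left, map_smul_right, RingHom.id_apply, smul_add]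
      map_lie' := fun {x y} => by
        ext v w
        simp [Ring.lie_def, sub_tmul, tmul_sub]
        abel }
  actOdd :=
    { toFun := fun y =>
        map (V.actOdd (projOdd ζ T y)) 1 + map V.parity (W.actOdd (projOdd ζ Tᶜ y))
      map_add' := fun x y => by
        rw [map_add, map_add, map_add, map_add, map_add_left, map_add_right]; abel
      map_smul' := fun c x => by
        simp only [map_smul, map_smul_left, map_smul_right, RingHom.id_apply, smul_add] }
  parity_mul_self := by
    have hV (v : V) := congrArg (fun f => f v) V.parity_mul_self
    have hW (w : W) := congrArg (fun f => f w) W.parity_mul_self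
    simp only [Module.End.mul_apply, Module.End.one_apply] at hV hW
    ext v w
    simp [hV, hW]
  parity_actEven := fun x => by
    have hV (v : V) := congrArg (fun f => f v) (V.parity_actEven (projEven ζ T x))
    have hW (w : W) := congrArg (fun f => f w) (W.parity_actEven (projEven ζ Tᶜ x))
    simp only [Module.End.mul_apply] at hV hW
    ext v w
    simp [hV, hW]
  parity_actOdd := fun y => by
    have hV (v : V) := congrArg (fun f => f v) (V.parity_actOdd (projOdd ζ T y))
    have hW (w : W) := congrArg (fun f => f w) (W.parity_actOdd (projOdd ζ Tᶜ y))
    simp only [Module.End.mul_apply, LinearMap.neg_apply] at hV hW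
    ext v w
    simp [hV, hW, neg_tmul, tmul_neg]
    abel
  act_even_odd := fun x y => by
    have h (T : Set (Block ζ)) : projOdd ζ T ⟨x * y - y * x, (levi ζ).even_odd_mem x x.2 y y.2⟩ =
        ⟨projEven ζ T x * projOdd ζ T y - projOdd ζ T y * projEven ζ T x,
          (leviPart ζ T).even_odd_mem _ (projEven ζ T x).2 _ (projOdd ζ T y).2⟩ :=
      Subtype.ext (by
        change cut ζ T (x.1 * y.1 - y.1 * x.1) =
          cut ζ T x.1 * cut ζ T y.1 - cut ζ T y.1 * cut ζ T x.1
        rw [map_sub, cut_mul T x.2, cut_mul T y.2])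
    have hp (v : V) := congrArg (fun f => f v) (V.parity_actEven (projEven ζ T x))
    simp only [Module.End.mul_apply] at hp
    ext v w
    simp [h, V.act_even_odd, W.act_even_odd, sub_tmul, tmul_sub, hp]
    abel
  act_odd_odd := fun y z => by
    have h (T : Set (Block ζ)) : projEven ζ T ⟨y * z + z * y, (levi ζ).odd_odd_mem y y.2 z z.2⟩ =
        ⟨projOdd ζ T y * projOdd ζ T z + projOdd ζ T z * projOdd ζ T y,
          (leviPart ζ T).odd_odd_mem _ (projOdd ζ T y).2 _ (projOdd ζ T z).2⟩ :=
      Subtype.ext (by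
        change cut ζ T (y.1 * z.1 + z.1 * y.1) =
          cut ζ T y.1 * cut ζ T z.1 + cut ζ T z.1 * cut ζ T y.1
        rw [map_add, cut_mul T y.2, cut_mul T z.2])
    have hp (y) (v : V) := congrArg (fun f => f v) (V.parity_actOdd (projOdd ζ T y))
    have hpp (v : V) := congrArg (fun f => f v) V.parity_mul_self
    simp only [Module.End.mul_apply, LinearMap.neg_apply, Module.End.one_apply] at hp hpp
    ext v w
    simp [h, V.act_odd_odd, W.act_odd_odd, add_tmul, tmul_add, neg_tmul, hp, hpp]
    abel

end Queer

end

/-!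
The tensor product `V ⊗ W` of simple modules over commuting algebras is simple when one of them
has only scalar endomorphisms, by Jacobson density. For supermodules two ingredients have to be
added.

*Schur's lemma.* Simple Whittaker supermodules may be infinite-dimensional, but their even
endomorphisms are scalars because they preserve the space of Whittaker vectors, which is nonzero
and finite-dimensional. The finiteness (`finiteDimensional_whittakerVectors`) goes back to two
facts about a module over a block diagonal Lie algebra that is generated by a finite-dimensional
space `F` of Whittaker vectors stable under the centre. First, the Gelfand invariants, which are
the traces of powers of the matrix of generators, express the last row of every block through the
other rows, by computing their symbols for the Kazhdan filtration (`kazhdan_le_mirabolicKazhdan`).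
Second, over the remaining matrix units an Euler operator built from each row shows that there are
no Whittaker vectors outside `F` (`mirabolicStage_whittaker`). The general case follows by
splitting off such submodules one at a time. An odd part of dimension `d` only contributes words
of length at most `d`, so that every nonzero supermodule satisfying the local Whittaker conditions
contains a nonzero graded submodule with a finite-dimensional space of Whittaker vectors. Where this
dimension is minimal, the Whittaker vectors generate a simple submodule
(`SMod.IsLocallyWhittaker.exists_simple`, `SMod.IsLocallyWhittaker.exists_eq_smul_id`).

*The parities.* Density, applied to the algebra of operators that includes the parity, shows that
`V ⊗ W` has no proper nonzero subspace stable under both actions and both parities. A proper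
nonzero graded submodule is therefore complementary to its conjugate under the parity `P ⊗ 1` of
the first factor (`SMod.isCompl_conj`). The involution with these two eigenspaces is contracted to
nonzero odd endomorphisms of both `V` and `W`, which is impossible if one of them is of type `M`.
Conversely, odd endomorphisms of both factors give an even involution that anticommutes with
`P ⊗ 1`, and its eigenspaces are simple and exchanged by an odd isomorphism
(`SMod.tensor_isSimple`, `SMod.tensor_isDouble`).

For completeness, let `V` be a simple submodule of the restriction of a simple `X` to the first
summand. The linear maps `V → X` that commute with this summand form a supermodule over the second
one, evaluation at a homogeneous vector embeds it into `X`, and hence it contains a simple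
submodule `W`; evaluation `V ⊗ W → X` is a nonzero homomorphism (`SMod.exists_iso_sub_tensor`).
For uniqueness, contraction with homogeneous linear forms recovers the factors
(`SMod.iso_of_iso_sub`).
-/

noncomputable section

namespace Queer

/-! ### Matrix units acting on a vector space -/

/-- The value of a character of the strictly upper triangular matrices on the matrix unit `(i, j)`
with `i < j`, in terms of its values `c i` on the superdiagonal matrix units `(i, i + 1)`. -/
def charValue (c : ℕ → ℂ) (i j : ℕ) : ℂ := if j = i + 1 then c i else 0

/-- Indices `0, …, n - 1`, some of which are partitioned into intervals, the classes of the partial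
equivalence relation `R`, together with a character that is nonzero on the superdiagonal matrix
units inside the intervals. -/
structure IsNondegenerate (n : ℕ) (R : ℕ → ℕ → Prop) (c : ℕ → ℂ) : Prop where
  symm : ∀ {i j}, R i j → R j i
  trans : ∀ {i j k}, R i j → R j k → R i k
  lt : ∀ {i j}, R i j → i < n
  convex : ∀ {i j k}, R i j → i ≤ k → k ≤ j → R i k
  ne_zero : ∀ {i}, R i (i + 1) → c i ≠ 0

/-- The elements `e i j` of a ring satisfy the commutation relations of the matrix units in the
block diagonal Lie algebra with blocks given by `R`. Outside the blocks `e i j` is zero. -/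
structure GlRelations (R : ℕ → ℕ → Prop) {A : Type*} [Ring A] (e : ℕ → ℕ → A) : Prop where
  eq_zero : ∀ {i j}, ¬R i j → e i j = 0
  comm : ∀ {i j k l}, R i j → R k l → e i j * e k l - e k l * e i j =
    (if j = k then e i l else 0) - (if l = i then e k j else 0)

section Ring

variable {n : ℕ} {R : ℕ → ℕ → Prop} {c : ℕ → ℂ} {A : Type*} [Ring A] {e : ℕ → ℕ → A}

theorem IsNondegenerate.refl (hR : IsNondegenerate n R c) {i j : ℕ} (h : R i j) : R i i :=
  hR.trans h (hR.symm h)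

theorem IsNondegenerate.lt_right (hR : IsNondegenerate n R c) {i j : ℕ} (h : R i j) : j < n :=
  hR.lt (hR.symm h)

theorem IsNondegenerate.le_of_last (hR : IsNondegenerate n R c) {i t : ℕ} (ht : ¬R t (t + 1))
    (h : R i t) : i ≤ t := by
  by_contra hlt
  exact ht (hR.convex (hR.symm h) (by omega) (by omega : t + 1 ≤ i))

theorem IsNondegenerate.succ_of_lt (hR : IsNondegenerate n R c) {i j : ℕ} (h : R i j)
    (hlt : i < j) : R i (i + 1) :=
  hR.convex h (by omega) (by omega)

theorem GlRelations.commute_left (hR : IsNondegenerate n R c) (he : GlRelations R e) {i j : ℕ}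
    (h : R i j) (k l : ℕ) : e i j * e k l - e k l * e i j =
      (if j = k then e i l else 0) - (if l = i then e k j else 0) := by
  by_cases hkl : R k l
  · exact he.comm h hkl
  · have h1 : (if j = k then e i l else 0) = 0 := by
      split_ifs with hjk
      · exact he.eq_zero fun h' => hkl (hR.trans (hR.symm (hjk ▸ h)) h')
      · rfl
    have h2 : (if l = i then e k j else 0) = 0 := by
      split_ifs with hli
      · exact he.eq_zero fun h' => hkl (hR.trans h' (hR.symm (hli ▸ h)))
      · rfl
    rw [he.eq_zero hkl, h1, h2]
    simp

/-- The entries of the powers of the matrix `(e i j)` with `0 ≤ i, j < n`. -/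
def powEntry (n : ℕ) (e : ℕ → ℕ → A) : ℕ → ℕ → ℕ → A
  | 0, i, j => if i = j then 1 else 0
  | r + 1, i, j => ∑ l ∈ Finset.range n, e i l * powEntry n e r l j

/-- The entries of a power of the matrix `(e i j)` transform under the Lie algebra like the matrix
units themselves. -/
theorem powEntry_comm (hR : IsNondegenerate n R c) (he : GlRelations R e) {a b : ℕ} (h : R a b)
    (r i j : ℕ) : e a b * powEntry n e r i j - powEntry n e r i j * e a b =
      (if b = i then powEntry n e r a j else 0) - (if j = a then powEntry n e r i b else 0) := by
  induction r generalizing i with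
  | zero =>
    simp only [powEntry, mul_ite, ite_mul, mul_one, one_mul, mul_zero, zero_mul, sub_self]
    by_cases h1 : b = i <;> by_cases h2 : a = j <;> simp [h1, h2, eq_comm]
  | succ r ih =>
    have ha := hR.lt h
    have hb := hR.lt_right h
    have key : ∀ l, e a b * (e i l * powEntry n e r l j) - e i l * powEntry n e r l j * e a b =
        ((if b = i then e a l * powEntry n e r l j else 0)
          - (if l = a then e i b * powEntry n e r l j else 0))
        + ((if b = l then e i l * powEntry n e r a j else 0)
          - (if j = a then e i l * powEntry n e r l b else 0)) := by
      intro l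
      have h1 := he.commute_left hR h i l
      have h2 := ih l
      calc _ = (e a b * e i l - e i l * e a b) * powEntry n e r l j
            + e i l * (e a b * powEntry n e r l j - powEntry n e r l j * e a b) := by noncomm_ring
        _ = _ := by
          rw [h1, h2, sub_mul, mul_sub]
          simp only [ite_mul, zero_mul, mul_ite, mul_zero]
    simp only [powEntry]
    rw [Finset.mul_sum, Finset.sum_mul, ← Finset.sum_sub_distrib, Finset.sum_congr rfl
      fun l _ => key l, Finset.sum_add_distrib, Finset.sum_sub_distrib, Finset.sum_sub_distrib]
    rw [Finset.sum_ite_eq' (Finset.range n) a, Finset.sum_ite_eq (Finset.range n) b,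
      if_pos (Finset.mem_range.2 ha), if_pos (Finset.mem_range.2 hb)]
    split_ifs <;> (simp; try abel)

open Classical in
/-- The Gelfand invariant: the trace of the `k`-th power of the block of `(e i j)` that contains
the index `t`. -/
def blockTrace (n : ℕ) (R : ℕ → ℕ → Prop) (e : ℕ → ℕ → A) (t k : ℕ) : A :=
  ∑ i ∈ (Finset.range n).filter (R · t), powEntry n e k i i

open Classical in
/-- The Gelfand invariants are central. -/
theorem blockTrace_comm (hR : IsNondegenerate n R c) (he : GlRelations R e) (a b t k : ℕ) :
    e a b * blockTrace n R e t k = blockTrace n R e t k * e a b := by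
  by_cases h : R a b
  · rw [← sub_eq_zero, blockTrace, Finset.mul_sum, Finset.sum_mul, ← Finset.sum_sub_distrib,
      Finset.sum_congr rfl fun i _ => powEntry_comm hR he h k i i, Finset.sum_sub_distrib,
      Finset.sum_ite_eq, Finset.sum_ite_eq']
    have hiff : R a t ↔ R b t := ⟨hR.trans (hR.symm h), hR.trans h⟩
    simp [hR.lt h, hR.lt_right h, hiff]
  · simp [he.eq_zero h]

theorem map_powEntry {B : Type*} [Ring B] (f : A →+* B) (r i j : ℕ) :
    f (powEntry n e r i j) = powEntry n (fun i j => f (e i j)) r i j := by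
  induction r generalizing i with
  | zero => simp only [powEntry]; split_ifs <;> simp
  | succ r ih => simp [powEntry, ih]

theorem map_blockTrace {B : Type*} [Ring B] (f : A →+* B) (t k : ℕ) :
    f (blockTrace n R e t k) = blockTrace n R (fun i j => f (e i j)) t k := by
  simp [blockTrace, map_powEntry]

end Ring

section Module

variable {n : ℕ} {R : ℕ → ℕ → Prop} {c : ℕ → ℂ} {X : Type*} [AddCommGroup X] [Module ℂ X]
  {e : ℕ → ℕ → Module.End ℂ X}

theorem GlRelations.apply_apply (he : GlRelations R e) {i j k l : ℕ} (h : R i j) (h' : R k l)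
    (v : X) : e i j (e k l v) = e k l (e i j v) + (if j = k then e i l v else 0)
      - (if l = i then e k j v else 0) := by
  have := congrArg (fun f => f v) (he.comm h h')
  simp only [LinearMap.sub_apply, Module.End.mul_apply] at this
  rw [sub_eq_iff_eq_add] at this
  rw [this]
  by_cases h1 : j = k <;> by_cases h2 : l = i <;> simp [h1, h2]
  all_goals abel

/-- The Whittaker vectors: the common eigenvectors of the matrix units above the diagonal whose
eigenvalues are given by the character. -/
def whittakerVectors (R : ℕ → ℕ → Prop) (c : ℕ → ℂ) (e : ℕ → ℕ → Module.End ℂ X) :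
    Submodule ℂ X where
  carrier := {v | ∀ i j, i < j → R i j → e i j v = charValue c i j • v}
  add_mem' := fun hv hw i j h h' => by rw [map_add, hv i j h h', hw i j h h', smul_add]
  zero_mem' := fun i j _ _ => by simp
  smul_mem' := fun a v hv i j h h' => by rw [map_smul, hv i j h h', smul_comm]

/-! ### Filtrations by words in the matrix units -/

/-- Vectors of the form `e i₁ j₁ (⋯ (e iᵣ jᵣ w))` with `w ∈ F`, all `(i, j)` satisfying `Q`, and
total degree at most `d`. -/
inductive WordVector (e : ℕ → ℕ → Module.End ℂ X) (Q : ℕ → ℕ → Prop) (deg : ℕ → ℕ → ℤ)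
    (F : Submodule ℂ X) : ℤ → X → Prop
  | base {d : ℤ} {w : X} : 0 ≤ d → w ∈ F → WordVector e Q deg F d w
  | step {d d' : ℤ} {i j : ℕ} {v : X} : Q i j → WordVector e Q deg F d v → d + deg i j ≤ d' →
      WordVector e Q deg F d' (e i j v)

/-- The filtration of the span of all word vectors by total degree. -/
def wordFiltration (e : ℕ → ℕ → Module.End ℂ X) (Q : ℕ → ℕ → Prop) (deg : ℕ → ℕ → ℤ)
    (F : Submodule ℂ X) (d : ℤ) : Submodule ℂ X :=
  Submodule.span ℂ {v | WordVector e Q deg F d v}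

section Filtration

variable {Q : ℕ → ℕ → Prop} {deg : ℕ → ℕ → ℤ} {F : Submodule ℂ X}

theorem WordVector.mono {d d' : ℤ} {v : X} (h : WordVector e Q deg F d v) (hd : d ≤ d') :
    WordVector e Q deg F d' v := by
  cases h with
  | base h0 hw => exact .base (h0.trans hd) hw
  | step hq hv hle => exact .step hq hv (hle.trans hd)

theorem WordVector.mem {d : ℤ} {v : X} (h : WordVector e Q deg F d v) :
    v ∈ wordFiltration e Q deg F d :=
  Submodule.subset_span h

theorem wordFiltration_mono {d d' : ℤ} (h : d ≤ d') :
    wordFiltration e Q deg F d ≤ wordFiltration e Q deg F d' :=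
  Submodule.span_mono fun _ hv => WordVector.mono hv h

theorem le_wordFiltration {d : ℤ} (h : 0 ≤ d) : F ≤ wordFiltration e Q deg F d :=
  fun _ hw => (WordVector.base h hw).mem

theorem wordFiltration_step {d d' : ℤ} {i j : ℕ} {v : X} (hq : Q i j)
    (hv : v ∈ wordFiltration e Q deg F d) (h : d + deg i j ≤ d') :
    e i j v ∈ wordFiltration e Q deg F d' := by
  have : wordFiltration e Q deg F d ≤ (wordFiltration e Q deg F d').comap (e i j) :=
    Submodule.span_le.2 fun w hw => (WordVector.step hq hw h).mem
  exact this hv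

theorem wordFiltration_eq_bot (hdeg : ∀ i j, Q i j → 0 ≤ deg i j) {d : ℤ} (hd : d < 0) :
    wordFiltration e Q deg F d = ⊥ := by
  have : ∀ d v, WordVector e Q deg F d v → 0 ≤ d := by
    intro d v h
    induction h with
    | base h0 _ => exact h0
    | step hq _ hle ih => exact (add_nonneg ih (hdeg _ _ hq)).trans hle
  rw [wordFiltration, eq_bot_iff, Submodule.span_le]
  intro v hv
  exact absurd (this d v hv) (not_le.2 hd)

/-- A linear map that sends word vectors into `N` sends their span into `N`. -/
theorem wordFiltration_map_le {Y : Type*} [AddCommGroup Y] [Module ℂ Y] (f : X →ₗ[ℂ] Y)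
    (N : Submodule ℂ Y) {d : ℤ} (h : ∀ v, WordVector e Q deg F d v → f v ∈ N) {v : X}
    (hv : v ∈ wordFiltration e Q deg F d) : f v ∈ N := by
  have : wordFiltration e Q deg F d ≤ N.comap f := Submodule.span_le.2 h
  exact this hv

end Filtration

/-- The smallest subspace that contains `F` and is stable under all `e i j` with `Q i j`. -/
def generated (e : ℕ → ℕ → Module.End ℂ X) (Q : ℕ → ℕ → Prop) (F : Submodule ℂ X) :
    Submodule ℂ X :=
  sInf {N | F ≤ N ∧ ∀ i j, Q i j → ∀ v ∈ N, e i j v ∈ N}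

section Generated

variable {Q Q' : ℕ → ℕ → Prop} {F F' : Submodule ℂ X}

theorem le_generated : F ≤ generated e Q F := le_sInf fun _ h => h.1

theorem generated_stable {i j : ℕ} (h : Q i j) {v : X} (hv : v ∈ generated e Q F) :
    e i j v ∈ generated e Q F := by
  rw [generated, Submodule.mem_sInf] at hv ⊢
  exact fun N hN => hN.2 i j h v (hv N hN)

theorem generated_le {N : Submodule ℂ X} (h : F ≤ N) (hN : ∀ i j, Q i j → ∀ v ∈ N, e i j v ∈ N) :
    generated e Q F ≤ N :=
  sInf_le ⟨h, hN⟩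

theorem generated_mono (h : ∀ i j, Q i j → Q' i j) (hF : F ≤ F') :
    generated e Q F ≤ generated e Q' F' :=
  generated_le (hF.trans le_generated) fun i j hq _ hv => generated_stable (h i j hq) hv

end Generated

/-! ### The Kazhdan filtration -/

/-- The Kazhdan degree of a matrix unit. -/
def kazhdanDeg (i j : ℕ) : ℤ := i - j + 1

/-- The Kazhdan filtration of the module generated by `F`, by words in the matrix units on and
below the diagonal. -/
abbrev kazhdan (R : ℕ → ℕ → Prop) (e : ℕ → ℕ → Module.End ℂ X) (F : Submodule ℂ X) (d : ℤ) :
    Submodule ℂ X :=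
  wordFiltration e (fun i j => R i j ∧ j ≤ i) kazhdanDeg F d

/-- The part of the Kazhdan filtration obtained from words that avoid the last row of each
block. -/
abbrev mirabolicKazhdan (R : ℕ → ℕ → Prop) (e : ℕ → ℕ → Module.End ℂ X) (F : Submodule ℂ X)
    (d : ℤ) : Submodule ℂ X :=
  wordFiltration e (fun i j => R i j ∧ j ≤ i ∧ R i (i + 1)) kazhdanDeg F d

variable {F : Submodule ℂ X}

theorem kazhdan_eq_bot {d : ℤ} (hd : d < 0) : kazhdan R e F d = ⊥ :=
  wordFiltration_eq_bot (fun i j h => by have := h.2; simp only [kazhdanDeg]; omega) hd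

theorem mirabolicKazhdan_le_kazhdan (d : ℤ) : mirabolicKazhdan R e F d ≤ kazhdan R e F d := by
  refine Submodule.span_le.2 fun v hv => ?_
  induction hv with
  | base h hw => exact le_wordFiltration h hw
  | step hq _ hle ih => exact wordFiltration_step ⟨hq.1, hq.2.1⟩ ih hle

/-- Modulo lower degrees, the matrix units above the diagonal act on the associated graded space of
the Kazhdan filtration by the character. -/
theorem kazhdan_upper_sub_mem (hR : IsNondegenerate n R c) (he : GlRelations R e)
    (hF : F ≤ whittakerVectors R c e) {i j : ℕ} (hij : i < j) (hr : R i j) {d : ℤ} {v : X}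
    (hv : v ∈ kazhdan R e F d) :
    e i j v - charValue c i j • v ∈ kazhdan R e F (d + (i - j)) := by
  refine wordFiltration_map_le (e i j - charValue c i j • LinearMap.id) _ ?_ hv
  clear hv v
  intro v hv
  induction hv generalizing i j with
  | @base d w h hw => simp [hF hw i j hij hr]
  | @step d' d k l v hq hv hle ih =>
    simp only [kazhdanDeg] at hle
    simp only [LinearMap.sub_apply, LinearMap.smul_apply, LinearMap.id_coe, id_eq] at ih ⊢
    have any : ∀ p q, R p q → e p q v ∈ kazhdan R e F (d' + (p - q + 1)) := by
      intro p q hpq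
      rcases le_or_gt q p with h | h
      · exact wordFiltration_step ⟨hpq, h⟩ hv.mem (by simp [kazhdanDeg])
      · have h1 := ih h hpq
        have h2 : charValue c p q • v ∈ kazhdan R e F (d' + (p - q + 1)) := by
          rw [charValue]
          split_ifs with hs
          · exact Submodule.smul_mem _ _ (wordFiltration_mono (by subst hs; simp) hv.mem)
          · simp
        have h3 := Submodule.add_mem _ (wordFiltration_mono (by omega) h1) h2
        rwa [sub_add_cancel] at h3
    rw [he.apply_apply hr hq.1]
    have e1 : e k l (e i j v - charValue c i j • v) ∈ kazhdan R e F (d + (i - j)) :=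
      wordFiltration_step hq (ih hij hr) (by simp only [kazhdanDeg]; omega)
    have e2 : (if j = k then e i l v else 0) ∈ kazhdan R e F (d + (i - j)) := by
      split_ifs with h
      · exact wordFiltration_mono (by omega) (any i l (hR.trans hr (h ▸ hq.1)))
      · simp
    have e3 : (if l = i then e k j v else 0) ∈ kazhdan R e F (d + (i - j)) := by
      split_ifs with h
      · exact wordFiltration_mono (by omega) (any k j (hR.trans hq.1 (h ▸ hr)))
      · simp
    convert Submodule.sub_mem _ (Submodule.add_mem _ e1 e2) e3 using 1
    rw [map_sub, map_smul]
    abel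

theorem kazhdan_apply_mem (hR : IsNondegenerate n R c) (he : GlRelations R e)
    (hF : F ≤ whittakerVectors R c e) {i j : ℕ} {d d' : ℤ} (hd : d + (i - j + 1) ≤ d') {v : X}
    (hv : v ∈ kazhdan R e F d) : e i j v ∈ kazhdan R e F d' := by
  by_cases hr : R i j
  · rcases le_or_gt j i with h | h
    · exact wordFiltration_step ⟨hr, h⟩ hv hd
    · have h1 := kazhdan_upper_sub_mem hR he hF h hr hv
      have h2 : charValue c i j • v ∈ kazhdan R e F d' := by
        rw [charValue]
        split_ifs with hs
        · exact Submodule.smul_mem _ _ (wordFiltration_mono (by omega) hv)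
        · simp
      have h3 := Submodule.add_mem _ (wordFiltration_mono (by omega) h1) h2
      rwa [sub_add_cancel] at h3
  · simp [he.eq_zero hr]

theorem kazhdan_commutator_mem (hR : IsNondegenerate n R c) (he : GlRelations R e)
    (hF : F ≤ whittakerVectors R c e) {i j k l : ℕ} (h : R i j) (h' : R k l) {d d' : ℤ}
    (hd : d + (i - j + 1) + (k - l + 1) - 1 ≤ d') {v : X} (hv : v ∈ kazhdan R e F d) :
    e i j (e k l v) - e k l (e i j v) ∈ kazhdan R e F d' := by
  rw [he.apply_apply h h']
  have e2 : (if j = k then e i l v else 0) ∈ kazhdan R e F d' := by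
    split_ifs with hs
    · exact kazhdan_apply_mem hR he hF (by omega) hv
    · simp
  have e3 : (if l = i then e k j v else 0) ∈ kazhdan R e F d' := by
    split_ifs with hs
    · exact kazhdan_apply_mem hR he hF (by omega) hv
    · simp
  convert Submodule.sub_mem _ e2 e3 using 1
  abel

theorem powEntry_apply_mem (hR : IsNondegenerate n R c) (he : GlRelations R e)
    (hF : F ≤ whittakerVectors R c e) (r i j : ℕ) {d d' : ℤ} (hd : d + (i - j + r) ≤ d') {v : X}
    (hv : v ∈ kazhdan R e F d) : powEntry n e r i j v ∈ kazhdan R e F d' := by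
  induction r generalizing i d' with
  | zero =>
    simp only [powEntry]
    split_ifs with h
    · exact wordFiltration_mono (by subst h; simpa using hd) hv
    · simp
  | succ r ih =>
    simp only [powEntry, LinearMap.sum_apply, Module.End.mul_apply]
    refine Submodule.sum_mem _ fun l _ => ?_
    exact kazhdan_apply_mem hR he hF (by push_cast at hd; omega) (ih l le_rfl)

/-- An entry of a power of the matrix of degree zero acts on Whittaker vectors by a product of
values of the character. -/
theorem powEntry_apply_of_add_eq (hR : IsNondegenerate n R c) (he : GlRelations R e)
    (hF : F ≤ whittakerVectors R c e) {w : X} (hw : w ∈ F) (r : ℕ) {l j : ℕ} (hlj : R l j)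
    (h : l + r = j) : powEntry n e r l j w = (∏ s ∈ Finset.Ico l j, c s) • w := by
  induction r generalizing l with
  | zero => subst h; simp [powEntry]
  | succ r ih =>
    have hl := hR.succ_of_lt hlj (by omega)
    have hw' : w ∈ kazhdan R e F 0 := le_wordFiltration le_rfl hw
    simp only [powEntry, LinearMap.sum_apply, Module.End.mul_apply]
    have hmem : ∀ m : ℕ, powEntry n e r m j w ∈ kazhdan R e F (m - j + r) := fun m =>
      powEntry_apply_mem hR he hF r m j (by omega) hw'
    rw [Finset.sum_eq_single (l + 1)]
    · have h1 := kazhdan_upper_sub_mem hR he hF (by omega) hl (hmem (l + 1))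
      rw [kazhdan_eq_bot (by push_cast; omega), Submodule.mem_bot, sub_eq_zero] at h1
      rw [h1, ih (hR.trans (hR.symm hl) hlj) (by omega), smul_smul, charValue, if_pos rfl,
        Finset.prod_eq_prod_Ico_succ_bot (by omega : l < j)]
    · intro m _ hm
      by_cases hr : R l m
      · rcases lt_or_ge l m with hlt | hge
        · have h1 := kazhdan_upper_sub_mem hR he hF hlt hr (hmem m)
          rw [kazhdan_eq_bot (by omega), Submodule.mem_bot, charValue, if_neg hm, zero_smul,
            sub_zero] at h1
          exact h1
        · have h1 := hmem m
          rw [kazhdan_eq_bot (by omega), Submodule.mem_bot] at h1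
          rw [h1, map_zero]
      · simp [he.eq_zero hr]
    · intro hn
      exact absurd (Finset.mem_range.2 (hR.lt_right hl)) hn

/-! ### Removing the last rows with the Gelfand invariants -/

/-- A matrix unit in the last row can be moved past the other letters, by induction on the degree,
so that only its action on the generating Whittaker vectors matters. -/
theorem lastRow_apply_mem (hR : IsNondegenerate n R c) (he : GlRelations R e)
    (hF : F ≤ whittakerVectors R c e) {d : ℤ}
    (ih : ∀ d' < d, kazhdan R e F d' ≤ mirabolicKazhdan R e F d') {t j : ℕ} (htj : R t j)
    (hjt : j ≤ t) (hbase : ∀ w ∈ F, e t j w ∈ mirabolicKazhdan R e F d) {d' : ℤ}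
    (hd : d' + (t - j + 1) ≤ d) {v : X} (hv : v ∈ kazhdan R e F d') :
    e t j v ∈ mirabolicKazhdan R e F d := by
  refine wordFiltration_map_le (e t j) _ ?_ (ih d' (by omega) hv)
  intro v hv
  cases hv with
  | base _ hw => exact hbase _ hw
  | @step d'' _ k l v hq hv hle =>
    simp only [kazhdanDeg] at hle
    have hlk := hq.2.1
    have hv' : v ∈ kazhdan R e F d'' := mirabolicKazhdan_le_kazhdan _ hv.mem
    have h1 := kazhdan_commutator_mem hR he hF (d' := d - 1) htj hq.1 (by omega) hv'
    have h2 := wordFiltration_mono (by omega) (ih (d - 1) (by omega) h1)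
      (d' := d)
    have h3 : e t j v ∈ mirabolicKazhdan R e F (d'' + (t - j + 1)) :=
      ih _ (by omega) (kazhdan_apply_mem hR he hF le_rfl hv')
    have h4 : e k l (e t j v) ∈ mirabolicKazhdan R e F d :=
      wordFiltration_step hq h3 (by simp only [kazhdanDeg]; omega)
    have h5 := Submodule.add_mem _ h2 h4
    rwa [sub_add_cancel] at h5

/-- The symbol of an entry of a power of the matrix `(e i j)`, modulo words that avoid the last
rows. The only remaining term comes from the matrix unit `(t, j₀)` whose degree equals the degree
of the entry; all other letters in that term are superdiagonal. -/
theorem powEntry_symbol (hR : IsNondegenerate n R c) (he : GlRelations R e)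
    (hF : F ≤ whittakerVectors R c e) {t j₀ : ℕ} (ht : ¬R t (t + 1)) (htj : R t j₀)
    (ih : ∀ d' < ((t : ℤ) - j₀ + 1), kazhdan R e F d' ≤ mirabolicKazhdan R e F d') {w : X}
    (hw : w ∈ F) (r i j : ℕ) (hi : R i t) (hij : R i j) (hd : (i : ℤ) - j + r = t - j₀ + 1) :
    powEntry n e r i j w -
      (if j₀ ≤ j then (∏ s ∈ Finset.Ico i t, c s) * ∏ s ∈ Finset.Ico j₀ j, c s else 0) • e t j₀ w
      ∈ mirabolicKazhdan R e F (t - j₀ + 1) := by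
  have hj₀ := hR.le_of_last ht (hR.symm htj)
  have hw' : w ∈ kazhdan R e F 0 := le_wordFiltration le_rfl hw
  induction r generalizing i with
  | zero =>
    have hit := hR.le_of_last ht hi
    rw [powEntry, if_neg (by omega), if_neg (by push_cast at hd; omega)]
    simp
  | succ r ihr =>
    push_cast at hd
    have hit := hR.le_of_last ht hi
    have hmem : ∀ m : ℕ, powEntry n e r m j w ∈ kazhdan R e F (m - j + r) := fun m =>
      powEntry_apply_mem hR he hF r m j (by omega) hw'
    simp only [powEntry, LinearMap.sum_apply, Module.End.mul_apply]
    have single : ∀ l₀ < n, ∀ x : X,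
        e i l₀ (powEntry n e r l₀ j w) - x ∈ mirabolicKazhdan R e F (t - j₀ + 1) →
        (∀ l, l ≠ l₀ → R i l →
          e i l (powEntry n e r l j w) ∈ mirabolicKazhdan R e F (t - j₀ + 1)) →
        (∑ l ∈ Finset.range n, e i l (powEntry n e r l j w)) - x
          ∈ mirabolicKazhdan R e F (t - j₀ + 1) := by
      intro l₀ hl₀ x h1 h2
      rw [← Finset.add_sum_erase _ _ (Finset.mem_range.2 hl₀), add_sub_right_comm]
      refine Submodule.add_mem _ h1 (Submodule.sum_mem _ fun l hl => ?_)
      by_cases hr : R i l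
      · exact h2 l (Finset.ne_of_mem_erase hl) hr
      · simp [he.eq_zero hr]
    rcases hit.lt_or_eq with hlt | rfl
    · have hsucc := hR.succ_of_lt hi hlt
      refine single (i + 1) (hR.lt_right hsucc) _ ?_ ?_
      · have h1 := kazhdan_upper_sub_mem hR he hF (by omega) hsucc (hmem (i + 1))
        have h2 := wordFiltration_mono (by push_cast; omega)
          (ih _ (by push_cast; omega) h1) (d' := (t - j₀ + 1 : ℤ))
        have h3 := Submodule.smul_mem _ (c i) (ihr (i + 1) (hR.trans (hR.symm hsucc) hi)
          (hR.trans (hR.symm hsucc) hij) (by push_cast; omega))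
        convert Submodule.add_mem _ h2 h3 using 1
        rw [charValue, if_pos rfl, smul_sub, smul_smul, mul_ite, mul_zero, ← mul_assoc,
          ← Finset.prod_eq_prod_Ico_succ_bot hlt]
        abel
      · intro l hl hr
        rcases lt_or_ge i l with hil | hil
        · have h1 := kazhdan_upper_sub_mem hR he hF hil hr (hmem l)
          rw [charValue, if_neg hl, zero_smul, sub_zero] at h1
          exact wordFiltration_mono (by omega) (ih _ (by omega) h1)
        · exact wordFiltration_step ⟨hr, hil, hsucc⟩ (ih _ (by omega) (hmem l))
            (by simp only [kazhdanDeg]; omega)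
    · refine single j₀ (hR.lt_right htj) _ ?_ ?_
      · rw [powEntry_apply_of_add_eq hR he hF hw r (hR.trans (hR.symm htj) hij) (by omega),
          map_smul, if_pos (by omega), Finset.Ico_self, Finset.prod_empty, one_mul, sub_self]
        exact Submodule.zero_mem _
      · intro l hl hr
        have hlt := hR.le_of_last ht (hR.symm hr)
        rcases lt_or_gt_of_ne hl with hlj | hlj
        · have h1 := hmem l
          rw [kazhdan_eq_bot (by omega), Submodule.mem_bot] at h1
          rw [h1, map_zero]
          exact Submodule.zero_mem _
        · refine lastRow_apply_mem hR he hF ih hr hlt (fun w hw => ?_) (by omega) (hmem l)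
          exact wordFiltration_mono (by omega) (ih (i - l + 1) (by omega)
            (kazhdan_apply_mem hR he hF (by omega) (le_wordFiltration le_rfl hw)))

open Classical in
/-- If the space `F` of Whittaker vectors is stable under the Gelfand invariants, then the last
rows of the blocks are not needed to generate the module from `F`: the Gelfand invariant of degree
`t - j₀ + 1` expresses the matrix unit `(t, j₀)` through the other ones. -/
theorem kazhdan_le_mirabolicKazhdan (hR : IsNondegenerate n R c) (he : GlRelations R e)
    (hF : F ≤ whittakerVectors R c e) (hC : ∀ t k, ∀ w ∈ F, blockTrace n R e t k w ∈ F) (d : ℤ) :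
    kazhdan R e F d ≤ mirabolicKazhdan R e F d := by
  suffices h : ∀ m : ℕ, ∀ d : ℤ, d < m → kazhdan R e F d ≤ mirabolicKazhdan R e F d by
    exact h (d + 1).toNat d (by omega)
  intro m
  induction m with
  | zero =>
    intro d hd
    rw [kazhdan_eq_bot (by exact_mod_cast hd)]
    exact bot_le
  | succ m ihm =>
    intro d hd
    push_cast at hd
    have ih : ∀ d' < d, kazhdan R e F d' ≤ mirabolicKazhdan R e F d' := fun d' h' =>
      ihm d' (by omega)
    refine Submodule.span_le.2 fun v hv => ?_
    cases hv with
    | base h hw => exact le_wordFiltration h hw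
    | @step d' _ t j₀ v hq hv hle =>
      obtain ⟨htj, hjt⟩ := hq
      simp only [kazhdanDeg] at hle
      by_cases hv0 : v = 0
      · simp [hv0]
      have hd' : 0 ≤ d' := by
        by_contra hneg
        have : v ∈ kazhdan R e F d' := hv.mem
        rw [kazhdan_eq_bot (by omega), Submodule.mem_bot] at this
        exact hv0 this
      by_cases ht : R t (t + 1)
      · exact wordFiltration_step ⟨htj, hjt, ht⟩ (ih d' (by omega) hv.mem) hle
      refine lastRow_apply_mem hR he hF ih htj hjt (fun w hw => ?_) hle hv.mem
      have hsum : blockTrace n R e t (t - j₀ + 1) w -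
          ∑ i ∈ (Finset.range n).filter (R · t),
            (if j₀ ≤ i then ∏ s ∈ Finset.Ico j₀ t, c s else 0) • e t j₀ w ∈
              mirabolicKazhdan R e F (t - j₀ + 1) := by
        rw [blockTrace, LinearMap.sum_apply, ← Finset.sum_sub_distrib]
        refine Submodule.sum_mem _ fun i hi => ?_
        have hit := (Finset.mem_filter.1 hi).2
        convert powEntry_symbol hR he hF ht htj (fun d' h' => ih d' (by omega)) hw
          (t - j₀ + 1) i i hit (hR.refl hit) (by omega) using 4
        rw [mul_comm, Finset.prod_Ico_consecutive _ ‹_› (hR.le_of_last ht hit)]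
      have hFle : F ≤ mirabolicKazhdan R e F (t - j₀ + 1) := le_wordFiltration (by omega)
      have h1 := Submodule.sub_mem _ (hFle (hC t (t - j₀ + 1) w hw)) hsum
      rw [sub_sub_cancel, ← Finset.sum_smul] at h1
      refine wordFiltration_mono (by omega : (t : ℤ) - j₀ + 1 ≤ d)
        ((Submodule.smul_mem_iff _ ?_).1 h1)
      rw [← Finset.sum_filter, Finset.sum_const, nsmul_eq_mul]
      refine mul_ne_zero ?_ (Finset.prod_ne_zero_iff.2 fun s hs => hR.ne_zero ?_)
      · have ht' : t ∈ ((Finset.range n).filter (R · t)).filter (j₀ ≤ ·) := by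
          simp [hR.lt htj, hR.refl htj, hjt]
        exact_mod_cast (Finset.card_pos.2 ⟨t, ht'⟩).ne'
      · have hs := Finset.mem_Ico.1 hs
        have h1 := hR.convex (hR.symm htj) hs.1 hs.2.le
        have h2 := hR.convex (hR.symm htj) (hs.1.trans (Nat.le_succ s)) (Nat.succ_le_of_lt hs.2)
        exact hR.trans (hR.symm h1) h2

end Module

end Queer

end

noncomputable section

namespace Queer

/-! ### Whittaker vectors of modules generated by Whittaker vectors -/

section Module

variable {n : ℕ} {R : ℕ → ℕ → Prop} {c : ℕ → ℂ} {X : Type*} [AddCommGroup X] [Module ℂ X]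
  {e : ℕ → ℕ → Module.End ℂ X} {F : Submodule ℂ X}

/-- The submodule generated by `F` under the matrix units in the first `k` rows and the first
`k + 1` columns that do not lie in the last row of a block. -/
def mirabolicStage (R : ℕ → ℕ → Prop) (e : ℕ → ℕ → Module.End ℂ X) (F : Submodule ℂ X) (k : ℕ) :
    Submodule ℂ X :=
  generated e (fun i j => R i j ∧ R i (i + 1) ∧ i < k ∧ j ≤ k) F

/-- The matrix units above the diagonal in the columns beyond `k` act on the stage `k` by the
character. -/
theorem mirabolicStage_upper (hR : IsNondegenerate n R c) (he : GlRelations R e)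
    (hF : F ≤ whittakerVectors R c e) {k i j : ℕ} (hij : i < j) (hr : R i j) (hk : k < j) {v : X}
    (hv : v ∈ mirabolicStage R e F k) : e i j v = charValue c i j • v := by
  let N : Submodule ℂ X :=
    { carrier := {v | ∀ i j, i < j → R i j → k < j → e i j v = charValue c i j • v}
      add_mem' := fun hv hw i j h h' hk => by
        rw [map_add, hv i j h h' hk, hw i j h h' hk, smul_add]
      zero_mem' := fun i j _ _ _ => by simp
      smul_mem' := fun a v hv i j h h' hk => by rw [map_smul, hv i j h h' hk, smul_comm] }
  have hN : mirabolicStage R e F k ≤ N := by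
    refine generated_le (fun w hw i j h h' _ => hF hw i j h h') ?_
    rintro a b ⟨hab, -, ha, hb⟩ v hv i j hij hr hk
    rw [he.apply_apply hr hab, hv i j hij hr hk, if_neg (by omega), map_smul]
    split_ifs with hbi
    · rw [hv a j (by omega) (hR.trans hab (hbi ▸ hr)) hk, charValue, charValue,
        if_neg (by omega : ¬j = a + 1)]
      simp
    · simp
  exact hN hv i j hij hr hk

/-- The stage `k + 1` filtered by the number of matrix units from the row `k`, over the
stage `k`. -/
abbrev rowFiltration (R : ℕ → ℕ → Prop) (e : ℕ → ℕ → Module.End ℂ X) (F : Submodule ℂ X) (k : ℕ)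
    (d : ℤ) : Submodule ℂ X :=
  wordFiltration e (fun i j => i = k ∧ R k j ∧ j ≤ k) (fun _ _ => 1) (mirabolicStage R e F k) d

theorem rowFiltration_stable (hR : IsNondegenerate n R c) (he : GlRelations R e) {k i j : ℕ}
    (hik : i < k) (hjk : j ≤ k) (hr : R i j) (hs : R i (i + 1)) {d : ℤ} {v : X}
    (hv : v ∈ rowFiltration R e F k d) : e i j v ∈ rowFiltration R e F k d := by
  refine wordFiltration_map_le (e i j) _ ?_ hv
  clear hv v
  intro v hv
  induction hv generalizing j with
  | base h hw => exact le_wordFiltration h (generated_stable ⟨hr, hs, hik, hjk⟩ hw)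
  | @step d' d p l v hq hv hle ih =>
    obtain ⟨rfl, hpl, hlp⟩ := hq
    rw [he.apply_apply hr hpl]
    refine Submodule.sub_mem _ (Submodule.add_mem _ ?_ ?_) ?_
    · exact wordFiltration_step ⟨rfl, hpl, hlp⟩ (ih hjk hr) hle
    · split_ifs with h
      · exact wordFiltration_mono (by omega) (ih hlp (hR.trans hr (h ▸ hpl)))
      · simp
    · split_ifs with h
      · exact wordFiltration_step ⟨rfl, hR.trans hpl (h ▸ hr), hjk⟩ hv.mem hle
      · simp

/-- The matrix units of the column `k + 1` minus their characters remove a letter of the row `k`. -/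
theorem rowFiltration_upper_sub_mem (hR : IsNondegenerate n R c) (he : GlRelations R e)
    (hF : F ≤ whittakerVectors R c e) {k i : ℕ} (hk : R k (k + 1)) (hik : i ≤ k)
    (hr : R i (k + 1)) {d : ℤ} {v : X} (hv : v ∈ rowFiltration R e F k d) :
    e i (k + 1) v - charValue c i (k + 1) • v ∈ rowFiltration R e F k (d - 1) := by
  refine wordFiltration_map_le (e i (k + 1) - charValue c i (k + 1) • LinearMap.id) _ ?_ hv
  clear hv v
  intro v hv
  simp only [LinearMap.sub_apply, LinearMap.smul_apply, LinearMap.id_coe, id_eq]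
  induction hv generalizing i with
  | base h hw =>
    rw [mirabolicStage_upper hR he hF (by omega) hr (by omega) hw, sub_self]
    exact Submodule.zero_mem _
  | @step d' d p l v hq hv hle ih =>
    obtain ⟨rfl, hpl, hlp⟩ := hq
    rw [he.apply_apply hr hpl, if_neg (by omega)]
    have h1 : e p l (e i (p + 1) v - charValue c i (p + 1) • v) ∈ rowFiltration R e F p (d - 1) :=
      wordFiltration_step ⟨rfl, hpl, hlp⟩ (ih hik hr) (by omega)
    have h2 : (if l = i then e p (p + 1) v else 0) ∈ rowFiltration R e F p (d - 1) := by
      split_ifs with h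
      · have h3 := wordFiltration_mono (by omega) (ih le_rfl hk) (d' := d - 1)
        have h4 := Submodule.smul_mem _ (charValue c p (p + 1))
          (wordFiltration_mono (by omega : d' ≤ d - 1) hv.mem)
        have h5 := Submodule.add_mem _ h3 h4
        rwa [sub_add_cancel] at h5
      · simp
    convert Submodule.sub_mem _ h1 h2 using 1
    rw [map_sub, map_smul]
    abel

theorem mirabolicStage_succ_le (hR : IsNondegenerate n R c) (he : GlRelations R e)
    (hF : F ≤ whittakerVectors R c e) {k : ℕ} (hk : R k (k + 1)) {v : X}
    (hv : v ∈ mirabolicStage R e F (k + 1)) : ∃ d : ℕ, v ∈ rowFiltration R e F k d := by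
  have hdir : Directed (· ≤ ·) fun d : ℕ => rowFiltration R e F k d :=
    Monotone.directed_le fun a b h => wordFiltration_mono (by exact_mod_cast h)
  rw [← Submodule.mem_iSup_of_directed _ hdir]
  revert v
  change mirabolicStage R e F (k + 1) ≤ ⨆ d : ℕ, rowFiltration R e F k d
  refine generated_le ?_ ?_
  · refine le_iSup_of_le 0 (le_generated.trans (le_wordFiltration le_rfl))
  · rintro i j ⟨hr, hs, hik, hjk⟩ v hv
    rw [Submodule.mem_iSup_of_directed _ hdir] at hv ⊢
    obtain ⟨d, hd⟩ := hv
    rcases Nat.lt_or_ge k j with hj | hj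
    · obtain rfl : j = k + 1 := by omega
      have h1 := wordFiltration_mono (by omega)
        (rowFiltration_upper_sub_mem hR he hF hk (by omega) hr hd) (d' := (d : ℤ))
      have h2 := Submodule.add_mem _ h1 (Submodule.smul_mem _ (charValue c i (k + 1)) hd)
      rw [sub_add_cancel] at h2
      exact ⟨d, h2⟩
    · rcases Nat.lt_or_ge i k with hi | hi
      · exact ⟨d, rowFiltration_stable hR he hi hj hr hs hd⟩
      · obtain rfl : i = k := by omega
        exact ⟨d + 1, wordFiltration_step ⟨rfl, hr, hj⟩ hd (by push_cast; rfl)⟩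

open Classical in
/-- The Euler operator of the row `k`. -/
def rowEuler (R : ℕ → ℕ → Prop) (c : ℕ → ℂ) (e : ℕ → ℕ → Module.End ℂ X) (k : ℕ) :
    Module.End ℂ X :=
  ∑ l ∈ (Finset.range (k + 1)).filter (R k),
    e k l * (e l (k + 1) - charValue c l (k + 1) • LinearMap.id)

open Classical in
/-- The Euler operator acts on the associated graded space of the filtration by row letters as a
nonzero multiple of the degree. -/
theorem rowEuler_add_mem (hR : IsNondegenerate n R c) (he : GlRelations R e)
    (hF : F ≤ whittakerVectors R c e) {k : ℕ} (hk : R k (k + 1)) {d : ℤ} {v : X}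
    (hv : v ∈ rowFiltration R e F k d) :
    rowEuler R c e k v + (d * c k) • v ∈ rowFiltration R e F k (d - 1) := by
  have expand : ∀ v, rowEuler R c e k v = ∑ l ∈ (Finset.range (k + 1)).filter (R k),
      e k l (e l (k + 1) v - charValue c l (k + 1) • v) := by
    intro v
    simp [rowEuler]
  have hfil : ∀ l ∈ (Finset.range (k + 1)).filter (R k), R k l ∧ l ≤ k := by
    intro l hl
    simp only [Finset.mem_filter, Finset.mem_range] at hl
    exact ⟨hl.2, by omega⟩
  refine wordFiltration_map_le (rowEuler R c e k + (d * c k) • LinearMap.id) _ ?_ hv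
  clear hv v
  intro v hv
  simp only [LinearMap.add_apply, LinearMap.smul_apply, LinearMap.id_coe, id_eq]
  induction hv with
  | @base d w h hw =>
    have h0 : rowEuler R c e k w = 0 := by
      rw [expand]
      refine Finset.sum_eq_zero fun l hl => ?_
      obtain ⟨hkl, hl⟩ := hfil l hl
      rw [mirabolicStage_upper hR he hF (by omega) (hR.trans (hR.symm hkl) hk) (by omega) hw,
        sub_self, map_zero]
    rw [h0, zero_add]
    rcases h.eq_or_lt with rfl | hlt
    · simp
    · exact Submodule.smul_mem _ _ (le_wordFiltration (by omega) hw)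
  | @step d' d p j v hq hv hle ih =>
    obtain ⟨rfl, hpj, hjp⟩ := hq
    have hstep : e p j v ∈ rowFiltration R e F p (d' + 1) :=
      wordFiltration_step ⟨rfl, hpj, hjp⟩ hv.mem le_rfl
    suffices h : rowEuler R c e p (e p j v) + ((d' + 1 : ℤ) * c p) • e p j v
        ∈ rowFiltration R e F p d' by
      rcases hle.eq_or_lt with rfl | hlt
      · convert h using 1
        simp
      · have h1 := wordFiltration_mono (by omega) h (d' := d - 1)
        have h2 := Submodule.smul_mem _ (((d - (d' + 1) : ℤ) : ℂ) * c p)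
          (wordFiltration_mono (by omega : d' + 1 ≤ d - 1) hstep)
        convert Submodule.add_mem _ h1 h2 using 1
        rw [add_assoc, ← add_smul]
        congr 2
        push_cast
        ring
    have hterm : ∀ l ∈ (Finset.range (p + 1)).filter (R p),
        e p l (e l (p + 1) (e p j v) - charValue c l (p + 1) • e p j v)
          + (if j = l then c p • e p l v else 0)
          - e p j (e p l (e l (p + 1) v - charValue c l (p + 1) • v))
        ∈ rowFiltration R e F p d' := by
      intro l hl
      obtain ⟨hpl, hlp⟩ := hfil l hl
      have hr := hR.trans (hR.symm hpl) hk
      set u := e l (p + 1) v - charValue c l (p + 1) • v with hu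
      have hu' : u ∈ rowFiltration R e F p (d' - 1) :=
        rowFiltration_upper_sub_mem hR he hF hk hlp hr hv.mem
      have e1 : e l (p + 1) (e p j v) - charValue c l (p + 1) • e p j v =
          e p j u - (if j = l then e p (p + 1) v else 0) := by
        rw [he.apply_apply hr hpj, if_neg (by omega), hu, map_sub, map_smul]
        abel
      have e2 : e p l (e p j u) = e p j (e p l u) + (if l = p then e p j u else 0)
          - (if j = p then e p l u else 0) := he.apply_apply hpl hpj u
      have m1 : (if l = p then e p j u else 0) ∈ rowFiltration R e F p d' := by
        split_ifs
        · exact wordFiltration_step ⟨rfl, hpj, hjp⟩ hu' (by omega)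
        · simp
      have m2 : (if j = p then e p l u else 0) ∈ rowFiltration R e F p d' := by
        split_ifs
        · exact wordFiltration_step ⟨rfl, hpl, hlp⟩ hu' (by omega)
        · simp
      have m3 : (if j = l then e p l (e p (p + 1) v - charValue c p (p + 1) • v) else 0)
          ∈ rowFiltration R e F p d' := by
        split_ifs
        · exact wordFiltration_step ⟨rfl, hpl, hlp⟩
            (rowFiltration_upper_sub_mem hR he hF hk le_rfl hk hv.mem) (by omega)
        · simp
      convert Submodule.sub_mem _ (Submodule.sub_mem _ m1 m2) m3 using 1
      rw [e1, map_sub, e2]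
      split_ifs with h1 <;> simp [charValue, h1] <;> abel
    have hsum := Submodule.sum_mem _ hterm
    rw [Finset.sum_sub_distrib, Finset.sum_add_distrib, ← expand, ← map_sum, ← expand,
      Finset.sum_ite_eq, if_pos (by simp [hpj]; omega)] at hsum
    have h1 : e p j (rowEuler R c e p v + (d' * c p) • v) ∈ rowFiltration R e F p d' :=
      wordFiltration_step ⟨rfl, hpj, hjp⟩ ih (by omega)
    convert Submodule.add_mem _ hsum h1 using 1
    rw [map_add, map_smul]
    push_cast
    rw [add_mul, one_mul, add_smul]
    abel

/-- Descent along the stages: a Whittaker vector is killed by the Euler operator of the row `k`,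
so it cannot involve letters of that row. -/
theorem mirabolicStage_whittaker (hR : IsNondegenerate n R c) (he : GlRelations R e)
    (hF : F ≤ whittakerVectors R c e) {k : ℕ} {v : X} (hv : v ∈ mirabolicStage R e F k)
    (hw : v ∈ whittakerVectors R c e) : v ∈ F := by
  induction k with
  | zero =>
    have : mirabolicStage R e F 0 ≤ F :=
      generated_le le_rfl fun i j h => absurd h.2.2.1 (Nat.not_lt_zero i)
    exact this hv
  | succ k ih =>
    refine ih ?_
    by_cases hk : R k (k + 1)
    · obtain ⟨d, hd⟩ := mirabolicStage_succ_le hR he hF hk hv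
      have h0 : rowEuler R c e k v = 0 := by
        simp only [rowEuler, LinearMap.sum_apply, Module.End.mul_apply]
        refine Finset.sum_eq_zero fun l hl => ?_
        simp only [Finset.mem_filter, Finset.mem_range] at hl
        simp [hw l (k + 1) hl.1 (hR.trans (hR.symm hl.2) hk)]
      have hdesc : v ∈ rowFiltration R e F k 0 := by
        induction d with
        | zero => exact_mod_cast hd
        | succ d ihd =>
          refine ihd ?_
          have h1 := rowEuler_add_mem hR he hF hk hd
          rw [h0, zero_add, Submodule.smul_mem_iff] at h1
          · exact wordFiltration_mono (by push_cast; omega) h1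
          · exact mul_ne_zero (by exact_mod_cast Nat.succ_ne_zero d) (hR.ne_zero hk)
      have hle : rowFiltration R e F k 0 ≤ mirabolicStage R e F k := by
        have hneg : ∀ d v, WordVector e (fun i j => i = k ∧ R k j ∧ j ≤ k) (fun _ _ => 1)
            (mirabolicStage R e F k) d v → d < 0 → v = 0 := fun d v h hd => by
          have := h.mem
          rw [wordFiltration_eq_bot (fun _ _ _ => zero_le_one) hd] at this
          exact (Submodule.mem_bot ℂ).1 this
        refine Submodule.span_le.2 fun u hu => ?_
        cases hu with
        | base _ h => exact h
        | step _ h hle => rw [hneg _ _ h (by omega), map_zero]; exact Submodule.zero_mem _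
      exact hle hdesc
    · refine generated_mono ?_ le_rfl hv
      rintro i j ⟨hr, hs, hi, hj⟩
      have hik : i ≠ k := fun h => hk (h ▸ hs)
      have hjk : j ≠ k + 1 := by
        rintro rfl
        exact hk (hR.trans (hR.symm (hR.convex hr (by omega) (by omega))) hr)
      exact ⟨hr, hs, by omega, by omega⟩

/-- The Whittaker vectors of the module generated by a space `F` of Whittaker vectors that is
stable under the Gelfand invariants lie in `F`. -/
theorem whittakerVectors_inf_generated_le (hR : IsNondegenerate n R c) (he : GlRelations R e)
    (hF : F ≤ whittakerVectors R c e) (hC : ∀ t k, ∀ w ∈ F, blockTrace n R e t k w ∈ F) :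
    whittakerVectors R c e ⊓ generated e R F ≤ F := by
  rintro v ⟨hw, hv⟩
  refine mirabolicStage_whittaker hR he hF (k := n) ?_ hw
  have hdir : Directed (· ≤ ·) fun d : ℕ => kazhdan R e F d :=
    Monotone.directed_le fun a b h => wordFiltration_mono (by exact_mod_cast h)
  have h1 : generated e R F ≤ ⨆ d : ℕ, kazhdan R e F d := by
    refine generated_le (le_iSup_of_le 0 (le_wordFiltration le_rfl)) fun i j hr v hv => ?_
    rw [Submodule.mem_iSup_of_directed _ hdir] at hv ⊢
    obtain ⟨d, hd⟩ := hv
    exact ⟨d + i + 1, kazhdan_apply_mem hR he hF (by push_cast; omega) hd⟩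
  obtain ⟨d, hd⟩ := (Submodule.mem_iSup_of_directed _ hdir).1 (h1 hv)
  have h2 : ∀ d, mirabolicKazhdan R e F d ≤ mirabolicStage R e F n := by
    refine fun d => Submodule.span_le.2 fun u hu => ?_
    induction hu with
    | base _ h => exact le_generated h
    | step hq _ _ ih =>
      exact generated_stable ⟨hq.1, hq.2.2, hR.lt hq.1, (hR.lt_right hq.1).le⟩ ih
  exact h2 d (kazhdan_le_mirabolicKazhdan hR he hF hC d hd)

/-! ### Existence and finiteness of Whittaker vectors -/

/-- A nonzero vector killed by a power of `f` has an iterate that is nonzero and killed by `f`. -/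
theorem exists_pow_apply_ne_zero (f : Module.End ℂ X) {v : X} (hv : v ≠ 0)
    (h : ∃ m : ℕ, (f ^ m) v = 0) : ∃ m : ℕ, (f ^ m) v ≠ 0 ∧ f ((f ^ m) v) = 0 := by
  classical
  have hpos : Nat.find h ≠ 0 := fun h0 => hv (by simpa [h0] using Nat.find_spec h)
  obtain ⟨m, hm⟩ := Nat.exists_eq_succ_of_ne_zero hpos
  refine ⟨m, Nat.find_min h (by omega), ?_⟩
  have := Nat.find_spec h
  rwa [hm, pow_succ', Module.End.mul_apply] at this

/-- The matrix units above the diagonal are treated in the order of decreasing height. On the common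
eigenspace of those already treated, the remaining ones commute. -/
theorem exists_whittakerVector (hR : IsNondegenerate n R c) (he : GlRelations R e)
    (hnil : ∀ i j, i < j → R i j → ∀ v, ∃ m : ℕ, ((e i j - charValue c i j • 1) ^ m) v = 0)
    {E : Submodule ℂ X} (hE : E ≠ ⊥) (hst : ∀ i j, i < j → R i j → ∀ v ∈ E, e i j v ∈ E) :
    ∃ w ∈ E, w ≠ 0 ∧ w ∈ whittakerVectors R c e := by
  have key : ∀ s : ℕ, ∃ N ≤ E, N ≠ ⊥ ∧ (∀ i j, i < j → R i j → ∀ v ∈ N, e i j v ∈ N) ∧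
      ∀ i j, i < j → R i j → (n - (j - i)) * n + i < s → ∀ v ∈ N,
        e i j v = charValue c i j • v := by
    intro s
    induction s with
    | zero => exact ⟨E, le_rfl, hE, hst, fun i j _ _ h => absurd h (Nat.not_lt_zero _)⟩
    | succ s ih =>
      obtain ⟨N, hNE, hN0, hNst, hN⟩ := ih
      by_cases hex : ∃ i j, i < j ∧ R i j ∧ (n - (j - i)) * n + i = s
      · obtain ⟨i, j, hij, hr, hs⟩ := hex
        have hjn := hR.lt_right hr
        have hmore : ∀ a b, a < b → R a b → j - i < b - a → ∀ v ∈ N, e a b v = 0 := by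
          intro a b hab hr' hlt v hv
          have hbn := hR.lt_right hr'
          rw [hN a b hab hr' ?_ v hv, charValue, if_neg (by omega), zero_smul]
          rw [← hs]
          have h1 : (n - (b - a)) + 1 ≤ n - (j - i) := by omega
          calc (n - (b - a)) * n + a < (n - (b - a)) * n + n := by omega
            _ = ((n - (b - a)) + 1) * n := by ring
            _ ≤ (n - (j - i)) * n := Nat.mul_le_mul_right _ h1
            _ ≤ _ := Nat.le_add_right _ _
        let N' : Submodule ℂ X := N ⊓ LinearMap.ker (e i j - charValue c i j • 1)
        have memN' : ∀ v, v ∈ N' ↔ v ∈ N ∧ e i j v = charValue c i j • v := by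
          intro v
          simp [N', sub_eq_zero]
        refine ⟨N', inf_le_left.trans hNE, ?_, ?_, ?_⟩
        · obtain ⟨v, hv, hv0⟩ := N.ne_bot_iff.1 hN0
          obtain ⟨m, hm0, hm⟩ := exists_pow_apply_ne_zero _ hv0 (hnil i j hij hr v)
          refine N'.ne_bot_iff.2 ⟨_, ⟨?_, hm⟩, hm0⟩
          clear hm0 hm
          induction m with
          | zero => simpa using hv
          | succ m ihm =>
            rw [pow_succ', Module.End.mul_apply]
            exact N.sub_mem (hNst i j hij hr _ ihm) (N.smul_mem _ ihm)
        · intro a b hab hr' v hv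
          rw [memN'] at hv ⊢
          refine ⟨hNst a b hab hr' v hv.1, ?_⟩
          rw [he.apply_apply hr hr', hv.2, map_smul]
          have h1 : (if j = a then e i b v else 0) = 0 := by
            split_ifs with h
            · exact hmore i b (by omega) (hR.trans hr (h ▸ hr')) (by omega) v hv.1
            · rfl
          have h2 : (if b = i then e a j v else 0) = 0 := by
            split_ifs with h
            · exact hmore a j (by omega) (hR.trans hr' (h ▸ hr)) (by omega) v hv.1
            · rfl
          rw [h1, h2, add_zero, sub_zero]
        · intro a b hab hr' hlt v hv
          rw [memN'] at hv
          rcases Nat.lt_succ_iff_lt_or_eq.1 hlt with h | h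
          · exact hN a b hab hr' h v hv.1
          · have hbn := hR.lt_right hr'
            -- the rank determines the pair of indices
            have e1 : ∀ x y : ℕ, x < n → (y * n + x) % n = x := fun x y hx => by
              rw [Nat.mul_add_mod', Nat.mod_eq_of_lt hx]
            have e2 : ∀ x y : ℕ, x < n → (y * n + x) / n = y := fun x y hx => by
              rw [Nat.mul_comm, Nat.mul_add_div (by omega), Nat.div_eq_of_lt hx, add_zero]
            have hai : a = i := by
              rw [← e1 a (n - (b - a)) (by omega), ← e1 i (n - (j - i)) (by omega), h, hs]
            have hba : n - (b - a) = n - (j - i) := by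
              rw [← e2 a (n - (b - a)) (by omega), ← e2 i (n - (j - i)) (by omega), h, hs]
            obtain rfl : b = j := by omega
            subst hai
            exact hv.2
      · refine ⟨N, hNE, hN0, hNst, fun i j hij hr hlt => ?_⟩
        rcases Nat.lt_succ_iff_lt_or_eq.1 hlt with h | h
        · exact hN i j hij hr h
        · exact absurd ⟨i, j, hij, hr, h⟩ hex
  obtain ⟨N, hNE, hN0, -, hN⟩ := key (n * n + n)
  obtain ⟨w, hw, hw0⟩ := N.ne_bot_iff.1 hN0
  refine ⟨w, hNE hw, hw0, fun i j hij hr => hN i j hij hr ?_ w hw⟩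
  have := hR.lt hr
  calc (n - (j - i)) * n + i < (n - (j - i)) * n + n := by omega
    _ ≤ n * n + n := by gcongr; omega

theorem powEntry_intertwine {Y : Type*} [AddCommGroup Y] [Module ℂ Y]
    {e' : ℕ → ℕ → Module.End ℂ Y} (f : X →ₗ[ℂ] Y) (h : ∀ i j v, f (e i j v) = e' i j (f v))
    (r i j : ℕ) (v : X) : f (powEntry n e r i j v) = powEntry n e' r i j (f v) := by
  induction r generalizing i with
  | zero => simp only [powEntry]; split_ifs <;> simp
  | succ r ih => simp [powEntry, h, ih]

theorem blockTrace_intertwine {Y : Type*} [AddCommGroup Y] [Module ℂ Y]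
    {e' : ℕ → ℕ → Module.End ℂ Y} (f : X →ₗ[ℂ] Y) (h : ∀ i j v, f (e i j v) = e' i j (f v))
    (t k : ℕ) (v : X) : f (blockTrace n R e t k v) = blockTrace n R e' t k (f v) := by
  simp [blockTrace, powEntry_intertwine f h]

end Module

/-- A module generated by a finite-dimensional space that is stable under the matrix units above
the diagonal has only finitely many linearly independent Whittaker vectors. The proof splits off
the submodule generated by one Whittaker vector at a time. -/
theorem finiteDimensional_whittakerVectors {n : ℕ} {R : ℕ → ℕ → Prop} {c : ℕ → ℂ}
    (hR : IsNondegenerate n R c) {X : Type u} [AddCommGroup X] [Module ℂ X]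
    {e : ℕ → ℕ → Module.End ℂ X} (he : GlRelations R e)
    (hnil : ∀ i j, i < j → R i j → ∀ v, ∃ m : ℕ, ((e i j - charValue c i j • 1) ^ m) v = 0)
    (hC : ∀ v : X, ∃ N : Submodule ℂ X, v ∈ N ∧ FiniteDimensional ℂ N ∧
      ∀ t k, ∀ w ∈ N, blockTrace n R e t k w ∈ N)
    (E : Submodule ℂ X) [FiniteDimensional ℂ E]
    (hst : ∀ i j, i < j → R i j → ∀ v ∈ E, e i j v ∈ E) :
    FiniteDimensional ℂ ↥(whittakerVectors R c e ⊓ generated e R E) := by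
  suffices H : ∀ m : ℕ, ∀ (X : Type u) [AddCommGroup X] [Module ℂ X]
      (e : ℕ → ℕ → Module.End ℂ X), GlRelations R e →
      (∀ i j, i < j → R i j → ∀ v, ∃ m : ℕ, ((e i j - charValue c i j • 1) ^ m) v = 0) →
      (∀ v : X, ∃ N : Submodule ℂ X, v ∈ N ∧ FiniteDimensional ℂ N ∧
        ∀ t k, ∀ w ∈ N, blockTrace n R e t k w ∈ N) →
      ∀ (E : Submodule ℂ X) [FiniteDimensional ℂ E],
      (∀ i j, i < j → R i j → ∀ v ∈ E, e i j v ∈ E) → Module.finrank ℂ E ≤ m →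
      FiniteDimensional ℂ ↥(whittakerVectors R c e ⊓ generated e R E) from
    H _ X e he hnil hC E hst le_rfl
  intro m
  induction m with
  | zero =>
    intro X _ _ e he hnil hC E _ hst hm
    have hE : E = ⊥ := Submodule.finrank_eq_zero.1 (Nat.le_zero.1 hm)
    have : generated e R E ≤ ⊥ := generated_le hE.le fun i j _ v hv => by
      rw [(Submodule.mem_bot ℂ).1 hv, map_zero]; exact Submodule.zero_mem _
    exact Submodule.finiteDimensional_of_le (inf_le_right.trans this)
  | succ m ih =>
    intro X _ _ e he hnil hC E _ hst hm
    by_cases hE : E = ⊥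
    · exact ih X e he hnil hC E hst (by rw [hE, finrank_bot]; exact Nat.zero_le _)
    obtain ⟨w, hwE, hw0, hw⟩ := exists_whittakerVector hR he hnil hE hst
    obtain ⟨N, hwN, hNfin, hNC⟩ := hC w
    let F : Submodule ℂ X := N ⊓ whittakerVectors R c e
    have hFfin : FiniteDimensional ℂ F := Submodule.finiteDimensional_of_le inf_le_left
    have hFC : ∀ t k, ∀ w ∈ F, blockTrace n R e t k w ∈ F := by
      rintro t k w ⟨h1, h2⟩
      refine ⟨hNC t k w h1, fun i j hij hr => ?_⟩
      have := congrArg (fun f => f w) (blockTrace_comm hR he i j t k)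
      simp only [Module.End.mul_apply] at this
      rw [this, h2 i j hij hr, map_smul]
    let K := generated e R F
    have hK : ∀ i j, ∀ v ∈ K, e i j v ∈ K := by
      intro i j v hv
      by_cases hr : R i j
      · exact generated_stable hr hv
      · rw [he.eq_zero hr]
        exact K.zero_mem
    let q : ℕ → ℕ → Module.End ℂ (X ⧸ K) := fun i j => K.mapQ K (e i j) (hK i j)
    have hq : ∀ i j v, K.mkQ (e i j v) = q i j (K.mkQ v) := fun i j v => rfl
    have hqpow : ∀ (i j m : ℕ) (v : X), ((q i j - charValue c i j • 1) ^ m) (K.mkQ v) =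
        K.mkQ (((e i j - charValue c i j • 1) ^ m) v) := by
      intro i j m v
      induction m with
      | zero => simp
      | succ m ihm =>
        rw [pow_succ', pow_succ', Module.End.mul_apply, Module.End.mul_apply, ihm]
        simp only [LinearMap.sub_apply, LinearMap.smul_apply, Module.End.one_apply, map_sub,
          map_smul, hq]
    have hfin := ih (X ⧸ K) q
      { eq_zero := fun {i j} hr => by
          refine LinearMap.ext fun x => ?_
          obtain ⟨v, rfl⟩ := K.mkQ_surjective x
          rw [← hq, he.eq_zero hr]
          simp
        comm := fun {i j k l} hr hr' => by
          refine LinearMap.ext fun x => ?_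
          obtain ⟨v, rfl⟩ := K.mkQ_surjective x
          have := congrArg (fun f => K.mkQ (f v)) (he.comm hr hr')
          simp only [LinearMap.sub_apply, Module.End.mul_apply, map_sub] at this ⊢
          simp only [hq] at this
          rw [this]
          split_ifs <;> simp [hq] }
      (fun i j hij hr x => by
        obtain ⟨v, rfl⟩ := K.mkQ_surjective x
        obtain ⟨p, hp⟩ := hnil i j hij hr v
        exact ⟨p, by rw [hqpow, hp, map_zero]⟩)
      (fun x => by
        obtain ⟨v, rfl⟩ := K.mkQ_surjective x
        obtain ⟨N, hv, _, hN⟩ := hC v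
        refine ⟨N.map K.mkQ, Submodule.mem_map_of_mem hv, inferInstance, ?_⟩
        rintro t k _ ⟨y, hy, rfl⟩
        rw [← blockTrace_intertwine K.mkQ hq]
        exact Submodule.mem_map_of_mem (hN t k y hy))
      (E.map K.mkQ)
      (by
        rintro i j hij hr _ ⟨y, hy, rfl⟩
        rw [← hq]
        exact Submodule.mem_map_of_mem (hst i j hij hr y hy))
      (by
        have h1 := LinearMap.finrank_range_add_finrank_ker (K.mkQ.domRestrict E)
        have h2 : 0 < Module.finrank ℂ (LinearMap.ker (K.mkQ.domRestrict E)) := by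
          refine Module.finrank_pos_iff_exists_ne_zero.2 ⟨⟨⟨w, hwE⟩, ?_⟩, ?_⟩
          · rw [LinearMap.mem_ker, LinearMap.domRestrict_apply, Submodule.mkQ_apply,
              Submodule.Quotient.mk_eq_zero]
            exact le_generated ⟨hwN, hw⟩
          · intro h
            exact hw0 (congrArg (fun x => ((x : E) : X)) (congrArg Subtype.val h))
        rw [LinearMap.range_domRestrict] at h1
        omega)
    rw [FiniteDimensional, Module.Finite.iff_fg]
    refine Submodule.fg_of_fg_map_of_fg_inf_ker K.mkQ ?_ ?_
    · rw [← Module.Finite.iff_fg]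
      refine Submodule.finiteDimensional_of_le (S₂ := whittakerVectors R c q ⊓
        generated q R (E.map K.mkQ)) ?_
      rintro _ ⟨v, ⟨hv, hv'⟩, rfl⟩
      refine ⟨fun i j hij hr => ?_, ?_⟩
      · rw [← hq, hv i j hij hr, map_smul]
      · have hle : generated e R E ≤ (generated q R (E.map K.mkQ)).comap K.mkQ :=
          generated_le (fun x hx => le_generated (Submodule.mem_map_of_mem hx))
            fun i j hr x hx => by
              rw [Submodule.mem_comap, hq]
              exact generated_stable hr hx
        exact hle hv'
    · rw [← Module.Finite.iff_fg]
      refine Submodule.finiteDimensional_of_le (S₂ := F) ?_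
      rintro v ⟨⟨hv, -⟩, hvK⟩
      rw [Submodule.ker_mkQ] at hvK
      exact whittakerVectors_inf_generated_le hR he inf_le_right hFC ⟨hv, hvK⟩

end Queer

end

noncomputable section

namespace Queer

/-! ### Universal enveloping algebras -/

section Enveloping

variable {L : Type*} [LieRing L] [LieAlgebra ℂ L]

theorem adjoin_range_ι :
    Algebra.adjoin ℂ (Set.range (UniversalEnvelopingAlgebra.ι ℂ (L := L))) = ⊤ := by
  set S := Algebra.adjoin ℂ (Set.range (UniversalEnvelopingAlgebra.ι ℂ (L := L))) with hS
  have hmem : ∀ x, UniversalEnvelopingAlgebra.ι ℂ x ∈ S := fun x =>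
    Algebra.subset_adjoin (Set.mem_range_self x)
  let f : L →ₗ⁅ℂ⁆ S :=
    { toFun := fun x => ⟨UniversalEnvelopingAlgebra.ι ℂ x, hmem x⟩
      map_add' := fun x y => Subtype.ext (map_add _ x y)
      map_smul' := fun a x => Subtype.ext (map_smul _ a x)
      map_lie' := fun {x y} => Subtype.ext
        ((UniversalEnvelopingAlgebra.ι ℂ).map_lie x y) }
  have h : S.val.comp (UniversalEnvelopingAlgebra.lift ℂ f) = AlgHom.id ℂ _ := by
    refine UniversalEnvelopingAlgebra.hom_ext ℂ ?_
    ext x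
    simp [f]
  rw [eq_top_iff]
  intro z _
  have := congrArg (fun g => g z) h
  simp only [AlgHom.comp_apply, AlgHom.id_apply] at this
  rw [← this]
  exact (UniversalEnvelopingAlgebra.lift ℂ f z).2

theorem enveloping_induction {p : UniversalEnvelopingAlgebra ℂ L → Prop}
    (ι : ∀ x, p (UniversalEnvelopingAlgebra.ι ℂ x)) (algebraMap : ∀ a, p (algebraMap ℂ _ a))
    (add : ∀ x y, p x → p y → p (x + y)) (mul : ∀ x y, p x → p y → p (x * y))
    (z : UniversalEnvelopingAlgebra ℂ L) : p z := by
  have hz : z ∈ Algebra.adjoin ℂ (Set.range (UniversalEnvelopingAlgebra.ι ℂ (L := L))) := by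
    rw [adjoin_range_ι]
    trivial
  induction hz using Algebra.adjoin_induction with
  | mem x hx => obtain ⟨y, rfl⟩ := hx; exact ι y
  | algebraMap a => exact algebraMap a
  | add x y _ _ hx hy => exact add x y hx hy
  | mul x y _ _ hx hy => exact mul x y hx hy

theorem mem_center_enveloping {z : UniversalEnvelopingAlgebra ℂ L}
    (h : ∀ x, UniversalEnvelopingAlgebra.ι ℂ x * z = z * UniversalEnvelopingAlgebra.ι ℂ x) :
    z ∈ Subalgebra.center ℂ (UniversalEnvelopingAlgebra ℂ L) := by
  rw [Subalgebra.mem_center_iff]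
  intro b
  induction b using enveloping_induction with
  | ι x => exact h x
  | algebraMap a => exact Algebra.commutes a z
  | add x y hx hy => rw [add_mul, mul_add, hx, hy]
  | mul x y hx hy => rw [mul_assoc, hy, ← mul_assoc, hx, mul_assoc]

theorem lift_intertwine {X Y : Type*} [AddCommGroup X] [Module ℂ X] [AddCommGroup Y] [Module ℂ Y]
    {L' : Type*} [LieRing L'] [LieAlgebra ℂ L'] (g : L →ₗ⁅ℂ⁆ L')
    {ρ : L →ₗ⁅ℂ⁆ Module.End ℂ X} {σ : L' →ₗ⁅ℂ⁆ Module.End ℂ Y} {f : X →ₗ[ℂ] Y}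
    (h : ∀ x v, f (ρ x v) = σ (g x) (f v)) (z : UniversalEnvelopingAlgebra ℂ L) (v : X) :
    f (UniversalEnvelopingAlgebra.lift ℂ ρ z v) =
      UniversalEnvelopingAlgebra.lift ℂ σ (UniversalEnvelopingAlgebra.lift ℂ
        ((UniversalEnvelopingAlgebra.ι ℂ).comp g) z) (f v) := by
  induction z using enveloping_induction generalizing v with
  | ι x => simp [h]
  | algebraMap a => simp
  | add x y hx hy => simp [hx, hy]
  | mul x y hx hy => simp [hx, hy]

end Enveloping

namespace SMod

variable {n : ℕ} {s : SubSuperalgebra n}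

/-! ### Submodules and homomorphisms of supermodules -/

section Basic

variable {M N K : SMod.{u} s}

theorem parity_parity (M : SMod.{u} s) (v : M) : M.parity (M.parity v) = v :=
  congrArg (fun f => f v) M.parity_mul_self

theorem parity_even (M : SMod.{u} s) (x : s.even) (v : M) :
    M.parity (M.actEven x v) = M.actEven x (M.parity v) :=
  congrArg (fun f => f v) (M.parity_actEven x)

theorem parity_odd (M : SMod.{u} s) (y : s.odd) (v : M) :
    M.parity (M.actOdd y v) = -M.actOdd y (M.parity v) :=
  congrArg (fun f => f v) (M.parity_actOdd y)

theorem even_odd (M : SMod.{u} s) (x : s.even) (y : s.odd) (v : M) :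
    M.actEven x (M.actOdd y v) = M.actOdd y (M.actEven x v) +
      M.actOdd ⟨x * y - y * x, s.even_odd_mem x x.2 y y.2⟩ v := by
  have := congrArg (fun f => f v) (M.act_even_odd x y)
  simp only [LinearMap.sub_apply, Module.End.mul_apply] at this
  rw [this]
  abel

theorem odd_odd (M : SMod.{u} s) (y z : s.odd) (v : M) :
    M.actOdd y (M.actOdd z v) + M.actOdd z (M.actOdd y v) =
      M.actEven ⟨y * z + z * y, s.odd_odd_mem y y.2 z z.2⟩ v :=
  (congrArg (fun f => f v) (M.act_odd_odd y z)).symm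

theorem parity_ne_zero {v : M} (h : v ≠ 0) : M.parity v ≠ 0 := fun h' =>
  h (by rw [← M.parity_parity v, h', map_zero])

/-- The intersection of all graded submodules that contain a subspace. -/
def gradedSpan (M : SMod.{u} s) (F : Submodule ℂ M) : M.Sub where
  space := sInf {N | F ≤ N ∧ (∀ v ∈ N, M.parity v ∈ N) ∧ M.IsStable N}
  parity_mem v hv := by
    rw [Submodule.mem_sInf] at hv ⊢
    exact fun N hN => hN.2.1 v (hv N hN)
  stable := by
    constructor <;> intro x v hv <;> rw [Submodule.mem_sInf] at hv ⊢
    · exact fun N hN => hN.2.2.1 x v (hv N hN)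
    · exact fun N hN => hN.2.2.2 x v (hv N hN)

theorem le_gradedSpan (F : Submodule ℂ M) : F ≤ (M.gradedSpan F).space :=
  le_sInf fun _ h => h.1

theorem gradedSpan_le {F : Submodule ℂ M} {N : M.Sub} (h : F ≤ N.space) :
    (M.gradedSpan F).space ≤ N.space :=
  sInf_le ⟨h, N.parity_mem, N.stable⟩

/-- The inclusion of a graded submodule. -/
def Sub.incl (U : M.Sub) : U.toSMod →ₗ[ℂ] M := U.space.subtype

theorem Sub.incl_injective (U : M.Sub) : Function.Injective U.incl :=
  U.space.subtype_injective

theorem Sub.incl_mem (U : M.Sub) (v : U.toSMod) : U.incl v ∈ U.space := v.2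

theorem Sub.exists_incl_eq (U : M.Sub) {v : M} (hv : v ∈ U.space) : ∃ w, U.incl w = v :=
  ⟨⟨v, hv⟩, rfl⟩

theorem Sub.incl_mem_homogHom (U : M.Sub) : U.incl ∈ homogHom U.toSMod M 1 :=
  ⟨fun v => by rw [one_smul]; rfl, fun _ _ => rfl, fun y v => by rw [one_smul]; rfl⟩

/-- A linear map with values in a graded submodule, as a map to that submodule. -/
def Sub.codRestrict (U : N.Sub) (f : M →ₗ[ℂ] N) (h : ∀ v, f v ∈ U.space) : M →ₗ[ℂ] U.toSMod :=
  LinearMap.codRestrict U.space f h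

theorem Sub.incl_codRestrict (U : N.Sub) (f : M →ₗ[ℂ] N) (h : ∀ v, f v ∈ U.space) (v : M) :
    U.incl (U.codRestrict f h v) = f v := rfl

theorem Sub.codRestrict_mem_homogHom (U : N.Sub) {ε : ℤˣ} {f : M →ₗ[ℂ] N}
    (hf : f ∈ homogHom M N ε) (h : ∀ v, f v ∈ U.space) :
    U.codRestrict f h ∈ homogHom M U.toSMod ε := by
  have hU := U.incl_mem_homogHom
  refine ⟨fun v => U.incl_injective ?_, fun x v => U.incl_injective ?_,
    fun y v => U.incl_injective ?_⟩
  · rw [map_zsmul_unit, hU.1, one_smul]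
    exact hf.1 v
  · rw [hU.2.1]
    exact hf.2.1 x v
  · rw [map_zsmul_unit, hU.2.2, one_smul]
    exact hf.2.2 y v

theorem homogHom_comp {ε δ : ℤˣ} {f : M →ₗ[ℂ] N} {g : N →ₗ[ℂ] K} (hf : f ∈ homogHom M N ε)
    (hg : g ∈ homogHom N K δ) : g ∘ₗ f ∈ homogHom M K (ε * δ) := by
  refine ⟨fun v => ?_, fun x v => ?_, fun y v => ?_⟩
  · simp only [LinearMap.comp_apply]
    rw [hf.1, map_zsmul_unit, hg.1, smul_smul]
  · simp only [LinearMap.comp_apply]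
    rw [hf.2.1, hg.2.1]
  · simp only [LinearMap.comp_apply]
    rw [hf.2.2, map_zsmul_unit, hg.2.2, smul_smul]

theorem id_mem_homogHom (M : SMod.{u} s) : LinearMap.id ∈ homogHom M M 1 := by
  simp [homogHom]

theorem symm_mem_homogHom {ε : ℤˣ} (e : M ≃ₗ[ℂ] N) (he : (e : M →ₗ[ℂ] N) ∈ homogHom M N ε) :
    (e.symm : N →ₗ[ℂ] M) ∈ homogHom N M ε := by
  refine ⟨fun v => ?_, fun x v => ?_, fun y v => ?_⟩ <;>
    apply e.injective
  · have := he.1 (e.symm v)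
    simp only [LinearEquiv.coe_coe, LinearEquiv.apply_symm_apply] at this ⊢
    rw [map_zsmul_unit, this, smul_smul, Int.units_mul_self, one_smul]
  · have := he.2.1 x (e.symm v)
    simp only [LinearEquiv.coe_coe, LinearEquiv.apply_symm_apply] at this ⊢
    rw [this]
  · have := he.2.2 y (e.symm v)
    simp only [LinearEquiv.coe_coe, LinearEquiv.apply_symm_apply] at this ⊢
    rw [map_zsmul_unit, this, smul_smul, Int.units_mul_self, one_smul]

theorem Iso.symm (h : Iso M N) : Iso N M := by
  obtain ⟨ε, e, he⟩ := h
  exact ⟨ε, e.symm, symm_mem_homogHom e he⟩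

theorem Iso.trans (h : Iso M N) (h' : Iso N K) : Iso M K := by
  obtain ⟨ε, e, he⟩ := h
  obtain ⟨δ, e', he'⟩ := h'
  exact ⟨ε * δ, e.trans e', homogHom_comp he he'⟩

/-- The kernel of a homogeneous homomorphism. -/
def kerSub {ε : ℤˣ} {f : M →ₗ[ℂ] N} (hf : f ∈ homogHom M N ε) : M.Sub where
  space := LinearMap.ker f
  parity_mem v hv := by
    rw [LinearMap.mem_ker] at hv ⊢
    rw [hf.1, hv, map_zero, smul_zero]
  stable := ⟨fun x v hv => by rw [LinearMap.mem_ker] at hv ⊢; rw [hf.2.1, hv, map_zero],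
    fun y v hv => by rw [LinearMap.mem_ker] at hv ⊢; rw [hf.2.2, hv, map_zero, smul_zero]⟩

theorem unit_smul_mem {X : Type*} [AddCommGroup X] [Module ℂ X] (N : Submodule ℂ X) (ε : ℤˣ)
    {v : X} : ε • v ∈ N ↔ v ∈ N := by
  rcases Int.units_eq_one_or ε with rfl | rfl
  · rw [one_smul]
  · rw [Units.neg_smul, one_smul, neg_mem_iff]

/-- The image of a graded submodule under a homogeneous homomorphism. -/
def mapSub {ε : ℤˣ} {f : M →ₗ[ℂ] N} (hf : f ∈ homogHom M N ε) (U : M.Sub) : N.Sub where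
  space := U.space.map f
  parity_mem := by
    rintro _ ⟨v, hv, rfl⟩
    rw [← unit_smul_mem _ ε, ← hf.1]
    exact Submodule.mem_map_of_mem (U.parity_mem v hv)
  stable := by
    constructor
    · rintro x _ ⟨v, hv, rfl⟩
      rw [← hf.2.1]
      exact Submodule.mem_map_of_mem (U.stable.1 x v hv)
    · rintro y _ ⟨v, hv, rfl⟩
      rw [← unit_smul_mem _ ε, ← hf.2.2]
      exact Submodule.mem_map_of_mem (U.stable.2 y v hv)

/-- A graded submodule is simple if and only if it is a minimal nonzero graded submodule. -/
theorem Sub.isSimple_iff (U : M.Sub) : U.toSMod.IsSimple ↔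
    U.space ≠ ⊥ ∧ ∀ N : M.Sub, N.space ≤ U.space → N.space = ⊥ ∨ N.space = U.space := by
  constructor
  · rintro ⟨h1, h2⟩
    refine ⟨(Submodule.nontrivial_iff_ne_bot).1 h1, fun N hN => ?_⟩
    rcases h2
      { space := N.space.comap U.space.subtype
        parity_mem := fun v hv => N.parity_mem _ hv
        stable := ⟨fun x v hv => N.stable.1 x _ hv, fun y v hv => N.stable.2 y _ hv⟩ } with h | h
    · left
      refine eq_bot_iff.2 fun v hv => ?_
      have hv' : (⟨v, hN hv⟩ : U.space) ∈ N.space.comap U.space.subtype := hv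
      rw [show N.space.comap U.space.subtype = ⊥ from h, Submodule.mem_bot] at hv'
      exact (Submodule.mem_bot ℂ).2 (congrArg Subtype.val hv')
    · right
      exact le_antisymm hN (Submodule.comap_subtype_eq_top.1 h)
  · rintro ⟨h1, h2⟩
    refine ⟨(Submodule.nontrivial_iff_ne_bot).2 h1, fun N => ?_⟩
    rcases h2 (mapSub U.incl_mem_homogHom N) (by rintro _ ⟨v, -, rfl⟩; exact v.2) with h | h
    · left
      refine eq_bot_iff.2 fun v hv => ?_
      have hv' : U.incl v ∈ N.space.map U.incl := Submodule.mem_map_of_mem hv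
      rw [show N.space.map U.incl = ⊥ from h, Submodule.mem_bot] at hv'
      exact (Submodule.mem_bot ℂ).2 (U.incl_injective (hv'.trans (map_zero U.incl).symm))
    · right
      refine eq_top_iff.2 fun v _ => ?_
      have hv : U.incl v ∈ N.space.map U.incl := by
        rw [show N.space.map U.incl = U.space from h]
        exact v.2
      obtain ⟨w, hw, hwv⟩ := hv
      rwa [← U.incl_injective hwv]

/-- The whole supermodule as a graded submodule of itself. -/
def topSub (M : SMod.{u} s) : M.Sub where
  space := ⊤
  parity_mem _ _ := trivial
  stable := ⟨fun _ _ _ => trivial, fun _ _ _ => trivial⟩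

theorem IsSimple.injective {ε : ℤˣ} {f : M →ₗ[ℂ] N} (hM : M.IsSimple) (hf : f ∈ homogHom M N ε)
    (h0 : f ≠ 0) : Function.Injective f := by
  rcases hM.2 (kerSub hf) with h | h
  · exact LinearMap.ker_eq_bot.1 h
  · exact absurd (LinearMap.ker_eq_top.1 h) h0

theorem IsSimple.surjective {ε : ℤˣ} {f : M →ₗ[ℂ] N} (hN : N.IsSimple) (hf : f ∈ homogHom M N ε)
    (h0 : f ≠ 0) : Function.Surjective f := by
  rcases hN.2 (mapSub hf M.topSub) with h | h
  · exact absurd (LinearMap.range_eq_bot.1 (by rw [← Submodule.map_top]; exact h)) h0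
  · exact LinearMap.range_eq_top.1 (by rw [← Submodule.map_top]; exact h)

/-- Schur's lemma for homogeneous homomorphisms. -/
theorem iso_of_ne_zero {ε : ℤˣ} {f : M →ₗ[ℂ] N} (hM : M.IsSimple) (hN : N.IsSimple)
    (hf : f ∈ homogHom M N ε) (h0 : f ≠ 0) : Iso M N :=
  ⟨ε, LinearEquiv.ofBijective f ⟨hM.injective hf h0, hN.surjective hf h0⟩, hf⟩

theorem isSimple_of_injective {ε : ℤˣ} {f : M →ₗ[ℂ] N} (hM : M.IsSimple)
    (hf : f ∈ homogHom M N ε) (hinj : Function.Injective f) (U : N.Sub)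
    (hU : U.space = LinearMap.range f) : U.toSMod.IsSimple := by
  rw [Sub.isSimple_iff, hU]
  have := hM.1
  refine ⟨fun h => ?_, fun K hK => ?_⟩
  · obtain ⟨v, hv⟩ := exists_ne (0 : M)
    rw [LinearMap.range_eq_bot] at h
    exact hv (hinj (by simp [h]))
  · rcases hM.2
      { space := K.space.comap f
        parity_mem := fun v hv => by
          rw [Submodule.mem_comap, hf.1, unit_smul_mem]
          exact K.parity_mem _ hv
        stable := ⟨fun x v hv => by
            rw [Submodule.mem_comap, hf.2.1]
            exact K.stable.1 x _ hv, fun y v hv => by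
            rw [Submodule.mem_comap, hf.2.2, unit_smul_mem]
            exact K.stable.2 y _ hv⟩ } with h | h
    · left
      refine eq_bot_iff.2 fun w hw => ?_
      obtain ⟨v, rfl⟩ := hK hw
      have hv : v ∈ K.space.comap f := hw
      rw [show K.space.comap f = ⊥ from h, Submodule.mem_bot] at hv
      simp [hv]
    · right
      refine le_antisymm hK ?_
      rintro _ ⟨v, rfl⟩
      have hv : v ∈ K.space.comap f := by
        rw [show K.space.comap f = ⊤ from h]
        trivial
      exact hv

theorem projection_apply_comm {X : Type*} [AddCommGroup X] [Module ℂ X] {A B : Submodule ℂ X}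
    (h : IsCompl A B) (φ : X →ₗ[ℂ] X) (hA : ∀ a ∈ A, φ a ∈ A) (hB : ∀ b ∈ B, φ b ∈ B) (v : X) :
    A.projection B h (φ v) = φ (A.projection B h v) := by
  obtain ⟨a, ha, b, hb, rfl⟩ := Submodule.mem_sup.1 (h.sup_eq_top ▸ Submodule.mem_top : v ∈ A ⊔ B)
  simp only [map_add, Submodule.projection_apply_of_mem_left h ha,
    Submodule.projection_apply_of_mem_right h hb,
    Submodule.projection_apply_of_mem_left h (hA a ha),
    Submodule.projection_apply_of_mem_right h (hB b hb), map_zero]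

theorem projection_mem_homogHom {A B : M.Sub} (h : IsCompl A.space B.space) :
    A.space.projection B.space h ∈ homogHom M M 1 := by
  refine ⟨fun v => ?_, fun x v => ?_, fun y v => ?_⟩
  · rw [one_smul, projection_apply_comm h _ A.parity_mem B.parity_mem]
  · exact projection_apply_comm h _ (A.stable.1 x) (B.stable.1 x) v
  · rw [one_smul, projection_apply_comm h _ (A.stable.2 y) (B.stable.2 y)]

theorem Sub.incl_ne_zero {U : M.Sub} (hU : U.toSMod.IsSimple) : U.incl ≠ 0 := fun h => by
  have := hU.1
  obtain ⟨v, hv⟩ := exists_ne (0 : U.toSMod)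
  exact hv (U.incl_injective (by rw [h]; simp))

/-- Every simple graded submodule of a simple supermodule or of the sum of two isomorphic simple
supermodules is isomorphic to every other one. -/
theorem iso_of_isSimple_sub (hM : M.IsSimple ∨ M.IsDouble) {U U' : M.Sub}
    (hU : U.toSMod.IsSimple) (hU' : U'.toSMod.IsSimple) : Iso U.toSMod U'.toSMod := by
  suffices H : ∃ K : SMod.{u} s, ∀ U : M.Sub, U.toSMod.IsSimple → Iso U.toSMod K by
    obtain ⟨K, hK⟩ := H
    exact (hK U hU).trans (hK U' hU').symm
  rcases hM with hM | ⟨N₁, N₂, hc, h₁, h₂, hiso⟩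
  · exact ⟨M, fun U hU => iso_of_ne_zero hU hM U.incl_mem_homogHom (Sub.incl_ne_zero hU)⟩
  · refine ⟨N₁.toSMod, fun U hU => ?_⟩
    have key : ∀ (A B : M.Sub) (hAB : IsCompl A.space B.space), A.toSMod.IsSimple →
        Iso U.toSMod A.toSMod ∨ U.space ≤ B.space := by
      intro A B hAB hA
      have hf := homogHom_comp U.incl_mem_homogHom (projection_mem_homogHom hAB)
      have hmem : ∀ v, (A.space.projection B.space hAB ∘ₗ U.incl) v ∈ A.space := fun v =>
        Submodule.projection_apply_mem _ _
      by_cases h0 : A.codRestrict _ hmem = 0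
      · right
        intro v hv
        obtain ⟨w, rfl⟩ := U.exists_incl_eq hv
        have := congrArg (fun f => A.incl (f w)) h0
        simp only [LinearMap.zero_apply, map_zero] at this
        exact (Submodule.projection_apply_eq_zero_iff hAB).1 this
      · left
        exact iso_of_ne_zero hU hA (A.codRestrict_mem_homogHom hf hmem) h0
    rcases key N₁ N₂ hc h₁ with h | h
    · exact h
    rcases key N₂ N₁ hc.symm h₂ with h' | h'
    · exact h'.trans hiso.symm
    exact absurd (eq_bot_iff.2 (hc.disjoint h' h)) (Sub.isSimple_iff U |>.1 hU).1

end Basic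

/-! ### Locally Whittaker supermodules -/

/-- The local conditions in the definition of the Whittaker category, without finite
generation. -/
structure IsLocallyWhittaker (ζ : NilCharacter n) (M : SMod.{u} s) : Prop where
  nil_locally_finite : ∀ v : M, ∃ N : Submodule ℂ M, v ∈ N ∧ FiniteDimensional ℂ N ∧
    (∀ x : s.even, IsStrictUpper (x : Mat n) → ∀ w ∈ N, M.actEven x w ∈ N) ∧
    (∀ y : s.odd, IsStrictUpper (y : Mat n) → ∀ w ∈ N, M.actOdd y w ∈ N)
  center_locally_finite : ∀ v : M, ∃ N : Submodule ℂ M, v ∈ N ∧ FiniteDimensional ℂ N ∧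
    ∀ z ∈ Subalgebra.center ℂ (UniversalEnvelopingAlgebra ℂ s.even),
      ∀ w ∈ N, UniversalEnvelopingAlgebra.lift ℂ M.actEven z w ∈ N
  locally_nilpotent : ∀ (x : s.even) (hx : (x : Mat n) ∈ nilEven n), ∀ v : M, ∃ k : ℕ,
    ((M.actEven x - ζ ⟨x, hx⟩ • (1 : Module.End ℂ M)) ^ k) v = 0

variable {ζ : NilCharacter n} {M N : SMod.{u} s}

theorem IsWhittaker.isLocallyWhittaker (h : M.IsWhittaker ζ) : M.IsLocallyWhittaker ζ :=
  ⟨h.nil_locally_finite, h.center_locally_finite, h.locally_nilpotent⟩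

theorem IsLocallyWhittaker.isWhittaker (h : M.IsLocallyWhittaker ζ) (hM : M.IsSimple) :
    M.IsWhittaker ζ := by
  classical
  refine ⟨?_, h.nil_locally_finite, h.center_locally_finite, h.locally_nilpotent⟩
  have := hM.1
  obtain ⟨v, hv⟩ := exists_ne (0 : M)
  refine ⟨{v, M.parity v}, fun N hN hvN => ?_⟩
  simp only [Finset.coe_insert, Finset.coe_singleton, Set.insert_subset_iff,
    Set.singleton_subset_iff, SetLike.mem_coe] at hvN
  -- the largest graded submodule inside `N`
  rcases hM.2
    { space := N ⊓ N.comap M.parity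
      parity_mem := fun w hw => ⟨hw.2, by
        change M.parity (M.parity w) ∈ N
        rw [M.parity_parity]; exact hw.1⟩
      stable := ⟨fun x w hw => ⟨hN.1 x w hw.1, by
          change M.parity (M.actEven x w) ∈ N
          rw [M.parity_even]; exact hN.1 x _ hw.2⟩,
        fun y w hw => ⟨hN.2 y w hw.1, by
          change M.parity (M.actOdd y w) ∈ N
          rw [M.parity_odd]; exact N.neg_mem (hN.2 y _ hw.2)⟩⟩ } with h0 | h0
  · have hmem : v ∈ N ⊓ N.comap M.parity := hvN
    rw [show N ⊓ N.comap M.parity = ⊥ from h0] at hmem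
    exact absurd ((Submodule.mem_bot ℂ).1 hmem) hv
  · exact eq_top_iff.2 ((show N ⊓ N.comap M.parity = ⊤ from h0).ge.trans inf_le_left)

theorem finiteDimensional_comap {X Y : Type*} [AddCommGroup X] [Module ℂ X] [AddCommGroup Y]
    [Module ℂ Y] {f : X →ₗ[ℂ] Y} (hf : Function.Injective f) (N : Submodule ℂ Y)
    [FiniteDimensional ℂ N] : FiniteDimensional ℂ (N.comap f) :=
  FiniteDimensional.of_injective (f.restrict (p := N.comap f) (q := N) fun _ h => h)
    fun _ _ h => Subtype.ext (hf (congrArg Subtype.val h))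

/-- The local conditions are inherited along injective homogeneous homomorphisms. -/
theorem IsLocallyWhittaker.of_injective (h : N.IsLocallyWhittaker ζ) {ε : ℤˣ} {f : M →ₗ[ℂ] N}
    (hf : f ∈ homogHom M N ε) (hinj : Function.Injective f) : M.IsLocallyWhittaker ζ where
  nil_locally_finite v := by
    obtain ⟨K, hv, hfin, h0, h1⟩ := h.nil_locally_finite (f v)
    refine ⟨K.comap f, hv, finiteDimensional_comap hinj K, fun x hx w hw => ?_,
      fun y hy w hw => ?_⟩
    · rw [Submodule.mem_comap, hf.2.1]
      exact h0 x hx _ hw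
    · rw [Submodule.mem_comap, hf.2.2, unit_smul_mem]
      exact h1 y hy _ hw
  center_locally_finite v := by
    obtain ⟨K, hv, hfin, h0⟩ := h.center_locally_finite (f v)
    refine ⟨K.comap f, hv, finiteDimensional_comap hinj K, fun z hz w hw => ?_⟩
    have hid : UniversalEnvelopingAlgebra.lift ℂ
        ((UniversalEnvelopingAlgebra.ι ℂ).comp (LieHom.id : s.even →ₗ⁅ℂ⁆ s.even)) =
        AlgHom.id ℂ _ := UniversalEnvelopingAlgebra.hom_ext ℂ (by ext x; simp)
    rw [Submodule.mem_comap,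
      lift_intertwine LieHom.id (σ := N.actEven) (fun x v => hf.2.1 x v), hid]
    exact h0 z hz _ hw
  locally_nilpotent x hx v := by
    obtain ⟨k, hk⟩ := h.locally_nilpotent x hx (f v)
    refine ⟨k, hinj ?_⟩
    rw [map_zero, ← hk]
    clear hk
    induction k generalizing v with
    | zero => simp
    | succ k ih =>
      rw [pow_succ, pow_succ, Module.End.mul_apply, Module.End.mul_apply, ih]
      simp [hf.2.1]

theorem IsLocallyWhittaker.sub (h : M.IsLocallyWhittaker ζ) (U : M.Sub) :
    U.toSMod.IsLocallyWhittaker ζ :=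
  h.of_injective U.incl_mem_homogHom U.incl_injective

end SMod

end Queer

end

noncomputable section

namespace Queer

variable {n : ℕ}

/-! ### The matrix units of the summands of the Levi subalgebra -/

/-- The relation of lying in the same block, for blocks in `T`, on natural numbers. -/
def SameBlock (ζ : NilCharacter n) (T : Set (Block ζ)) (i j : ℕ) : Prop :=
  ∃ (hi : i < n) (hj : j < n), block ζ ⟨i, hi⟩ = block ζ ⟨j, hj⟩ ∧ block ζ ⟨i, hi⟩ ∈ T

open Classical in
/-- The values of the character on the superdiagonal matrix units. -/
def superdiagValue (ζ : NilCharacter n) (i : ℕ) : ℂ :=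
  if h : i + 1 < n then
    ζ ⟨Matrix.single ⟨i, by omega⟩ ⟨i + 1, h⟩ 1, single_mem_nilEven (by simp [Fin.lt_def])⟩
  else 0

/-- A character vanishes on root vectors of non-simple roots, since these are commutators. -/
theorem character_single (ζ : NilCharacter n) {i j : Fin n} (h : i < j) :
    ζ ⟨Matrix.single i j 1, single_mem_nilEven h⟩ = charValue (superdiagValue ζ) i j := by
  by_cases hs : (j : ℕ) = i + 1
  · have hi : (i : ℕ) + 1 < n := hs ▸ j.2
    obtain rfl : j = ⟨i + 1, hi⟩ := Fin.ext hs
    rw [charValue, if_pos rfl, superdiagValue, dif_pos hi]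
  · rw [charValue, if_neg hs]
    have hlt : (i : ℕ) < j := h
    let k : Fin n := ⟨i + 1, by omega⟩
    have hik : i < k := by simp [k, Fin.lt_def]
    have hkj : k < j := by simp only [k, Fin.lt_def]; omega
    have := LieAlgebra.lieCharacter_apply_lie ζ
      (⟨Matrix.single i k 1, single_mem_nilEven hik⟩ : nilEven n)
      ⟨Matrix.single k j 1, single_mem_nilEven hkj⟩
    rw [← this]
    congr 1
    refine Subtype.ext ?_
    change _ = Matrix.single i k 1 * Matrix.single k j 1 - Matrix.single k j 1 * Matrix.single i k 1
    rw [Matrix.single_mul_single_same, Matrix.single_mul_single_of_ne (h := h.ne'), mul_one,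
      sub_zero]

theorem linked_iff (ζ : NilCharacter n) {i j : Fin n} :
    Linked ζ i j ↔ (j : ℕ) = i + 1 ∧ superdiagValue ζ i ≠ 0 := by
  constructor
  · rintro ⟨h, h0⟩
    rw [character_single ζ h, charValue] at h0
    split_ifs at h0 with hs
    · exact ⟨hs, h0⟩
    · exact absurd rfl h0
  · rintro ⟨hs, h0⟩
    have h : i < j := by rw [Fin.lt_def]; omega
    exact ⟨h, by rwa [character_single ζ h, charValue, if_pos hs]⟩

theorem block_eq_iff (ζ : NilCharacter n) (i j : Fin n) : block ζ i = block ζ j ↔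
    ∀ s : ℕ, min (i : ℕ) j ≤ s → s < max (i : ℕ) j → superdiagValue ζ s ≠ 0 := by
  constructor
  · intro h
    have h' := Quot.eqvGen_exact h
    clear h
    induction h' with
    | rel i j h =>
      obtain ⟨h1, h2⟩ := (linked_iff ζ).1 h
      intro s hs hs'
      obtain rfl : s = i := by omega
      exact h2
    | refl i => intro s hs hs'; omega
    | symm i j h ih => rwa [min_comm, max_comm] at ih
    | trans i j k h1 h2 ih1 ih2 =>
      intro s hs hs'
      by_cases h : min (i : ℕ) j ≤ s ∧ s < max (i : ℕ) j
      · exact ih1 s h.1 h.2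
      · exact ih2 s (by omega) (by omega)
  · have key : ∀ (m : ℕ) (i j : Fin n), (j : ℕ) = i + m →
        (∀ s : ℕ, i ≤ s → s < j → superdiagValue ζ s ≠ 0) → block ζ i = block ζ j := by
      intro m
      induction m with
      | zero =>
        intro i j h _
        rw [Fin.ext (h.symm : (i : ℕ) = j)]
      | succ m ih =>
        intro i j h hs
        have hk : (i : ℕ) + m < n := by omega
        refine (ih i ⟨i + m, hk⟩ rfl fun s h1 h2 => hs s h1 ?_).trans (Quot.sound ?_)
        · have : s < i + m := h2
          omega
        · exact (linked_iff ζ).2 ⟨by simp only; omega, hs _ (by simp) (by simp only; omega)⟩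
    intro h
    rcases le_total (i : ℕ) j with hij | hij
    · exact key (j - i) i j (by omega) fun s h1 h2 => h s (by omega) (by omega)
    · exact (key (i - j) j i (by omega) fun s h1 h2 => h s (by omega) (by omega)).symm

theorem sameBlock_isNondegenerate (ζ : NilCharacter n) (T : Set (Block ζ)) :
    IsNondegenerate n (SameBlock ζ T) (superdiagValue ζ) where
  symm := fun ⟨hi, hj, h, hT⟩ => ⟨hj, hi, h.symm, h ▸ hT⟩
  trans := fun ⟨hi, _, h, hT⟩ ⟨_, hk, h', _⟩ => ⟨hi, hk, h.trans h', hT⟩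
  lt := fun ⟨hi, _⟩ => hi
  convex := fun {i j k} ⟨hi, hj, h, hT⟩ h1 h2 => by
    refine ⟨hi, by omega, ?_, hT⟩
    rw [block_eq_iff] at h ⊢
    intro s hs hs'
    exact h s (by simp only at *; omega) (by simp only at *; omega)
  ne_zero := fun {i} ⟨hi, hj, h, hT⟩ => by
    rw [block_eq_iff] at h
    exact h i (by simp) (by simp)

theorem single_mem_blockMatrices {ζ : NilCharacter n} {T : Set (Block ζ)} {i j : Fin n}
    (h : block ζ i = block ζ j) (hT : block ζ i ∈ T) :
    Matrix.single i j (1 : ℂ) ∈ blockMatrices ζ T := by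
  intro k l hkl
  rw [Matrix.single_apply] at hkl
  simp only [ne_eq, ite_eq_right_iff, one_ne_zero, imp_false, not_not] at hkl
  obtain ⟨rfl, rfl⟩ := hkl
  exact ⟨h, hT⟩

open Classical in
/-- The even matrix units of the summand of the Levi subalgebra for `T`, zero outside the
blocks. -/
def matrixUnit (ζ : NilCharacter n) (T : Set (Block ζ)) (i j : ℕ) : (leviPart ζ T).even :=
  if h : SameBlock ζ T i j then
    ⟨Matrix.single ⟨i, h.1⟩ ⟨j, h.2.1⟩ 1, single_mem_blockMatrices h.2.2.1 h.2.2.2⟩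
  else 0

theorem matrixUnit_of_sameBlock {ζ : NilCharacter n} {T : Set (Block ζ)} {i j : ℕ}
    (h : SameBlock ζ T i j) :
    (matrixUnit ζ T i j : Mat n) = Matrix.single ⟨i, h.1⟩ ⟨j, h.2.1⟩ 1 := by
  rw [matrixUnit, dif_pos h]

theorem matrixUnit_lie {ζ : NilCharacter n} {T : Set (Block ζ)} {i j k l : ℕ}
    (h : SameBlock ζ T i j) (h' : SameBlock ζ T k l) :
    ⁅matrixUnit ζ T i j, matrixUnit ζ T k l⁆ =
      (if j = k then matrixUnit ζ T i l else 0) - (if l = i then matrixUnit ζ T k j else 0) := by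
  have hR := sameBlock_isNondegenerate ζ T
  have key : ∀ {i j k l : ℕ} (h : SameBlock ζ T i j) (h' : SameBlock ζ T k l),
      (matrixUnit ζ T i j : Mat n) * matrixUnit ζ T k l =
        ((if j = k then matrixUnit ζ T i l else 0 : (leviPart ζ T).even) : Mat n) := by
    intro i j k l h h'
    rw [matrixUnit_of_sameBlock h, matrixUnit_of_sameBlock h']
    split_ifs with hjk
    · subst hjk
      rw [matrixUnit_of_sameBlock (hR.trans h h'), Matrix.single_mul_single_same, mul_one]
    · rw [Matrix.single_mul_single_of_ne (h := fun e => hjk (congrArg Fin.val e))]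
      rfl
  refine Subtype.ext ?_
  change (matrixUnit ζ T i j : Mat n) * matrixUnit ζ T k l
    - matrixUnit ζ T k l * matrixUnit ζ T i j = _
  rw [key h h', key h' h]
  rfl

/-- Every representation of the even part of a summand of the Levi subalgebra gives elements that
satisfy the relations of matrix units. -/
theorem glRelations_matrixUnit {ζ : NilCharacter n} {T : Set (Block ζ)} {A : Type*} [Ring A]
    [Algebra ℂ A] (ρ : (leviPart ζ T).even →ₗ⁅ℂ⁆ A) :
    GlRelations (SameBlock ζ T) fun i j => ρ (matrixUnit ζ T i j) where
  eq_zero := fun h => by rw [matrixUnit, dif_neg h, map_zero]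
  comm := fun h h' => by
    have := congrArg ρ (matrixUnit_lie h h')
    rw [LieHom.map_lie, Ring.lie_def] at this
    rw [this, map_sub]
    split_ifs <;> simp

theorem eq_sum_matrixUnit {ζ : NilCharacter n} {T : Set (Block ζ)} (x : (leviPart ζ T).even) :
    x = ∑ i : Fin n, ∑ j : Fin n, (x : Mat n) i j • matrixUnit ζ T i j := by
  refine Subtype.ext ?_
  have hcoe : ((∑ i : Fin n, ∑ j : Fin n, (x : Mat n) i j • matrixUnit ζ T i j :
      (leviPart ζ T).even) : Mat n) =
      ∑ i : Fin n, ∑ j : Fin n, (x : Mat n) i j • (matrixUnit ζ T i j : Mat n) := by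
    simp
  rw [hcoe]
  conv_lhs => rw [Matrix.matrix_eq_sum_single (x : Mat n)]
  refine Finset.sum_congr rfl fun i _ => Finset.sum_congr rfl fun j _ => ?_
  by_cases h : (x : Mat n) i j = 0
  · simp [h]
  · have hx := x.2 i j h
    rw [matrixUnit_of_sameBlock ⟨i.2, j.2, hx⟩, Matrix.smul_single, smul_eq_mul, mul_one]

namespace SMod

variable {ζ : NilCharacter n} {T : Set (Block ζ)}

/-- The action of the even matrix units on a supermodule. -/
def unitAct (M : SMod.{u} (leviPart ζ T)) (i j : ℕ) : Module.End ℂ M :=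
  M.actEven (matrixUnit ζ T i j)

theorem glRelations_unitAct (M : SMod.{u} (leviPart ζ T)) :
    GlRelations (SameBlock ζ T) M.unitAct :=
  glRelations_matrixUnit M.actEven

theorem actEven_mem {M : SMod.{u} (leviPart ζ T)} {N : Submodule ℂ M}
    (h : ∀ i j, SameBlock ζ T i j → ∀ v ∈ N, M.unitAct i j v ∈ N) (x : (leviPart ζ T).even)
    {v : M} (hv : v ∈ N) : M.actEven x v ∈ N := by
  rw [eq_sum_matrixUnit x]
  simp only [map_sum, map_smul, LinearMap.sum_apply, LinearMap.smul_apply]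
  refine Submodule.sum_mem _ fun i _ => Submodule.sum_mem _ fun j _ => Submodule.smul_mem _ _ ?_
  by_cases hr : SameBlock ζ T i j
  · exact h i j hr v hv
  · have := M.glRelations_unitAct.eq_zero hr
    rw [unitAct] at this
    rw [this]
    exact N.zero_mem

/-- The even Whittaker vectors of a supermodule. -/
def whittaker (M : SMod.{u} (leviPart ζ T)) : Submodule ℂ M :=
  whittakerVectors (SameBlock ζ T) (superdiagValue ζ) M.unitAct

variable {M : SMod.{u} (leviPart ζ T)}

theorem IsLocallyWhittaker.unitAct_nilpotent (h : M.IsLocallyWhittaker ζ) (i j : ℕ) (hij : i < j)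
    (hr : SameBlock ζ T i j) (v : M) :
    ∃ m : ℕ, ((M.unitAct i j - charValue (superdiagValue ζ) i j • 1) ^ m) v = 0 := by
  have hlt : (⟨i, hr.1⟩ : Fin n) < ⟨j, hr.2.1⟩ := hij
  have hmem := single_mem_nilEven hlt
  have hmem' : (matrixUnit ζ T i j : Mat n) ∈ nilEven n := by
    rwa [matrixUnit_of_sameBlock hr]
  obtain ⟨k, hk⟩ := h.locally_nilpotent (matrixUnit ζ T i j) hmem' v
  refine ⟨k, ?_⟩
  have heq : ζ ⟨(matrixUnit ζ T i j : Mat n), hmem'⟩ = charValue (superdiagValue ζ) i j := by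
    rw [← character_single ζ hlt]
    congr 1
    exact Subtype.ext (matrixUnit_of_sameBlock hr)
  rwa [heq] at hk

theorem IsLocallyWhittaker.blockTrace_finite (h : M.IsLocallyWhittaker ζ) (v : M) :
    ∃ N : Submodule ℂ M, v ∈ N ∧ FiniteDimensional ℂ N ∧
      ∀ t k, ∀ w ∈ N, blockTrace n (SameBlock ζ T) M.unitAct t k w ∈ N := by
  obtain ⟨N, hv, hfin, hN⟩ := h.center_locally_finite v
  refine ⟨N, hv, hfin, fun t k w hw => ?_⟩
  let ι := UniversalEnvelopingAlgebra.ι ℂ (L := (leviPart ζ T).even)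
  have hz : blockTrace n (SameBlock ζ T) (fun i j => ι (matrixUnit ζ T i j)) t k ∈
      Subalgebra.center ℂ (UniversalEnvelopingAlgebra ℂ (leviPart ζ T).even) := by
    refine mem_center_enveloping fun x => ?_
    rw [eq_sum_matrixUnit x]
    simp only [map_sum, map_smul, Finset.sum_mul, Finset.mul_sum, smul_mul_assoc, mul_smul_comm]
    refine Finset.sum_congr rfl fun i _ => Finset.sum_congr rfl fun j _ => ?_
    rw [blockTrace_comm (sameBlock_isNondegenerate ζ T) (glRelations_matrixUnit ι) i j t k]
  have := hN _ hz w hw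
  have hmap := map_blockTrace (n := n) (R := SameBlock ζ T)
    (e := fun i j => ι (matrixUnit ζ T i j))
    (UniversalEnvelopingAlgebra.lift ℂ M.actEven).toRingHom t k
  have hun : (fun i j => (UniversalEnvelopingAlgebra.lift ℂ M.actEven).toRingHom
      (ι (matrixUnit ζ T i j))) = M.unitAct := by
    funext i j
    simp [ι, unitAct]
  rw [hun] at hmap
  rw [← hmap]
  exact this

/-! ### Simple submodules of locally Whittaker supermodules -/

/-- The space spanned by the words of length at most `r` in the odd elements, applied to `W`. -/
def oddWords (M : SMod.{u} (leviPart ζ T)) (W : Submodule ℂ M) : ℕ → Submodule ℂ M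
  | 0 => W
  | r + 1 => oddWords M W r ⊔ Submodule.map₂ M.actOdd ⊤ (oddWords M W r)

/-- The submodule over the even part generated by the odd words of length at most `r`. -/
def oddSpan (M : SMod.{u} (leviPart ζ T)) (W : Submodule ℂ M) (r : ℕ) : Submodule ℂ M :=
  generated M.unitAct (SameBlock ζ T) (M.oddWords W r)

section OddWords

variable {W : Submodule ℂ M}

theorem oddWords_le_succ (r : ℕ) : M.oddWords W r ≤ M.oddWords W (r + 1) := le_sup_left

theorem actOdd_mem_oddWords {r : ℕ} (y : (leviPart ζ T).odd) {v : M} (hv : v ∈ M.oddWords W r) :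
    M.actOdd y v ∈ M.oddWords W (r + 1) :=
  Submodule.mem_sup_right (Submodule.apply_mem_map₂ _ trivial hv)

theorem finiteDimensional_oddWords [FiniteDimensional ℂ W] (r : ℕ) :
    FiniteDimensional ℂ (M.oddWords W r) := by
  induction r with
  | zero => assumption
  | succ r ih =>
    have h : FiniteDimensional ℂ (Submodule.map₂ M.actOdd ⊤ (M.oddWords W r)) := by
      rw [FiniteDimensional, Module.Finite.iff_fg] at ih ⊢
      have htop : (⊤ : Submodule ℂ (leviPart ζ T).odd).FG := by
        have : FiniteDimensional ℂ (leviPart ζ T).odd := inferInstance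
        exact this.fg_top
      exact htop.map₂ _ ih
    rw [oddWords]
    infer_instance

/-- A subspace property that is preserved along `oddWords`. -/
theorem oddWords_induction {p : ℕ → M → Prop} {N : ℕ → Submodule ℂ M}
    (hN : ∀ r v, p r v ↔ v ∈ N r) (h0 : ∀ v ∈ W, p 0 v) (hmono : ∀ r v, p r v → p (r + 1) v)
    (hodd : ∀ r y, ∀ v ∈ M.oddWords W r, p r v → p (r + 1) (M.actOdd y v)) {r : ℕ} {v : M}
    (hv : v ∈ M.oddWords W r) : p r v := by
  induction r generalizing v with
  | zero => exact h0 v hv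
  | succ r ih =>
    rw [hN]
    refine (sup_le ?_ ?_ : M.oddWords W (r + 1) ≤ N (r + 1)) hv
    · exact fun w hw => (hN _ _).1 (hmono r w (ih hw))
    · rw [Submodule.map₂_le]
      exact fun y _ w hw => (hN _ _).1 (hodd r y w hw (ih hw))

theorem unitAct_mem_oddWords (hW : ∀ i j, i < j → SameBlock ζ T i j → ∀ v ∈ W, M.unitAct i j v ∈ W)
    {i j : ℕ} (hij : i < j) (hr : SameBlock ζ T i j) {r : ℕ} {v : M} (hv : v ∈ M.oddWords W r) :
    M.unitAct i j v ∈ M.oddWords W r := by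
  refine oddWords_induction (p := fun r v => M.unitAct i j v ∈ M.oddWords W r)
    (N := fun r => (M.oddWords W r).comap (M.unitAct i j)) (fun _ _ => Iff.rfl)
    (fun v hv => hW i j hij hr v hv) (fun r v h => oddWords_le_succ r h) ?_ hv
  intro r y v hv h
  rw [unitAct, even_odd]
  exact Submodule.add_mem _ (actOdd_mem_oddWords y h) (actOdd_mem_oddWords _ hv)

theorem parity_mem_oddWords (hW : ∀ v ∈ W, M.parity v ∈ W) {r : ℕ} {v : M}
    (hv : v ∈ M.oddWords W r) : M.parity v ∈ M.oddWords W r := by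
  refine oddWords_induction (p := fun r v => M.parity v ∈ M.oddWords W r)
    (N := fun r => (M.oddWords W r).comap M.parity) (fun _ _ => Iff.rfl)
    hW (fun r v h => oddWords_le_succ r h) ?_ hv
  intro r y v hv h
  rw [parity_odd]
  exact Submodule.neg_mem _ (actOdd_mem_oddWords y h)

theorem oddSpan_le_succ (r : ℕ) : M.oddSpan W r ≤ M.oddSpan W (r + 1) :=
  generated_mono (fun _ _ h => h) (oddWords_le_succ r)

theorem actEven_mem_oddSpan {r : ℕ} (x : (leviPart ζ T).even) {v : M} (hv : v ∈ M.oddSpan W r) :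
    M.actEven x v ∈ M.oddSpan W r :=
  actEven_mem (fun _ _ hr _ hv => generated_stable hr hv) x hv

theorem actOdd_mem_oddSpan {r : ℕ} (y : (leviPart ζ T).odd) {v : M} (hv : v ∈ M.oddSpan W r) :
    M.actOdd y v ∈ M.oddSpan W (r + 1) := by
  let N : Submodule ℂ M := ⨅ y, (M.oddSpan W (r + 1)).comap (M.actOdd y)
  have hN : ∀ v, v ∈ N ↔ ∀ y, M.actOdd y v ∈ M.oddSpan W (r + 1) := fun v => by
    simp [N, Submodule.mem_iInf]
  have hle : M.oddSpan W r ≤ N ⊓ M.oddSpan W r := by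
    refine generated_le (fun w hw => ⟨(hN w).2 fun y => le_generated (actOdd_mem_oddWords y hw),
      le_generated hw⟩) ?_
    rintro i j hr w ⟨hw, hw'⟩
    refine ⟨(hN _).2 fun y => ?_, generated_stable hr hw'⟩
    have := M.even_odd (matrixUnit ζ T i j) y w
    rw [← sub_eq_iff_eq_add] at this
    rw [unitAct, ← this]
    exact Submodule.sub_mem _ (actEven_mem_oddSpan _ ((hN w).1 hw y)) ((hN w).1 hw _)
  exact (hN v).1 (hle hv).1 y

theorem parity_mem_oddSpan (hW : ∀ v ∈ W, M.parity v ∈ W) {r : ℕ} {v : M}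
    (hv : v ∈ M.oddSpan W r) : M.parity v ∈ M.oddSpan W r := by
  have hle : M.oddSpan W r ≤ (M.oddSpan W r).comap M.parity :=
    generated_le (fun w hw => le_generated (parity_mem_oddWords hW hw)) fun i j hr w hw => by
      rw [Submodule.mem_comap] at hw ⊢
      rw [unitAct, parity_even]
      exact generated_stable hr hw
  exact hle hv

/-- A word in the odd elements `b i`, applied to a vector. -/
def oddWord (M : SMod.{u} (leviPart ζ T)) {ι : Type*} (b : ι → (leviPart ζ T).odd) (l : List ι)
    (v : M) : M :=
  l.foldr (fun i w => M.actOdd (b i) w) v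

theorem oddWord_mem {ι : Type*} (b : ι → (leviPart ζ T).odd) (l : List ι) {v : M} (hv : v ∈ W) :
    M.oddWord b l v ∈ M.oddSpan W l.length := by
  induction l with
  | nil => exact le_generated hv
  | cons i l ih => exact actOdd_mem_oddSpan (b i) ih

/-- Repeating a letter in a word of odd elements does not lead to longer words, because odd elements
anticommute up to even elements. -/
theorem actOdd_oddWord_mem {ι : Type*} (b : ι → (leviPart ζ T).odd) {i : ι} {l : List ι}
    (hi : i ∈ l) {v : M} (hv : v ∈ W) :
    M.actOdd (b i) (M.oddWord b l v) ∈ M.oddSpan W l.length := by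
  induction l with
  | nil => simp at hi
  | cons j l ih =>
    have hmem : M.oddWord b l v ∈ M.oddSpan W (l.length + 1) :=
      oddSpan_le_succ _ (oddWord_mem b l hv)
    have h1 := M.odd_odd (b i) (b j) (M.oddWord b l v)
    change M.actOdd (b i) (M.actOdd (b j) (M.oddWord b l v)) ∈ M.oddSpan W (l.length + 1)
    have h2 : M.actOdd (b i) (M.actOdd (b j) (M.oddWord b l v)) +
        M.actOdd (b j) (M.actOdd (b i) (M.oddWord b l v)) ∈ M.oddSpan W (l.length + 1) := by
      rw [h1]
      exact actEven_mem_oddSpan _ hmem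
    by_cases hij : i = j
    · subst hij
      rw [← two_smul ℂ] at h2
      exact (Submodule.smul_mem_iff _ two_ne_zero).1 h2
    · have h3 := actOdd_mem_oddSpan (b j) (ih ((List.mem_cons.1 hi).resolve_left hij))
      have h4 := Submodule.sub_mem _ h2 h3
      rwa [add_sub_cancel_right] at h4

theorem actOdd_eq_sum {d : ℕ} (b : Module.Basis (Fin d) ℂ (leviPart ζ T).odd)
    (y : (leviPart ζ T).odd) (v : M) :
    M.actOdd y v = ∑ i, b.repr y i • M.actOdd (b i) v := by
  calc M.actOdd y v = M.actOdd (∑ i, b.repr y i • b i) v := by rw [b.sum_repr]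
    _ = _ := by simp only [map_sum, map_smul, LinearMap.sum_apply, LinearMap.smul_apply]

theorem oddWords_le_sup {d : ℕ} (b : Module.Basis (Fin d) ℂ (leviPart ζ T).odd) (r : ℕ) :
    M.oddWords W (r + 1) ≤ M.oddSpan W r ⊔
      Submodule.span ℂ {u | ∃ l : List (Fin d), l.Nodup ∧ l.length = r + 1 ∧
        ∃ v ∈ W, u = M.oddWord b l v} := by
  induction r with
  | zero =>
    refine sup_le (le_generated.trans le_sup_left) ?_
    rw [Submodule.map₂_le]
    intro y _ v hv
    rw [actOdd_eq_sum b]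
    refine Submodule.sum_mem _ fun i _ => Submodule.smul_mem _ _ (Submodule.mem_sup_right
      (Submodule.subset_span ⟨[i], by simp, rfl, v, hv, rfl⟩))
  | succ r ih =>
    refine sup_le (le_generated.trans le_sup_left) ?_
    rw [Submodule.map₂_le]
    intro y _ v hv
    rw [actOdd_eq_sum b]
    refine Submodule.sum_mem _ fun i _ => Submodule.smul_mem _ _ ?_
    obtain ⟨v₁, h₁, v₂, h₂, rfl⟩ := Submodule.mem_sup.1 (ih hv)
    rw [map_add]
    refine Submodule.add_mem _ (Submodule.mem_sup_left (actOdd_mem_oddSpan _ h₁)) ?_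
    rw [← Submodule.mem_comap]
    refine Submodule.span_le.2 ?_ h₂
    rintro _ ⟨l, hl, hlen, w, hw, rfl⟩
    by_cases hi : i ∈ l
    · refine Submodule.mem_sup_left ?_
      rw [← hlen]
      exact actOdd_oddWord_mem b hi hw
    · exact Submodule.mem_sup_right (Submodule.subset_span
        ⟨i :: l, List.nodup_cons.2 ⟨hi, hl⟩, by simp [hlen], w, hw, rfl⟩)

/-- The odd words longer than the dimension of the odd part are not needed. -/
theorem oddSpan_finrank_stable :
    M.oddSpan W (Module.finrank ℂ (leviPart ζ T).odd + 1) ≤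
      M.oddSpan W (Module.finrank ℂ (leviPart ζ T).odd) := by
  refine generated_le ((oddWords_le_sup (Module.finBasis ℂ _) _).trans (sup_le le_rfl ?_))
    fun _ _ hr _ hv => generated_stable hr hv
  rw [Submodule.span_le]
  rintro _ ⟨l, hl, hlen, -⟩
  have := hl.length_le_card
  rw [Fintype.card_fin] at this
  omega

end OddWords

/-- A nonzero locally Whittaker supermodule contains a nonzero graded submodule with a
finite-dimensional space of Whittaker vectors. -/
theorem IsLocallyWhittaker.exists_sub_finiteDimensional (h : M.IsLocallyWhittaker ζ)
    [Nontrivial M] : ∃ U : M.Sub, U.space ≠ ⊥ ∧ FiniteDimensional ℂ ↥(M.whittaker ⊓ U.space) := by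
  have hR := sameBlock_isNondegenerate ζ T
  obtain ⟨w, -, hw0, hw⟩ := exists_whittakerVector hR M.glRelations_unitAct h.unitAct_nilpotent
    (E := ⊤) top_ne_bot fun _ _ _ _ _ _ => trivial
  have hPw : M.parity w ∈ M.whittaker := fun i j hij hr => by
    rw [unitAct, ← parity_even, ← map_smul, ← hw i j hij hr]
    rfl
  let W : Submodule ℂ M := Submodule.span ℂ {w, M.parity w}
  have hWfin : FiniteDimensional ℂ W := FiniteDimensional.span_of_finite ℂ (by simp)
  have hWle : W ≤ M.whittaker := by
    rw [Submodule.span_le]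
    rintro _ (rfl | rfl)
    exacts [hw, hPw]
  have hwW : w ∈ W := Submodule.subset_span (Set.mem_insert _ _)
  have hWP : ∀ v ∈ W, M.parity v ∈ W := by
    intro v hv
    refine (Submodule.span_le.2 ?_ : W ≤ W.comap M.parity) hv
    rintro _ (rfl | rfl)
    · exact Submodule.subset_span (Set.mem_insert_of_mem _ rfl)
    · change M.parity (M.parity w) ∈ W
      rw [parity_parity]
      exact hwW
  have hWst : ∀ i j, i < j → SameBlock ζ T i j → ∀ v ∈ W, M.unitAct i j v ∈ W := by
    intro i j hij hr v hv
    rw [hWle hv i j hij hr]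
    exact W.smul_mem _ hv
  set d := Module.finrank ℂ (leviPart ζ T).odd with hd
  refine ⟨{ space := M.oddSpan W d
            parity_mem := fun v hv => parity_mem_oddSpan hWP hv
            stable := ⟨fun x v hv => actEven_mem_oddSpan x hv,
              fun y v hv => oddSpan_finrank_stable (actOdd_mem_oddSpan y hv)⟩ }, ?_, ?_⟩
  · refine (Submodule.ne_bot_iff _).2 ⟨w, ?_, hw0⟩
    have : ∀ r, w ∈ M.oddWords W r := fun r => by
      induction r with
      | zero => exact hwW
      | succ r ih => exact oddWords_le_succ r ih
    exact le_generated (this d)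
  · have := finiteDimensional_oddWords (M := M) (W := W) d
    exact finiteDimensional_whittakerVectors hR M.glRelations_unitAct h.unitAct_nilpotent
      h.blockTrace_finite (M.oddWords W d) fun i j hij hr v hv =>
        unitAct_mem_oddWords hWst hij hr hv

theorem IsLocallyWhittaker.whittaker_inf_ne_bot (h : M.IsLocallyWhittaker ζ) {U : M.Sub}
    (hU : U.space ≠ ⊥) : M.whittaker ⊓ U.space ≠ ⊥ := by
  obtain ⟨w, hwU, hw0, hw⟩ := exists_whittakerVector (sameBlock_isNondegenerate ζ T)
    M.glRelations_unitAct h.unitAct_nilpotent hU fun i j _ _ v hv => U.stable.1 _ v hv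
  exact (Submodule.ne_bot_iff _).2 ⟨w, ⟨hw, hwU⟩, hw0⟩

/-- A nonzero locally Whittaker supermodule contains a simple graded submodule: one that is
generated by a nonzero space of Whittaker vectors of minimal dimension. -/
theorem IsLocallyWhittaker.exists_simple (h : M.IsLocallyWhittaker ζ) [Nontrivial M] :
    ∃ U : M.Sub, U.toSMod.IsSimple := by
  classical
  obtain ⟨U, hU0, hUfin⟩ := h.exists_sub_finiteDimensional
  have hex : ∃ d : ℕ, ∃ V : M.Sub, V.space ≤ U.space ∧ V.space ≠ ⊥ ∧
      Module.finrank ℂ ↥(M.whittaker ⊓ V.space) = d := ⟨_, U, le_rfl, hU0, rfl⟩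
  obtain ⟨V, hVU, hV0, hVd⟩ := Nat.find_spec hex
  have hmin : ∀ V' : M.Sub, V'.space ≤ U.space → V'.space ≠ ⊥ →
      Nat.find hex ≤ Module.finrank ℂ ↥(M.whittaker ⊓ V'.space) := fun V' h1 h2 =>
    Nat.find_min' hex ⟨V', h1, h2, rfl⟩
  have hVfin : FiniteDimensional ℂ ↥(M.whittaker ⊓ V.space) :=
    Submodule.finiteDimensional_of_le (inf_le_inf_left _ hVU)
  refine ⟨M.gradedSpan (M.whittaker ⊓ V.space), (Sub.isSimple_iff _).2 ⟨fun h0 => ?_, ?_⟩⟩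
  · exact h.whittaker_inf_ne_bot hV0 (eq_bot_iff.2 ((le_gradedSpan _).trans h0.le))
  · intro N hN
    have hNV : N.space ≤ V.space := hN.trans (gradedSpan_le inf_le_right)
    by_cases hN0 : N.space = ⊥
    · exact Or.inl hN0
    right
    refine le_antisymm hN (gradedSpan_le ?_)
    have heq : M.whittaker ⊓ N.space = M.whittaker ⊓ V.space :=
      Submodule.eq_of_le_of_finrank_le (inf_le_inf_left _ hNV)
        (hVd.le.trans (hmin N (hNV.trans hVU) hN0))
    rw [← heq]
    exact inf_le_right

/-- Schur's lemma: an even endomorphism of a simple Whittaker supermodule has an eigenvector among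
the Whittaker vectors and hence is a scalar. -/
theorem IsLocallyWhittaker.exists_eq_smul_id (h : M.IsLocallyWhittaker ζ) (hM : M.IsSimple)
    {f : M →ₗ[ℂ] M} (hf : f ∈ homogHom M M 1) : ∃ a : ℂ, f = a • LinearMap.id := by
  have := hM.1
  obtain ⟨U, hU0, hUfin⟩ := h.exists_sub_finiteDimensional
  have hUtop : U.space = ⊤ := (hM.2 U).resolve_left hU0
  have hne := h.whittaker_inf_ne_bot hU0
  rw [hUtop, inf_top_eq] at hUfin hne
  have hst : ∀ v ∈ M.whittaker, f v ∈ M.whittaker := by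
    intro v hv i j hij hr
    rw [unitAct, ← hf.2.1, ← map_smul, ← hv i j hij hr]
    rfl
  have : Nontrivial M.whittaker := Submodule.nontrivial_iff_ne_bot.2 hne
  obtain ⟨a, ha⟩ := Module.End.exists_eigenvalue (f.restrict hst)
  obtain ⟨v, hv⟩ := ha.exists_hasEigenvector
  refine ⟨a, ?_⟩
  have hg : f - a • LinearMap.id ∈ homogHom M M 1 :=
    Submodule.sub_mem _ hf (Submodule.smul_mem _ a M.id_mem_homogHom)
  by_contra hne
  have hinj := hM.injective hg (sub_ne_zero.2 hne)
  have h0 : (f - a • (LinearMap.id : M →ₗ[ℂ] M)) (v : M) = 0 := by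
    have := congrArg Subtype.val hv.apply_eq_smul
    simp only [LinearMap.restrict_apply] at this
    simp [this]
  exact hv.2 (Subtype.ext (hinj (h0.trans (map_zero _).symm)))

end SMod

end Queer

end

noncomputable section

namespace Queer

open TensorProduct

/-! ### Slices of tensor products -/

section Slice

variable {V W : Type*} [AddCommGroup V] [Module ℂ V] [AddCommGroup W] [Module ℂ W]

/-- The contraction of the first tensor factor with a linear form. -/
def sliceLeft (ℓ : Module.Dual ℂ V) : V ⊗[ℂ] W →ₗ[ℂ] W :=
  TensorProduct.lid ℂ W ∘ₗ TensorProduct.map ℓ LinearMap.id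

/-- The contraction of the second tensor factor with a linear form. -/
def sliceRight (φ : Module.Dual ℂ W) : V ⊗[ℂ] W →ₗ[ℂ] V :=
  TensorProduct.rid ℂ V ∘ₗ TensorProduct.map LinearMap.id φ

@[simp]
theorem sliceLeft_tmul (ℓ : Module.Dual ℂ V) (v : V) (w : W) :
    sliceLeft ℓ (v ⊗ₜ[ℂ] w) = ℓ v • w := by
  simp [sliceLeft]

@[simp]
theorem sliceRight_tmul (φ : Module.Dual ℂ W) (v : V) (w : W) :
    sliceRight φ (v ⊗ₜ[ℂ] w) = φ w • v := by
  simp [sliceRight]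

theorem eq_zero_of_sliceLeft {t : V ⊗[ℂ] W} (h : ∀ ℓ : Module.Dual ℂ V, sliceLeft ℓ t = 0) :
    t = 0 := by
  classical
  let b := Module.Basis.ofVectorSpace ℂ V
  refine (TensorProduct.equivFinsuppOfBasisLeft b (N := W)).injective ?_
  rw [map_zero]
  ext i
  rw [Finsupp.zero_apply, ← h (b.coord i)]
  clear h
  induction t with
  | zero => simp
  | tmul v w => simp
  | add x y hx hy => simp_all

theorem eq_zero_of_sliceRight {t : V ⊗[ℂ] W} (h : ∀ φ : Module.Dual ℂ W, sliceRight φ t = 0) :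
    t = 0 := by
  classical
  let b := Module.Basis.ofVectorSpace ℂ W
  refine (TensorProduct.equivFinsuppOfBasisRight b (M := V)).injective ?_
  rw [map_zero]
  ext i
  rw [Finsupp.zero_apply, ← h (b.coord i)]
  clear h
  induction t with
  | zero => simp
  | tmul v w => simp
  | add x y hx hy => simp_all

theorem tmul_ne_zero_of_ne_zero {v : V} {w : W} (hv : v ≠ 0) (hw : w ≠ 0) : v ⊗ₜ[ℂ] w ≠ 0 := by
  intro h
  refine hv ((Module.forall_dual_apply_eq_zero_iff ℂ v).1 fun ℓ => ?_)
  have := sliceLeft_tmul ℓ v w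
  rw [h, map_zero] at this
  exact (smul_eq_zero.1 this.symm).resolve_right hw

end Slice

/-! ### The two summands inside the Levi subalgebra -/

section Incl

variable {n : ℕ} {ζ : NilCharacter n}

theorem cut_of_mem {T : Set (Block ζ)} {A : Mat n} (hA : A ∈ blockMatrices ζ T) :
    cut ζ T A = A := by
  ext i j
  by_cases h : block ζ i ∈ T
  · simp [cut, h]
  · have : A i j = 0 := by
      by_contra h'
      exact h (hA i j h').2
    simp [cut, this]

theorem cut_of_disjoint {T S : Set (Block ζ)} (hTS : Disjoint T S) {A : Mat n}
    (hA : A ∈ blockMatrices ζ S) : cut ζ T A = 0 := by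
  ext i j
  by_cases h : block ζ i ∈ T
  · have : A i j = 0 := by
      by_contra h'
      exact Set.disjoint_left.1 hTS h (hA i j h').2
    simp [cut, this]
  · simp [cut, h]

theorem cut_add_cut_compl (T : Set (Block ζ)) (A : Mat n) : cut ζ T A + cut ζ Tᶜ A = A := by
  ext i j
  by_cases h : block ζ i ∈ T <;> simp [cut, h]

theorem blockMatrices_le_univ (T : Set (Block ζ)) :
    blockMatrices ζ T ≤ blockMatrices ζ Set.univ :=
  fun _ hA i j h => ⟨(hA i j h).1, trivial⟩

/-- The inclusion of the even part of a summand into the Levi subalgebra. -/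
def inclEven (ζ : NilCharacter n) (T : Set (Block ζ)) :
    (leviPart ζ T).even →ₗ⁅ℂ⁆ (levi ζ).even where
  toFun x := ⟨x, blockMatrices_le_univ T x.2⟩
  map_add' _ _ := rfl
  map_smul' _ _ := rfl
  map_lie' := rfl

/-- The inclusion of the odd part of a summand into the Levi subalgebra. -/
def inclOdd (ζ : NilCharacter n) (T : Set (Block ζ)) :
    (leviPart ζ T).odd →ₗ[ℂ] (levi ζ).odd where
  toFun x := ⟨x, blockMatrices_le_univ T x.2⟩
  map_add' _ _ := rfl
  map_smul' _ _ := rfl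

theorem projEven_inclEven (T : Set (Block ζ)) (x : (leviPart ζ T).even) :
    projEven ζ T (inclEven ζ T x) = x :=
  Subtype.ext (cut_of_mem x.2)

theorem projOdd_inclOdd (T : Set (Block ζ)) (y : (leviPart ζ T).odd) :
    projOdd ζ T (inclOdd ζ T y) = y :=
  Subtype.ext (cut_of_mem y.2)

theorem projEven_inclEven_of_disjoint {T S : Set (Block ζ)} (h : Disjoint T S)
    (x : (leviPart ζ S).even) : projEven ζ T (inclEven ζ S x) = 0 :=
  Subtype.ext (cut_of_disjoint h x.2)

theorem projOdd_inclOdd_of_disjoint {T S : Set (Block ζ)} (h : Disjoint T S)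
    (y : (leviPart ζ S).odd) : projOdd ζ T (inclOdd ζ S y) = 0 :=
  Subtype.ext (cut_of_disjoint h y.2)

theorem incl_projEven_add (T : Set (Block ζ)) (x : (levi ζ).even) :
    inclEven ζ T (projEven ζ T x) + inclEven ζ Tᶜ (projEven ζ Tᶜ x) = x :=
  Subtype.ext (cut_add_cut_compl T x.1)

theorem incl_projOdd_add (T : Set (Block ζ)) (y : (levi ζ).odd) :
    inclOdd ζ T (projOdd ζ T y) + inclOdd ζ Tᶜ (projOdd ζ Tᶜ y) = y :=
  Subtype.ext (cut_add_cut_compl T y.1)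

end Incl

/-! ### Density and stable subspaces of tensor products -/

namespace SMod

variable {n : ℕ} {ζ : NilCharacter n} {T : Set (Block ζ)}

section Density

variable {s : SubSuperalgebra n} {V : SMod.{u} s}

/-- The algebra of operators generated by a supermodule structure. It includes the parity, so that
its submodules are the graded submodules. -/
def operatorAlgebra (V : SMod.{u} s) : Subalgebra ℂ (Module.End ℂ V) :=
  Algebra.adjoin ℂ ({V.parity} ∪ Set.range V.actEven ∪ Set.range V.actOdd)

theorem parity_mem_operatorAlgebra : V.parity ∈ V.operatorAlgebra :=
  Algebra.subset_adjoin (Or.inl (Or.inl rfl))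

theorem actEven_mem_operatorAlgebra (x : s.even) : V.actEven x ∈ V.operatorAlgebra :=
  Algebra.subset_adjoin (Or.inl (Or.inr ⟨x, rfl⟩))

theorem actOdd_mem_operatorAlgebra (y : s.odd) : V.actOdd y ∈ V.operatorAlgebra :=
  Algebra.subset_adjoin (Or.inr ⟨y, rfl⟩)

/-- Density: if all even endomorphisms of a simple supermodule are scalars, then on finitely many
vectors every linear map agrees with an operator from the operator algebra. -/
theorem exists_operator_eq (hV : V.IsSimple)
    (hschur : ∀ f ∈ homogHom V V 1, ∃ a : ℂ, f = a • LinearMap.id) (g : Module.End ℂ V)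
    (S : Finset V) : ∃ r ∈ V.operatorAlgebra, ∀ v ∈ S, r v = g v := by
  have hsimple : IsSimpleModule V.operatorAlgebra V := by
    have := hV.1
    refine { eq_bot_or_eq_top := fun N => ?_ }
    rcases hV.2
      { space := N.restrictScalars ℂ
        parity_mem := fun v hv => N.smul_mem ⟨_, parity_mem_operatorAlgebra⟩ hv
        stable := ⟨fun x v hv => N.smul_mem ⟨_, actEven_mem_operatorAlgebra x⟩ hv,
          fun y v hv => N.smul_mem ⟨_, actOdd_mem_operatorAlgebra y⟩ hv⟩ } with h | h
    · exact Or.inl ((Submodule.restrictScalars_eq_bot_iff _ _ _).1 h)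
    · exact Or.inr ((Submodule.restrictScalars_eq_top_iff _ _ _).1 h)
  let g' : Module.End (Module.End V.operatorAlgebra V) V :=
    { toFun := g
      map_add' := map_add g
      map_smul' := fun f v => by
        have hf : f.restrictScalars ℂ ∈ homogHom V V 1 := by
          refine ⟨fun v => ?_, fun x v => ?_, fun y v => ?_⟩
          · rw [one_smul]
            exact f.map_smul ⟨_, parity_mem_operatorAlgebra⟩ v
          · exact f.map_smul ⟨_, actEven_mem_operatorAlgebra x⟩ v
          · rw [one_smul]
            exact f.map_smul ⟨_, actOdd_mem_operatorAlgebra y⟩ v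
        obtain ⟨a, ha⟩ := hschur _ hf
        have hfa : ∀ v, f v = a • v := fun v => congrArg (fun φ => φ v) ha
        simp only [Module.End.smul_def, RingHom.id_apply, hfa, map_smul] }
  obtain ⟨r, hr⟩ := jacobson_density g' S
  exact ⟨r, r.2, fun v hv => (hr v hv).symm⟩

/-- The tensor product of two simple supermodules has no proper nonzero subspace that is stable
under the operators of both factors, including both parities. Density makes such a subspace stable
under all linear maps of the first factor, so that it contains `v ⊗ w` for all `v` as soon as `w` is
a contraction of one of its elements. -/
theorem eq_bot_or_top_of_stable {s' : SubSuperalgebra n} {W : SMod.{u} s'} (hV : V.IsSimple)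
    (hschur : ∀ f ∈ homogHom V V 1, ∃ a : ℂ, f = a • LinearMap.id) (hW : W.IsSimple)
    (N : Submodule ℂ (V ⊗[ℂ] W))
    (hP : ∀ t ∈ N, map V.parity 1 t ∈ N) (h0 : ∀ x, ∀ t ∈ N, map (V.actEven x) 1 t ∈ N)
    (h1 : ∀ y, ∀ t ∈ N, map (V.actOdd y) 1 t ∈ N)
    (hP' : ∀ t ∈ N, map 1 W.parity t ∈ N) (h0' : ∀ x, ∀ t ∈ N, map 1 (W.actEven x) t ∈ N)
    (h1' : ∀ y, ∀ t ∈ N, map 1 (W.actOdd y) t ∈ N) : N = ⊥ ∨ N = ⊤ := by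
  classical
  rw [or_iff_not_imp_left]
  intro hN
  obtain ⟨t, ht, ht0⟩ := N.ne_bot_iff.1 hN
  have hop : ∀ r ∈ V.operatorAlgebra, ∀ t ∈ N, map r 1 t ∈ N := by
    intro r hr
    induction hr using Algebra.adjoin_induction with
    | mem r hr =>
      rcases hr with (hr | ⟨x, rfl⟩) | ⟨y, rfl⟩
      · rw [Set.mem_singleton_iff.1 hr]
        exact hP
      · exact h0 x
      · exact h1 y
    | algebraMap a =>
      intro t ht
      have : map (algebraMap ℂ (Module.End ℂ V) a) (1 : Module.End ℂ W) t = a • t := by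
        rw [Algebra.algebraMap_eq_smul_one, map_smul_left]
        simp
      rw [this]
      exact N.smul_mem a ht
    | add r r' _ _ hr hr' =>
      intro t ht
      rw [map_add_left]
      exact N.add_mem (hr t ht) (hr' t ht)
    | mul r r' _ _ hr hr' =>
      intro t ht
      have : map (r * r') (1 : Module.End ℂ W) t =
          map r (1 : Module.End ℂ W) (map r' (1 : Module.End ℂ W) t) := by
        rw [← LinearMap.comp_apply, ← map_comp]
        rfl
      rw [this]
      exact hr _ (hr' t ht)
  have hall : ∀ (g : Module.End ℂ V), ∀ t ∈ N, map g (1 : Module.End ℂ W) t ∈ N := by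
    intro g t ht
    obtain ⟨S, hS⟩ := TensorProduct.exists_finset t
    obtain ⟨r, hr, hrg⟩ := exists_operator_eq hV hschur g (S.image Prod.fst)
    have : map g (1 : Module.End ℂ W) t = map r 1 t := by
      rw [hS, map_sum, map_sum]
      refine Finset.sum_congr rfl fun i hi => ?_
      rw [map_tmul, map_tmul, hrg _ (Finset.mem_image_of_mem _ hi)]
    rw [this]
    exact hop r hr t ht
  obtain ⟨ℓ, hℓ⟩ : ∃ ℓ : Module.Dual ℂ V, sliceLeft ℓ t ≠ 0 := by
    by_contra! h
    exact ht0 (eq_zero_of_sliceLeft h)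
  have hmem : ∀ v : V, v ⊗ₜ[ℂ] sliceLeft ℓ t ∈ N := by
    intro v
    let g : Module.End ℂ V := LinearMap.smulRight ℓ v
    have hg : ∀ v', g v' = ℓ v' • v := fun _ => rfl
    have : map g (1 : Module.End ℂ W) t = v ⊗ₜ[ℂ] sliceLeft ℓ t := by
      clear ht ht0 hℓ
      induction t with
      | zero => simp
      | tmul v' w => simp [hg, TensorProduct.smul_tmul]
      | add x y hx hy => simp_all [tmul_add]
    rw [← this]
    exact hall g t ht
  let W' : Submodule ℂ W :=
    { carrier := {w | ∀ v : V, v ⊗ₜ[ℂ] w ∈ N}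
      add_mem' := fun h h' v => by rw [tmul_add]; exact N.add_mem (h v) (h' v)
      zero_mem' := fun v => by rw [tmul_zero]; exact N.zero_mem
      smul_mem' := fun a w h v => by rw [tmul_smul]; exact N.smul_mem a (h v) }
  rcases hW.2
    { space := W'
      parity_mem := fun w h v => hP' _ (h v)
      stable := ⟨fun x w h v => h0' x _ (h v), fun y w h v => h1' y _ (h v)⟩ } with h | h
  · have hw : sliceLeft ℓ t ∈ W' := hmem
    rw [show W' = ⊥ from h] at hw
    exact absurd ((Submodule.mem_bot ℂ).1 hw) hℓ
  · refine eq_top_iff.2 fun x _ => ?_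
    induction x with
    | zero => exact N.zero_mem
    | tmul v w =>
      have hw : w ∈ W' := by
        rw [show W' = ⊤ from h]
        trivial
      exact hw v
    | add x y hx hy => exact N.add_mem (hx trivial) (hy trivial)

end Density

end SMod

end Queer

end

noncomputable section

namespace Queer

namespace SMod

variable {n : ℕ} {ζ : NilCharacter n} {T : Set (Block ζ)}

/-! ### Homomorphisms between outer tensor products -/

section Tensor

variable {V V' : SMod.{u} (leviPart ζ T)} {W W' : SMod.{u} (leviPart ζ Tᶜ)}

/-- The pure tensors in the outer tensor product. -/
def tprod (V : SMod.{u} (leviPart ζ T)) (W : SMod.{u} (leviPart ζ Tᶜ)) :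
    V →ₗ[ℂ] W →ₗ[ℂ] tensor V W :=
  TensorProduct.mk ℂ V W

theorem tensor_induction {p : tensor V W → Prop} (tprod : ∀ v w, p (tprod V W v w))
    (add : ∀ t t', p t → p t' → p (t + t')) (t : tensor V W) : p t :=
  TensorProduct.induction_on (R := ℂ) (M := V) (N := W) t
    (by have h := tprod 0 0; rw [map_zero] at h; exact h) tprod add

theorem tprod_ne_zero {v : V} {w : W} (hv : v ≠ 0) (hw : w ≠ 0) : tprod V W v w ≠ 0 :=
  tmul_ne_zero_of_ne_zero hv hw

@[simp]
theorem parity_tprod (v : V) (w : W) :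
    (tensor V W).parity (tprod V W v w) = tprod V W (V.parity v) (W.parity w) := rfl

theorem even_tprod (x : (levi ζ).even) (v : V) (w : W) :
    (tensor V W).actEven x (tprod V W v w) = tprod V W (V.actEven (projEven ζ T x) v) w +
      tprod V W v (W.actEven (projEven ζ Tᶜ x) w) := rfl

theorem odd_tprod (y : (levi ζ).odd) (v : V) (w : W) :
    (tensor V W).actOdd y (tprod V W v w) = tprod V W (V.actOdd (projOdd ζ T y) v) w +
      tprod V W (V.parity v) (W.actOdd (projOdd ζ Tᶜ y) w) := rfl

@[simp]
theorem even_left_tprod (x : (leviPart ζ T).even) (v : V) (w : W) :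
    (tensor V W).actEven (inclEven ζ T x) (tprod V W v w) = tprod V W (V.actEven x v) w := by
  rw [even_tprod, projEven_inclEven, projEven_inclEven_of_disjoint disjoint_compl_left]
  simp

@[simp]
theorem even_right_tprod (x : (leviPart ζ Tᶜ).even) (v : V) (w : W) :
    (tensor V W).actEven (inclEven ζ Tᶜ x) (tprod V W v w) = tprod V W v (W.actEven x w) := by
  rw [even_tprod, projEven_inclEven, projEven_inclEven_of_disjoint disjoint_compl_right]
  simp

@[simp]
theorem odd_left_tprod (y : (leviPart ζ T).odd) (v : V) (w : W) :
    (tensor V W).actOdd (inclOdd ζ T y) (tprod V W v w) = tprod V W (V.actOdd y v) w := by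
  rw [odd_tprod, projOdd_inclOdd, projOdd_inclOdd_of_disjoint disjoint_compl_left]
  simp

@[simp]
theorem odd_right_tprod (y : (leviPart ζ Tᶜ).odd) (v : V) (w : W) :
    (tensor V W).actOdd (inclOdd ζ Tᶜ y) (tprod V W v w) =
      tprod V W (V.parity v) (W.actOdd y w) := by
  rw [odd_tprod, projOdd_inclOdd, projOdd_inclOdd_of_disjoint disjoint_compl_right]
  simp

/-- The linear map on the outer tensor product that is given by a bilinear map. -/
def tensorLift {X : Type*} [AddCommGroup X] [Module ℂ X] (B : V →ₗ[ℂ] W →ₗ[ℂ] X) :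
    tensor V W →ₗ[ℂ] X :=
  TensorProduct.lift B

/-- The tensor product of two linear maps, between outer tensor products. -/
def tensorMap (f : V →ₗ[ℂ] V') (g : W →ₗ[ℂ] W') : tensor V W →ₗ[ℂ] tensor V' W' :=
  TensorProduct.map f g

@[simp]
theorem tensorMap_tprod (f : V →ₗ[ℂ] V') (g : W →ₗ[ℂ] W') (v : V) (w : W) :
    tensorMap f g (tprod V W v w) = tprod V' W' (f v) (g w) := rfl

/-- The contraction of the first factor of an outer tensor product with a linear form. -/
def contractLeft (W : SMod.{u} (leviPart ζ Tᶜ)) (ℓ : Module.Dual ℂ V) : tensor V W →ₗ[ℂ] W :=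
  sliceLeft ℓ

/-- The contraction of the second factor of an outer tensor product with a linear form. -/
def contractRight (V : SMod.{u} (leviPart ζ T)) (φ : Module.Dual ℂ W) : tensor V W →ₗ[ℂ] V :=
  sliceRight φ

@[simp]
theorem contractLeft_tprod (ℓ : Module.Dual ℂ V) (v : V) (w : W) :
    contractLeft W ℓ (tprod V W v w) = ℓ v • w := sliceLeft_tmul ℓ v w

@[simp]
theorem contractRight_tprod (φ : Module.Dual ℂ W) (v : V) (w : W) :
    contractRight V φ (tprod V W v w) = φ w • v := sliceRight_tmul φ v w

theorem eq_zero_of_contractLeft {t : tensor V W}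
    (h : ∀ ℓ : Module.Dual ℂ V, contractLeft W ℓ t = 0) : t = 0 :=
  eq_zero_of_sliceLeft (V := V) (W := W) h

theorem eq_zero_of_contractRight {t : tensor V W}
    (h : ∀ φ : Module.Dual ℂ W, contractRight V φ t = 0) : t = 0 :=
  eq_zero_of_sliceRight (V := V) (W := W) h

/-- A linear map is a homogeneous homomorphism over the Levi subalgebra if it is one over both
summands. -/
theorem mem_homogHom_of_incl {M N : SMod.{u} (levi ζ)} {ε : ℤˣ} {f : M →ₗ[ℂ] N}
    (hP : ∀ v, f (M.parity v) = ε • N.parity (f v))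
    (h0 : ∀ x v, f (M.actEven (inclEven ζ T x) v) = N.actEven (inclEven ζ T x) (f v))
    (h0' : ∀ x v, f (M.actEven (inclEven ζ Tᶜ x) v) = N.actEven (inclEven ζ Tᶜ x) (f v))
    (h1 : ∀ y v, f (M.actOdd (inclOdd ζ T y) v) = ε • N.actOdd (inclOdd ζ T y) (f v))
    (h1' : ∀ y v, f (M.actOdd (inclOdd ζ Tᶜ y) v) = ε • N.actOdd (inclOdd ζ Tᶜ y) (f v)) :
    f ∈ homogHom M N ε := by
  refine ⟨hP, fun x v => ?_, fun y v => ?_⟩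
  · rw [← incl_projEven_add T x, map_add, map_add]
    simp only [LinearMap.add_apply, map_add, h0, h0']
  · rw [← incl_projOdd_add T y, map_add, map_add]
    simp only [LinearMap.add_apply, map_add, h1, h1', smul_add]

theorem isStable_of_incl {M : SMod.{u} (levi ζ)} {N : Submodule ℂ M}
    (h0 : ∀ x, ∀ v ∈ N, M.actEven (inclEven ζ T x) v ∈ N)
    (h0' : ∀ x, ∀ v ∈ N, M.actEven (inclEven ζ Tᶜ x) v ∈ N)
    (h1 : ∀ y, ∀ v ∈ N, M.actOdd (inclOdd ζ T y) v ∈ N)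
    (h1' : ∀ y, ∀ v ∈ N, M.actOdd (inclOdd ζ Tᶜ y) v ∈ N) : M.IsStable N := by
  refine ⟨fun x v hv => ?_, fun y v hv => ?_⟩
  · rw [← incl_projEven_add T x, map_add]
    exact N.add_mem (h0 _ v hv) (h0' _ v hv)
  · rw [← incl_projOdd_add T y, map_add]
    exact N.add_mem (h1 _ v hv) (h1' _ v hv)

theorem tensorMap_mem_homogHom {ε : ℤˣ} {f : V →ₗ[ℂ] V'} {g : W →ₗ[ℂ] W'}
    (hf : f ∈ homogHom V V' ε) (hg : g ∈ homogHom W W' 1) :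
    tensorMap f g ∈ homogHom (tensor V W) (tensor V' W') ε := by
  have hgP := hg.1
  have hgy := hg.2.2
  simp only [one_smul] at hgP hgy
  rcases Int.units_eq_one_or ε with rfl | rfl <;>
  refine mem_homogHom_of_incl (T := T) (fun t => ?_) (fun x t => ?_) (fun x t => ?_)
    (fun y t => ?_) (fun y t => ?_) <;>
  induction t using tensor_induction with
  | tprod v w => simp [hf.1, hf.2.1, hf.2.2, hgP, hg.2.1, hgy]
  | add t t' h h' => simp only [map_add, h, h', smul_add]

/-- With the sign rule, the tensor product of the identity with an odd homomorphism involves the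
parity of the first factor. -/
theorem tensorMap_parity_mem_homogHom {g : W →ₗ[ℂ] W'} (hg : g ∈ homogHom W W' (-1)) :
    tensorMap V.parity g ∈ homogHom (tensor V W) (tensor V W') (-1) := by
  have hgP := hg.1
  have hgy := hg.2.2
  simp only [Units.neg_smul, one_smul] at hgP hgy
  refine mem_homogHom_of_incl (T := T) (fun t => ?_) (fun x t => ?_) (fun x t => ?_)
    (fun y t => ?_) (fun y t => ?_) <;>
  induction t using tensor_induction with
  | tprod v w => simp [hgP, hg.2.1, hgy, parity_parity, parity_even, parity_odd]
  | add t t' h h' => simp only [map_add, h, h', smul_add]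

/-- The parity of the first factor of an outer tensor product. -/
def leftParity (V : SMod.{u} (leviPart ζ T)) (W : SMod.{u} (leviPart ζ Tᶜ)) :
    Module.End ℂ (tensor V W) :=
  tensorMap V.parity LinearMap.id

@[simp]
theorem leftParity_tprod (v : V) (w : W) :
    leftParity V W (tprod V W v w) = tprod V W (V.parity v) w := rfl

theorem leftParity_leftParity (t : tensor V W) : leftParity V W (leftParity V W t) = t := by
  induction t using tensor_induction with
  | tprod v w => simp [parity_parity]
  | add t t' h h' => simp only [map_add, h, h']

theorem leftParity_parity (t : tensor V W) :
    leftParity V W ((tensor V W).parity t) = (tensor V W).parity (leftParity V W t) := by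
  induction t using tensor_induction with
  | tprod v w => simp
  | add t t' h h' => simp only [map_add, h, h']

theorem leftParity_even_left (x : (leviPart ζ T).even) (t : tensor V W) :
    leftParity V W ((tensor V W).actEven (inclEven ζ T x) t) =
      (tensor V W).actEven (inclEven ζ T x) (leftParity V W t) := by
  induction t using tensor_induction with
  | tprod v w => simp [parity_even]
  | add t t' h h' => simp only [map_add, h, h']

theorem leftParity_even_right (x : (leviPart ζ Tᶜ).even) (t : tensor V W) :
    leftParity V W ((tensor V W).actEven (inclEven ζ Tᶜ x) t) =
      (tensor V W).actEven (inclEven ζ Tᶜ x) (leftParity V W t) := by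
  induction t using tensor_induction with
  | tprod v w => simp
  | add t t' h h' => simp only [map_add, h, h']

theorem leftParity_odd_left (y : (leviPart ζ T).odd) (t : tensor V W) :
    leftParity V W ((tensor V W).actOdd (inclOdd ζ T y) t) =
      -(tensor V W).actOdd (inclOdd ζ T y) (leftParity V W t) := by
  induction t using tensor_induction with
  | tprod v w => simp [parity_odd]
  | add t t' h h' => simp only [map_add, h, h', neg_add]

theorem leftParity_odd_right (y : (leviPart ζ Tᶜ).odd) (t : tensor V W) :
    leftParity V W ((tensor V W).actOdd (inclOdd ζ Tᶜ y) t) =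
      (tensor V W).actOdd (inclOdd ζ Tᶜ y) (leftParity V W t) := by
  induction t using tensor_induction with
  | tprod v w => simp
  | add t t' h h' => simp only [map_add, h, h']

/-- The conjugate of a graded submodule under the parity of the first factor. -/
def conj (N : (tensor V W).Sub) : (tensor V W).Sub where
  space := N.space.comap (leftParity V W)
  parity_mem t ht := by
    rw [Submodule.mem_comap, leftParity_parity]
    exact N.parity_mem _ ht
  stable := by
    refine isStable_of_incl (T := T) (fun x t ht => ?_) (fun x t ht => ?_) (fun y t ht => ?_)
      (fun y t ht => ?_)
    · rw [Submodule.mem_comap, leftParity_even_left]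
      exact N.stable.1 _ _ ht
    · rw [Submodule.mem_comap, leftParity_even_right]
      exact N.stable.1 _ _ ht
    · rw [Submodule.mem_comap, leftParity_odd_left]
      exact N.space.neg_mem (N.stable.2 _ _ ht)
    · rw [Submodule.mem_comap, leftParity_odd_right]
      exact N.stable.2 _ _ ht

theorem mem_conj {N : (tensor V W).Sub} {t : tensor V W} :
    t ∈ (conj N).space ↔ leftParity V W t ∈ N.space := Iff.rfl

theorem leftParity_mem_conj {N : (tensor V W).Sub} {t : tensor V W} :
    leftParity V W t ∈ (conj N).space ↔ t ∈ N.space := by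
  rw [mem_conj, leftParity_leftParity]

theorem nontrivial_tensor (hV : V.IsSimple) (hW : W.IsSimple) : Nontrivial (tensor V W) := by
  have := hV.1
  have := hW.1
  obtain ⟨v, hv⟩ := exists_ne (0 : V)
  obtain ⟨w, hw⟩ := exists_ne (0 : W)
  exact ⟨⟨tprod V W v w, 0, tprod_ne_zero hv hw⟩⟩

/-! ### Simplicity of outer tensor products -/

theorem eq_bot_or_top_of_leftParity (hV : V.IsSimple)
    (hschur : ∀ f ∈ homogHom V V 1, ∃ a : ℂ, f = a • LinearMap.id) (hW : W.IsSimple)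
    (N : (tensor V W).Sub) (hN : ∀ t ∈ N.space, leftParity V W t ∈ N.space) :
    N.space = ⊥ ∨ N.space = ⊤ := by
  have key : ∀ (f : V →ₗ[ℂ] V) (g : W →ₗ[ℂ] W) (F : Module.End ℂ (tensor V W)),
      (∀ v w, F (tprod V W v w) = tprod V W (f v) (g w)) → (∀ t ∈ N.space, F t ∈ N.space) →
      ∀ t ∈ N.space, TensorProduct.map f g t ∈ N.space := by
    intro f g F h hF t ht
    have e : TensorProduct.map f g = F := TensorProduct.ext' fun v w => (h v w).symm
    exact (congrArg (· ∈ N.space) (LinearMap.congr_fun e t)).mpr (hF t ht)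
  refine eq_bot_or_top_of_stable hV hschur hW N.space hN (fun x => ?_) (fun y => ?_) ?_
    (fun x => ?_) (fun y => ?_)
  · exact key _ _ _ (even_left_tprod x) (N.stable.1 _)
  · exact key _ _ _ (odd_left_tprod y) (N.stable.2 _)
  · exact key _ _ (leftParity V W * (tensor V W).parity)
      (fun v w => by simp [parity_parity]) fun t ht => hN _ (N.parity_mem t ht)
  · exact key _ _ _ (even_right_tprod x) (N.stable.1 _)
  · exact key _ _ (leftParity V W * (tensor V W).actOdd (inclOdd ζ Tᶜ y))
      (fun v w => by simp [parity_parity]) fun t ht => hN _ (N.stable.2 _ t ht)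

/-- A proper nonzero graded submodule of the tensor product is complementary to its conjugate. -/
theorem isCompl_conj (hV : V.IsSimple)
    (hschur : ∀ f ∈ homogHom V V 1, ∃ a : ℂ, f = a • LinearMap.id) (hW : W.IsSimple)
    {N : (tensor V W).Sub} (hbot : N.space ≠ ⊥) (htop : N.space ≠ ⊤) :
    IsCompl N.space (conj N).space := by
  constructor
  · rw [disjoint_iff]
    rcases eq_bot_or_top_of_leftParity hV hschur hW
      { space := N.space ⊓ (conj N).space
        parity_mem := fun t ht => ⟨N.parity_mem t ht.1, (conj N).parity_mem t ht.2⟩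
        stable := ⟨fun x t ht => ⟨N.stable.1 x t ht.1, (conj N).stable.1 x t ht.2⟩,
          fun y t ht => ⟨N.stable.2 y t ht.1, (conj N).stable.2 y t ht.2⟩⟩ }
      (fun t ht => ⟨ht.2, leftParity_mem_conj.2 ht.1⟩) with h | h
    · exact h
    · exact absurd (eq_top_iff.2 (h.ge.trans inf_le_left)) htop
  · have hsup : ∀ {F : Module.End ℂ (tensor V W)}, (∀ t ∈ N.space, F t ∈ N.space) →
        (∀ t ∈ (conj N).space, F t ∈ (conj N).space) →
        ∀ t ∈ N.space ⊔ (conj N).space, F t ∈ N.space ⊔ (conj N).space := by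
      intro F h h' t ht
      obtain ⟨a, ha, b, hb, rfl⟩ := Submodule.mem_sup.1 ht
      rw [map_add]
      exact Submodule.add_mem_sup (h a ha) (h' b hb)
    rw [codisjoint_iff]
    rcases eq_bot_or_top_of_leftParity hV hschur hW
      { space := N.space ⊔ (conj N).space
        parity_mem := hsup N.parity_mem (conj N).parity_mem
        stable := ⟨fun x => hsup (N.stable.1 x) ((conj N).stable.1 x),
          fun y => hsup (N.stable.2 y) ((conj N).stable.2 y)⟩ }
      (fun t ht => by
        obtain ⟨a, ha, b, hb, rfl⟩ := Submodule.mem_sup.1 ht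
        rw [map_add, add_comm]
        exact Submodule.add_mem_sup hb (leftParity_mem_conj.2 ha)) with h | h
    · exact absurd (eq_bot_iff.2 (le_sup_left.trans h.le)) hbot
    · exact h

/-- An even endomorphism of the tensor product that anticommutes with the parity of the first
factor yields odd endomorphisms of both factors by contraction, so it vanishes if one of the factors
has no nonzero ones. -/
theorem eq_zero_of_anticomm
    (hodd : (∀ f ∈ homogHom V V (-1), f = 0) ∨ ∀ g ∈ homogHom W W (-1), g = 0)
    {θ : tensor V W →ₗ[ℂ] tensor V W} (hθ : θ ∈ homogHom (tensor V W) (tensor V W) 1)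
    (hanti : ∀ t, θ (leftParity V W t) = -leftParity V W (θ t)) : θ = 0 := by
  suffices h : ∀ v w, θ (tprod V W v w) = 0 by
    refine LinearMap.ext fun t => ?_
    induction t using tensor_induction with
    | tprod v w => exact h v w
    | add t t' h h' => rw [map_add, h, h', map_add]
  have hP := hθ.1
  have hy := hθ.2.2
  simp only [one_smul] at hP hy
  intro v w
  rcases hodd with hodd | hodd
  · refine eq_zero_of_contractRight fun φ => ?_
    let S : V →ₗ[ℂ] V := contractRight V φ ∘ₗ θ ∘ₗ (tprod V W).flip w
    have hSP : ∀ v, S (V.parity v) = -V.parity (S v) := by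
      intro v
      have : ∀ t : tensor V W, contractRight V φ (leftParity V W t) =
          V.parity (contractRight V φ t) := by
        intro t
        induction t using tensor_induction with
        | tprod v w => simp
        | add t t' h h' => simp only [map_add, h, h']
      simp only [S, LinearMap.comp_apply, LinearMap.flip_apply]
      rw [← leftParity_tprod, hanti, map_neg, this]
    have hS0 : ∀ x v, S (V.actEven x v) = V.actEven x (S v) := by
      intro x v
      have : ∀ t : tensor V W, contractRight V φ ((tensor V W).actEven (inclEven ζ T x) t) =
          V.actEven x (contractRight V φ t) := by
        intro t
        induction t using tensor_induction with
        | tprod v w => simp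
        | add t t' h h' => simp only [map_add, h, h']
      simp only [S, LinearMap.comp_apply, LinearMap.flip_apply]
      rw [← even_left_tprod, hθ.2.1, this]
    have hS1 : ∀ y v, S (V.actOdd y v) = V.actOdd y (S v) := by
      intro y v
      have : ∀ t : tensor V W, contractRight V φ ((tensor V W).actOdd (inclOdd ζ T y) t) =
          V.actOdd y (contractRight V φ t) := by
        intro t
        induction t using tensor_induction with
        | tprod v w => simp
        | add t t' h h' => simp only [map_add, h, h']
      simp only [S, LinearMap.comp_apply, LinearMap.flip_apply]
      rw [← odd_left_tprod, hy, this]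
    -- `S` anticommutes with the parity but commutes with the odd elements
    have hmem : S ∘ₗ V.parity ∈ homogHom V V (-1) := by
      refine ⟨fun v => ?_, fun x v => ?_, fun y v => ?_⟩
      · simp [hSP]
      · simp [hS0, parity_even]
      · simp [hS1, parity_odd]
    have := LinearMap.congr_fun (hodd _ hmem) (V.parity v)
    simpa [parity_parity, S] using this
  · refine eq_zero_of_contractLeft fun ℓ => ?_
    let S : W →ₗ[ℂ] W := contractLeft W ℓ ∘ₗ θ ∘ₗ tprod V W v
    have hmem : S ∈ homogHom W W (-1) := by
      refine ⟨fun w => ?_, fun x w => ?_, fun y w => ?_⟩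
      · have : ∀ t : tensor V W, contractLeft W ℓ (leftParity V W ((tensor V W).parity t)) =
            W.parity (contractLeft W ℓ t) := by
          intro t
          induction t using tensor_induction with
          | tprod v w => simp [parity_parity]
          | add t t' h h' => simp only [map_add, h, h']
        have e : tprod V W v (W.parity w) =
            leftParity V W ((tensor V W).parity (tprod V W v w)) := by simp [parity_parity]
        simp only [S, LinearMap.comp_apply]
        rw [e, hanti, hP, map_neg, this, Units.neg_smul, one_smul]
      · have : ∀ t : tensor V W, contractLeft W ℓ ((tensor V W).actEven (inclEven ζ Tᶜ x) t) =
            W.actEven x (contractLeft W ℓ t) := by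
          intro t
          induction t using tensor_induction with
          | tprod v w => simp
          | add t t' h h' => simp only [map_add, h, h']
        simp only [S, LinearMap.comp_apply]
        rw [← even_right_tprod, hθ.2.1, this]
      · have : ∀ t : tensor V W, contractLeft W ℓ
            (leftParity V W ((tensor V W).actOdd (inclOdd ζ Tᶜ y) t)) =
            W.actOdd y (contractLeft W ℓ t) := by
          intro t
          induction t using tensor_induction with
          | tprod v w => simp [parity_parity]
          | add t t' h h' => simp only [map_add, h, h']
        have e : tprod V W v (W.actOdd y w) = leftParity V W
            ((tensor V W).actOdd (inclOdd ζ Tᶜ y) (tprod V W v w)) := by simp [parity_parity]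
        simp only [S, LinearMap.comp_apply]
        rw [e, hanti, hy, map_neg, this, Units.neg_smul, one_smul]
    exact LinearMap.congr_fun (hodd _ hmem) w

/-- If one of the factors has no nonzero odd endomorphism, then the outer tensor product is simple:
a proper nonzero submodule would be complementary to its conjugate, and the involution with these
eigenspaces would yield nonzero odd endomorphisms of both factors. -/
theorem tensor_isSimple (hV : V.IsSimple)
    (hschur : ∀ f ∈ homogHom V V 1, ∃ a : ℂ, f = a • LinearMap.id) (hW : W.IsSimple)
    (hodd : (∀ f ∈ homogHom V V (-1), f = 0) ∨ ∀ g ∈ homogHom W W (-1), g = 0) :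
    (tensor V W).IsSimple := by
  refine ⟨nontrivial_tensor hV hW, fun N => ?_⟩
  by_contra! hN
  have hc := isCompl_conj hV hschur hW hN.1 hN.2
  -- the involution that is `1` on `N` and `-1` on its conjugate
  let θ : tensor V W →ₗ[ℂ] tensor V W :=
    (2 : ℂ) • N.space.projection (conj N).space hc - LinearMap.id
  have hθ : θ ∈ homogHom (tensor V W) (tensor V W) 1 :=
    sub_mem (Submodule.smul_mem _ _ (projection_mem_homogHom hc)) (id_mem_homogHom _)
  have hθN : ∀ t ∈ N.space, θ t = t := by
    intro t ht
    simp only [θ, LinearMap.sub_apply, LinearMap.smul_apply, LinearMap.id_apply,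
      Submodule.projection_apply_of_mem_left hc ht]
    rw [two_smul, add_sub_cancel_right]
  have hθN' : ∀ t ∈ (conj N).space, θ t = -t := by
    intro t ht
    simp only [θ, LinearMap.sub_apply, LinearMap.smul_apply, LinearMap.id_apply,
      Submodule.projection_apply_of_mem_right hc ht]
    rw [smul_zero, zero_sub]
  have h0 := eq_zero_of_anticomm hodd hθ fun t => by
    obtain ⟨a, ha, b, hb, rfl⟩ :=
      Submodule.mem_sup.1 (hc.sup_eq_top ▸ Submodule.mem_top : t ∈ N.space ⊔ (conj N).space)
    rw [map_add, map_add, map_add, hθN a ha, hθN' b hb, hθN _ (mem_conj.1 hb),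
      hθN' _ (leftParity_mem_conj.2 ha), map_add, map_neg]
    abel
  refine hN.1 (eq_bot_iff.2 fun t ht => (Submodule.mem_bot ℂ).2 ?_)
  rw [← hθN t ht, h0, LinearMap.zero_apply]

/-- A graded submodule that is complementary to its conjugate is simple. -/
theorem isSimple_of_isCompl_conj (hV : V.IsSimple)
    (hschur : ∀ f ∈ homogHom V V 1, ∃ a : ℂ, f = a • LinearMap.id) (hW : W.IsSimple)
    {A : (tensor V W).Sub} (hA : IsCompl A.space (conj A).space) : A.toSMod.IsSimple := by
  rw [Sub.isSimple_iff]
  have := nontrivial_tensor hV hW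
  refine ⟨fun h => ?_, fun K hK => ?_⟩
  · have h' : (conj A).space = ⊥ := eq_bot_iff.2 fun t ht => by
      have ht' := mem_conj.1 ht
      rw [h, Submodule.mem_bot] at ht'
      rw [Submodule.mem_bot, ← leftParity_leftParity t, ht', map_zero]
    have := hA.sup_eq_top
    rw [h, h', sup_bot_eq] at this
    exact bot_ne_top this
  · by_cases h1 : K.space = ⊥
    · exact Or.inl h1
    by_cases h2 : K.space = ⊤
    · exact Or.inr (le_antisymm hK (h2 ▸ le_top))
    right
    have hc := isCompl_conj hV hschur hW h1 h2
    refine le_antisymm hK fun t ht => ?_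
    obtain ⟨a, ha, b, hb, rfl⟩ :=
      Submodule.mem_sup.1 (hc.sup_eq_top ▸ Submodule.mem_top : t ∈ K.space ⊔ (conj K).space)
    have hbA : b ∈ A.space := by
      have := A.space.sub_mem ht (hK ha)
      rwa [add_sub_cancel_left] at this
    have hb0 : b = 0 := (Submodule.mem_bot ℂ).1 (hA.disjoint.le_bot ⟨hbA, hK (mem_conj.1 hb)⟩)
    rw [hb0, add_zero]
    exact ha

/-- An odd endomorphism of a simple supermodule may be rescaled to have any given square. -/
theorem exists_odd_sq {s : SubSuperalgebra n} {M : SMod.{u} s} (hM : M.IsSimple)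
    (hschur : ∀ f ∈ homogHom M M 1, ∃ a : ℂ, f = a • LinearMap.id) {f : M →ₗ[ℂ] M}
    (hf : f ∈ homogHom M M (-1)) (h0 : f ≠ 0) (b : ℂ) :
    ∃ g ∈ homogHom M M (-1), ∀ v, g (g v) = b • v := by
  obtain ⟨a, ha⟩ := hschur (f ∘ₗ f) (by simpa using homogHom_comp hf hf)
  have hfa : ∀ v, f (f v) = a • v := LinearMap.congr_fun ha
  have ha0 : a ≠ 0 := by
    rintro rfl
    have := hM.1
    obtain ⟨v, hv⟩ := exists_ne (0 : M)
    have hinj := hM.injective hf h0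
    refine hv (hinj (hinj ?_))
    rw [hfa, zero_smul, map_zero, map_zero]
  obtain ⟨c, hc⟩ := IsAlgClosed.exists_pow_nat_eq (b / a) two_pos
  refine ⟨c • f, Submodule.smul_mem _ c hf, fun v => ?_⟩
  simp only [LinearMap.smul_apply, map_smul, hfa, smul_smul]
  rw [← mul_assoc, ← sq, hc, div_mul_cancel₀ b ha0]

/-- If both factors have nonzero odd endomorphisms `f` and `g`, normalized by `f² = 1` and
`g² = -1`, then `f ⊗ 1` and `P ⊗ g` anticommute, their product `θ` is an even involution, and
`f ⊗ 1` exchanges its two eigenspaces, which are simple. -/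
theorem tensor_isDouble (hV : V.IsSimple)
    (hschur : ∀ f ∈ homogHom V V 1, ∃ a : ℂ, f = a • LinearMap.id) (hW : W.IsSimple)
    (hschur' : ∀ f ∈ homogHom W W 1, ∃ a : ℂ, f = a • LinearMap.id)
    {f : V →ₗ[ℂ] V} (hf : f ∈ homogHom V V (-1)) (hf0 : f ≠ 0)
    {g : W →ₗ[ℂ] W} (hg : g ∈ homogHom W W (-1)) (hg0 : g ≠ 0) : (tensor V W).IsDouble := by
  obtain ⟨f, hf, hff⟩ := exists_odd_sq hV hschur hf hf0 1
  obtain ⟨g, hg, hgg⟩ := exists_odd_sq hW hschur' hg hg0 (-1)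
  simp only [one_smul, neg_smul] at hff hgg
  have hfP : ∀ v, f (V.parity v) = -V.parity (f v) := fun v => by
    rw [hf.1, Units.neg_smul, one_smul]
  let F : tensor V W →ₗ[ℂ] tensor V W := tensorMap f LinearMap.id
  let θ : tensor V W →ₗ[ℂ] tensor V W := F ∘ₗ tensorMap V.parity g
  have hF : F ∈ homogHom (tensor V W) (tensor V W) (-1) :=
    tensorMap_mem_homogHom hf (id_mem_homogHom W)
  have hθ : θ ∈ homogHom (tensor V W) (tensor V W) 1 := by
    simpa using homogHom_comp (tensorMap_parity_mem_homogHom (V := V) hg) hF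
  have hθθ : ∀ t, θ (θ t) = t := by
    intro t
    induction t using tensor_induction with
    | tprod v w => simp [θ, F, hfP, hff, hgg, parity_parity]
    | add t t' h h' => simp only [map_add, h, h']
  have hθF : ∀ t, θ (F t) = -F (θ t) := by
    intro t
    induction t using tensor_induction with
    | tprod v w => simp [θ, F, hfP, hff]
    | add t t' h h' => simp only [map_add, h, h', neg_add]
  have hFF : ∀ t, F (F t) = t := by
    intro t
    induction t using tensor_induction with
    | tprod v w => simp [F, hff]
    | add t t' h h' => simp only [map_add, h, h']
  have hθP : ∀ t, θ (leftParity V W t) = -leftParity V W (θ t) := by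
    intro t
    induction t using tensor_induction with
    | tprod v w => simp [θ, F, hfP, parity_parity]
    | add t t' h h' => simp only [map_add, h, h', neg_add]
  have hsub : θ - LinearMap.id ∈ homogHom (tensor V W) (tensor V W) 1 :=
    sub_mem hθ (id_mem_homogHom _)
  -- the eigenspace of `θ` for the eigenvalue `1`; its conjugate is the one for `-1`
  let A : (tensor V W).Sub := kerSub hsub
  have hA : ∀ t, t ∈ A.space ↔ θ t = t := fun t => by
    change (θ - LinearMap.id : tensor V W →ₗ[ℂ] tensor V W) t = 0 ↔ _
    rw [LinearMap.sub_apply, sub_eq_zero, LinearMap.id_apply]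
  have hA' : ∀ t, t ∈ (conj A).space ↔ θ t = -t := fun t => by
    rw [mem_conj, hA, hθP, neg_eq_iff_eq_neg, ← map_neg]
    constructor
    · intro h
      rw [← leftParity_leftParity (θ t), h, leftParity_leftParity]
    · intro h
      rw [h]
  have hc : IsCompl A.space (conj A).space := by
    constructor
    · rw [Submodule.disjoint_def]
      intro t h h'
      rw [hA] at h
      rw [hA', h] at h'
      have h2 : (2 : ℂ) • t = 0 := by rw [two_smul, ← eq_neg_iff_add_eq_zero]; exact h'
      exact (smul_eq_zero.1 h2).resolve_left two_ne_zero
    · rw [codisjoint_iff, eq_top_iff]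
      intro t _
      have e : t = (2⁻¹ : ℂ) • (t + θ t) + (2⁻¹ : ℂ) • (t - θ t) := by
        rw [← smul_add, add_add_sub_cancel, ← two_smul ℂ t, smul_smul]
        norm_num
      rw [e]
      refine Submodule.add_mem_sup (Submodule.smul_mem _ _ ?_) (Submodule.smul_mem _ _ ?_)
      · rw [hA, map_add, hθθ, add_comm]
      · rw [hA', map_sub, hθθ, neg_sub]
  have hcc : (conj (conj A)).space = A.space :=
    Submodule.ext fun t => by rw [mem_conj, leftParity_mem_conj]
  have h1 := isSimple_of_isCompl_conj hV hschur hW hc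
  have h2 : (conj A).toSMod.IsSimple := isSimple_of_isCompl_conj hV hschur hW (by
    rw [hcc]; exact hc.symm)
  refine ⟨A, conj A, hc, h1, h2, ?_⟩
  have hmem : ∀ a, (F ∘ₗ A.incl) a ∈ (conj A).space := fun a => by
    rw [hA']
    change θ (F (A.incl a)) = -F (A.incl a)
    rw [hθF, (hA _).1 (A.incl_mem a)]
  refine iso_of_ne_zero h1 h2
    ((conj A).codRestrict_mem_homogHom (homogHom_comp A.incl_mem_homogHom hF) hmem) fun h => ?_
  refine Sub.incl_ne_zero h1 (LinearMap.ext fun a => ?_)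
  have := congrArg (fun φ => F ((conj A).incl (φ a))) h
  simp only [LinearMap.zero_apply, map_zero, Sub.incl_codRestrict, LinearMap.comp_apply,
    hFF] at this
  exact this

end Tensor

end SMod

end Queer

end

noncomputable section

namespace Queer

open TensorProduct

/-! ### Centres of tensor products of algebras -/

/-- Over a field the centre of a tensor product is the tensor product of the centres. -/
theorem exists_of_mem_center_tensorProduct {A B : Type*} [Ring A] [Algebra ℂ A] [Ring B]
    [Algebra ℂ B] {t : A ⊗[ℂ] B} (ht : ∀ s, s * t = t * s) :
    ∃ r : Subalgebra.center ℂ A ⊗[ℂ] Subalgebra.center ℂ B,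
      Algebra.TensorProduct.map (Subalgebra.center ℂ A).val (Subalgebra.center ℂ B).val r = t := by
  have h1 : t ∈ Subalgebra.centralizer ℂ
      ((Algebra.TensorProduct.includeLeft : A →ₐ[ℂ] A ⊗[ℂ] B).range : Set (A ⊗[ℂ] B)) :=
    fun s _ => ht s
  rw [Subalgebra.centralizer_coe_range_includeLeft_eq_center_tensorProduct] at h1
  obtain ⟨s, rfl⟩ := h1
  have hinj : Function.Injective
      (Algebra.TensorProduct.map (Subalgebra.center ℂ A).val (AlgHom.id ℂ B)) :=
    Module.Flat.rTensor_preserves_injective_linearMap (M := B)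
      (Subalgebra.center ℂ A).val.toLinearMap Subtype.val_injective
  have h2 : s ∈ Subalgebra.centralizer ℂ
      ((Algebra.TensorProduct.includeRight : B →ₐ[ℂ] Subalgebra.center ℂ A ⊗[ℂ] B).range :
        Set (Subalgebra.center ℂ A ⊗[ℂ] B)) := fun r _ => hinj (by
    rw [map_mul, map_mul]; exact ht _)
  rw [Subalgebra.centralizer_range_includeRight_eq_center_tensorProduct] at h2
  obtain ⟨r, rfl⟩ := h2
  refine ⟨r, ?_⟩
  induction r with
  | zero => simp
  | tmul a b => simp
  | add x y hx hy =>
    have key : ∀ q, Algebra.TensorProduct.map (Subalgebra.center ℂ A).val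
        (Subalgebra.center ℂ B).val q =
        (Algebra.TensorProduct.map (Subalgebra.center ℂ A).val (AlgHom.id ℂ B))
          ((Algebra.TensorProduct.map (AlgHom.id ℂ (Subalgebra.center ℂ A))
            (Subalgebra.center ℂ B).val) q) := by
      intro q
      induction q with
      | zero => simp
      | tmul a b => simp
      | add x y hx hy => simp only [map_add, hx, hy]
    exact key _

namespace SMod

variable {n : ℕ} {ζ : NilCharacter n} {T : Set (Block ζ)}

section Tensor

variable {V : SMod.{u} (leviPart ζ T)} {W : SMod.{u} (leviPart ζ Tᶜ)}

/-! ### The Whittaker conditions for outer tensor products -/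

/-- The homomorphism from the enveloping algebra of the even part of the Levi subalgebra to the
tensor product of the enveloping algebras for the two summands. It is an isomorphism, but only its
surjectivity is needed. -/
def envelopingSplit (ζ : NilCharacter n) (T : Set (Block ζ)) :
    UniversalEnvelopingAlgebra ℂ (levi ζ).even →ₐ[ℂ]
      UniversalEnvelopingAlgebra ℂ (leviPart ζ T).even ⊗[ℂ]
        UniversalEnvelopingAlgebra ℂ (leviPart ζ Tᶜ).even :=
  UniversalEnvelopingAlgebra.lift ℂ
    { toFun := fun x => UniversalEnvelopingAlgebra.ι ℂ (projEven ζ T x) ⊗ₜ[ℂ] 1 +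
        1 ⊗ₜ[ℂ] UniversalEnvelopingAlgebra.ι ℂ (projEven ζ Tᶜ x)
      map_add' := fun x y => by
        simp only [map_add, add_tmul, tmul_add]
        abel
      map_smul' := fun a x => by
        simp only [map_smul, smul_tmul', tmul_smul, smul_add, RingHom.id_apply]
      map_lie' := fun {x y} => by
        simp only [LieHom.map_lie, Ring.lie_def, sub_tmul, tmul_sub, add_mul, mul_add,
          Algebra.TensorProduct.tmul_mul_tmul, one_mul, mul_one]
        abel }

theorem envelopingSplit_ι (x : (levi ζ).even) :
    envelopingSplit ζ T (UniversalEnvelopingAlgebra.ι ℂ x) =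
      UniversalEnvelopingAlgebra.ι ℂ (projEven ζ T x) ⊗ₜ[ℂ] 1 +
        1 ⊗ₜ[ℂ] UniversalEnvelopingAlgebra.ι ℂ (projEven ζ Tᶜ x) := by
  simp [envelopingSplit]

theorem envelopingSplit_surjective : Function.Surjective (envelopingSplit ζ T) := by
  have hl : ∀ a, a ⊗ₜ[ℂ] 1 ∈ (envelopingSplit ζ T).range := by
    intro a
    induction a using enveloping_induction with
    | ι x =>
      refine ⟨UniversalEnvelopingAlgebra.ι ℂ (inclEven ζ T x), ?_⟩
      change envelopingSplit ζ T _ = _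
      rw [envelopingSplit_ι, projEven_inclEven,
        projEven_inclEven_of_disjoint disjoint_compl_left, map_zero, tmul_zero, add_zero]
    | algebraMap c => exact (envelopingSplit ζ T).range.algebraMap_mem c
    | add a b ha hb => rw [add_tmul]; exact add_mem ha hb
    | mul a b ha hb =>
      rw [← mul_one (1 : UniversalEnvelopingAlgebra ℂ (leviPart ζ Tᶜ).even),
        ← Algebra.TensorProduct.tmul_mul_tmul]
      exact mul_mem ha hb
  have hr : ∀ b, 1 ⊗ₜ[ℂ] b ∈ (envelopingSplit ζ T).range := by
    intro b
    induction b using enveloping_induction with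
    | ι x =>
      refine ⟨UniversalEnvelopingAlgebra.ι ℂ (inclEven ζ Tᶜ x), ?_⟩
      change envelopingSplit ζ T _ = _
      rw [envelopingSplit_ι, projEven_inclEven,
        projEven_inclEven_of_disjoint disjoint_compl_right, map_zero, zero_tmul, zero_add]
    | algebraMap c =>
      have := (envelopingSplit ζ T).range.algebraMap_mem c
      rwa [Algebra.TensorProduct.algebraMap_apply'] at this
    | add a b ha hb => rw [tmul_add]; exact add_mem ha hb
    | mul a b ha hb =>
      rw [← mul_one (1 : UniversalEnvelopingAlgebra ℂ (leviPart ζ T).even),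
        ← Algebra.TensorProduct.tmul_mul_tmul]
      exact mul_mem ha hb
  intro t
  induction t with
  | zero => exact ⟨0, map_zero _⟩
  | tmul a b =>
    have := mul_mem (hl a) (hr b)
    rw [Algebra.TensorProduct.tmul_mul_tmul, mul_one, one_mul] at this
    exact this
  | add x y hx hy =>
    obtain ⟨a, rfl⟩ := hx
    obtain ⟨b, rfl⟩ := hy
    exact ⟨a + b, map_add _ a b⟩

/-- The action of the tensor product of the enveloping algebras on the outer tensor product. -/
def envelopingAct (V : SMod.{u} (leviPart ζ T)) (W : SMod.{u} (leviPart ζ Tᶜ)) :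
    UniversalEnvelopingAlgebra ℂ (leviPart ζ T).even ⊗[ℂ]
      UniversalEnvelopingAlgebra ℂ (leviPart ζ Tᶜ).even →ₐ[ℂ] Module.End ℂ (tensor V W) :=
  (Module.endTensorEndAlgHom (R := ℂ) (S := ℂ) (A := ℂ) (M := V) (N := W)).comp
    (Algebra.TensorProduct.map (UniversalEnvelopingAlgebra.lift ℂ V.actEven)
      (UniversalEnvelopingAlgebra.lift ℂ W.actEven))

theorem envelopingAct_tprod (a : UniversalEnvelopingAlgebra ℂ (leviPart ζ T).even)
    (b : UniversalEnvelopingAlgebra ℂ (leviPart ζ Tᶜ).even) (v : V) (w : W) :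
    envelopingAct V W (a ⊗ₜ[ℂ] b) (tprod V W v w) =
      tprod V W (UniversalEnvelopingAlgebra.lift ℂ V.actEven a v)
        (UniversalEnvelopingAlgebra.lift ℂ W.actEven b w) := rfl

theorem lift_tensor (z : UniversalEnvelopingAlgebra ℂ (levi ζ).even) :
    UniversalEnvelopingAlgebra.lift ℂ (tensor V W).actEven z =
      envelopingAct V W (envelopingSplit ζ T z) := by
  induction z using enveloping_induction with
  | ι x =>
    rw [envelopingSplit_ι, UniversalEnvelopingAlgebra.lift_ι_apply]
    refine LinearMap.ext fun t => ?_
    induction t using tensor_induction with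
    | tprod v w =>
      rw [map_add, LinearMap.add_apply, envelopingAct_tprod, envelopingAct_tprod, even_tprod]
      simp
    | add t t' h h' => rw [map_add, map_add, h, h']
  | algebraMap a => rw [AlgHom.commutes, AlgHom.commutes, AlgHom.commutes]
  | add a b ha hb => rw [map_add, map_add, map_add, ha, hb]
  | mul a b ha hb => rw [map_mul, map_mul, map_mul, ha, hb]

/-- To find a finite-dimensional subspace containing a given vector and stable under a set of
operators, it suffices to do so for pure tensors. -/
theorem exists_finiteDimensional_stable (E : Set (Module.End ℂ (tensor V W)))
    (h : ∀ v w, ∃ N : Submodule ℂ (tensor V W), tprod V W v w ∈ N ∧ FiniteDimensional ℂ N ∧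
      ∀ F ∈ E, ∀ t ∈ N, F t ∈ N) (t : tensor V W) :
    ∃ N : Submodule ℂ (tensor V W), t ∈ N ∧ FiniteDimensional ℂ N ∧
      ∀ F ∈ E, ∀ t ∈ N, F t ∈ N := by
  induction t using tensor_induction with
  | tprod v w => exact h v w
  | add t t' h h' =>
    obtain ⟨N, ht, hN, hs⟩ := h
    obtain ⟨N', ht', hN', hs'⟩ := h'
    refine ⟨N ⊔ N', Submodule.add_mem_sup ht ht', inferInstance, fun F hF x hx => ?_⟩
    obtain ⟨a, ha, b, hb, rfl⟩ := Submodule.mem_sup.1 hx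
    rw [map_add]
    exact Submodule.add_mem_sup (hs F hF a ha) (hs' F hF b hb)

theorem finiteDimensional_map₂ (A : Submodule ℂ V) (B : Submodule ℂ W) [FiniteDimensional ℂ A]
    [FiniteDimensional ℂ B] : FiniteDimensional ℂ (Submodule.map₂ (tprod V W) A B) := by
  have hA : A.FG := Module.Finite.iff_fg.1 inferInstance
  have hB : B.FG := Module.Finite.iff_fg.1 inferInstance
  exact Module.Finite.iff_fg.2 (hA.map₂ _ hB)

theorem apply_mem_of_mem_map₂ {F : Module.End ℂ (tensor V W)} {A : Submodule ℂ V}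
    {B : Submodule ℂ W} {N : Submodule ℂ (tensor V W)}
    (h : ∀ a ∈ A, ∀ b ∈ B, F (tprod V W a b) ∈ N) {t : tensor V W}
    (ht : t ∈ Submodule.map₂ (tprod V W) A B) : F t ∈ N := by
  have hle : Submodule.map₂ (tprod V W) A B ≤ N.comap F := Submodule.map₂_le.2 h
  exact hle ht

theorem isStrictUpper_cut {A : Mat n} (hA : IsStrictUpper A) : IsStrictUpper (cut ζ T A) := by
  intro i j h
  by_cases h' : block ζ i ∈ T <;> simp [cut, h', hA i j h]

/-- If `v` and `w` are killed by powers of `f` and `g`, then `v ⊗ w` is killed by a power of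
`f ⊗ 1 + 1 ⊗ g`. -/
theorem pow_tprod_eq_zero {f : Module.End ℂ V} {g : Module.End ℂ W}
    {F : Module.End ℂ (tensor V W)}
    (hF : ∀ v w, F (tprod V W v w) = tprod V W (f v) w + tprod V W v (g w)) (m : ℕ) :
    ∀ (j k : ℕ) (v : V) (w : W), j + k ≤ m → (f ^ j) v = 0 → (g ^ k) w = 0 →
      (F ^ m) (tprod V W v w) = 0 := by
  induction m with
  | zero =>
    intro j k v w hjk hj _
    obtain ⟨rfl, rfl⟩ : j = 0 ∧ k = 0 := by omega
    have hv : v = 0 := hj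
    rw [hv, map_zero, LinearMap.zero_apply, map_zero]
  | succ m ih =>
    intro j k v w hjk hj hk
    rw [pow_succ, Module.End.mul_apply, hF, map_add]
    rcases j with - | j
    · have hv : v = 0 := hj
      simp [hv]
    rcases k with - | k
    · have hw : w = 0 := hk
      simp [hw]
    rw [ih j (k + 1) (f v) w (by omega) (by rwa [pow_succ, Module.End.mul_apply] at hj) hk,
      ih (j + 1) k v (g w) (by omega) hj (by rwa [pow_succ, Module.End.mul_apply] at hk), add_zero]

/-- The Whittaker conditions pass to outer tensor products. For the centre this uses that the
enveloping algebra for the Levi subalgebra maps onto the tensor product of those for the summands,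
so that its centre maps into the tensor product of their centres. -/
theorem tensor_isLocallyWhittaker (hV : V.IsLocallyWhittaker ζ) (hW : W.IsLocallyWhittaker ζ) :
    (tensor V W).IsLocallyWhittaker ζ where
  nil_locally_finite t := by
    obtain ⟨N, ht, hN, hs⟩ := exists_finiteDimensional_stable (V := V) (W := W)
      ({F | ∃ x : (levi ζ).even, IsStrictUpper (x : Mat n) ∧ F = (tensor V W).actEven x} ∪
        {F | ∃ y : (levi ζ).odd, IsStrictUpper (y : Mat n) ∧ F = (tensor V W).actOdd y})
      (fun v w => by
        obtain ⟨A, hvA, hAf, hA0, hA1⟩ := hV.nil_locally_finite v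
        obtain ⟨B, hwB, hBf, hB0, hB1⟩ := hW.nil_locally_finite w
        -- the right odd operators involve the parity of the first factor
        let A' := A ⊔ A.map V.parity
        have hP : ∀ a ∈ A', V.parity a ∈ A' := by
          intro a ha
          obtain ⟨b, hb, _, ⟨c, hc, rfl⟩, rfl⟩ := Submodule.mem_sup.1 ha
          rw [map_add, parity_parity, add_comm]
          exact Submodule.add_mem_sup hc (Submodule.mem_map_of_mem hb)
        have hA0' : ∀ x : (leviPart ζ T).even, IsStrictUpper (x : Mat n) →
            ∀ a ∈ A', V.actEven x a ∈ A' := by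
          intro x hx a ha
          obtain ⟨b, hb, _, ⟨c, hc, rfl⟩, rfl⟩ := Submodule.mem_sup.1 ha
          rw [map_add, ← parity_even]
          exact Submodule.add_mem_sup (hA0 x hx b hb) (Submodule.mem_map_of_mem (hA0 x hx c hc))
        have hA1' : ∀ y : (leviPart ζ T).odd, IsStrictUpper (y : Mat n) →
            ∀ a ∈ A', V.actOdd y a ∈ A' := by
          intro y hy a ha
          obtain ⟨b, hb, _, ⟨c, hc, rfl⟩, rfl⟩ := Submodule.mem_sup.1 ha
          rw [map_add, ← neg_neg (V.actOdd y (V.parity c)), ← parity_odd]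
          exact Submodule.add_mem_sup (hA1 y hy b hb)
            (Submodule.neg_mem _ (Submodule.mem_map_of_mem (hA1 y hy c hc)))
        refine ⟨Submodule.map₂ (tprod V W) A' B,
          Submodule.apply_mem_map₂ _ (Submodule.mem_sup_left hvA) hwB,
          finiteDimensional_map₂ A' B, ?_⟩
        rintro F (⟨x, hx, rfl⟩ | ⟨y, hy, rfl⟩) t ht
        · refine apply_mem_of_mem_map₂ (fun a ha b hb => ?_) ht
          rw [even_tprod]
          exact add_mem (Submodule.apply_mem_map₂ _ (hA0' _ (isStrictUpper_cut hx) a ha) hb)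
            (Submodule.apply_mem_map₂ _ ha (hB0 _ (isStrictUpper_cut hx) b hb))
        · refine apply_mem_of_mem_map₂ (fun a ha b hb => ?_) ht
          rw [odd_tprod]
          exact add_mem (Submodule.apply_mem_map₂ _ (hA1' _ (isStrictUpper_cut hy) a ha) hb)
            (Submodule.apply_mem_map₂ _ (hP a ha) (hB1 _ (isStrictUpper_cut hy) b hb))) t
    exact ⟨N, ht, hN, fun x hx => hs _ (Or.inl ⟨x, hx, rfl⟩),
      fun y hy => hs _ (Or.inr ⟨y, hy, rfl⟩)⟩
  center_locally_finite t := by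
    obtain ⟨N, ht, hN, hs⟩ := exists_finiteDimensional_stable (V := V) (W := W)
      {F | ∃ z ∈ Subalgebra.center ℂ (UniversalEnvelopingAlgebra ℂ (levi ζ).even),
        F = UniversalEnvelopingAlgebra.lift ℂ (tensor V W).actEven z}
      (fun v w => by
        obtain ⟨A, hvA, hAf, hA⟩ := hV.center_locally_finite v
        obtain ⟨B, hwB, hBf, hB⟩ := hW.center_locally_finite w
        refine ⟨Submodule.map₂ (tprod V W) A B, Submodule.apply_mem_map₂ _ hvA hwB,
          finiteDimensional_map₂ A B, ?_⟩
        rintro F ⟨z, hz, rfl⟩ t ht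
        rw [lift_tensor]
        obtain ⟨r, hr⟩ := exists_of_mem_center_tensorProduct (t := envelopingSplit ζ T z)
          (fun s => by
            obtain ⟨s, rfl⟩ := envelopingSplit_surjective s
            rw [← map_mul, ← map_mul, Subalgebra.mem_center_iff.1 hz s])
        rw [← hr]
        clear hr
        induction r with
        | zero => simp
        | tmul a b =>
          refine apply_mem_of_mem_map₂ (fun v hv w hw => ?_) ht
          rw [Algebra.TensorProduct.map_tmul, envelopingAct_tprod]
          exact Submodule.apply_mem_map₂ _ (hA a a.2 v hv) (hB b b.2 w hw)
        | add x y hx hy =>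
          rw [map_add, map_add]
          exact add_mem hx hy) t
    exact ⟨N, ht, hN, fun z hz => hs _ ⟨z, hz, rfl⟩⟩
  locally_nilpotent x hx t := by
    induction t using tensor_induction with
    | tprod v w =>
      have hxT : (projEven ζ T x : Mat n) ∈ nilEven n := isStrictUpper_cut hx
      have hxT' : (projEven ζ Tᶜ x : Mat n) ∈ nilEven n := isStrictUpper_cut hx
      obtain ⟨j, hj⟩ := hV.locally_nilpotent (projEven ζ T x) hxT v
      obtain ⟨k, hk⟩ := hW.locally_nilpotent (projEven ζ Tᶜ x) hxT' w
      refine ⟨j + k, pow_tprod_eq_zero (fun v w => ?_) (j + k) j k v w le_rfl hj hk⟩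
      have hζ : ζ ⟨x, hx⟩ = ζ ⟨projEven ζ T x, hxT⟩ + ζ ⟨projEven ζ Tᶜ x, hxT'⟩ := by
        rw [← map_add]
        congr 1
        exact Subtype.ext (cut_add_cut_compl T x.1).symm
      simp only [LinearMap.sub_apply, LinearMap.smul_apply, Module.End.one_apply, even_tprod, hζ,
        map_sub, map_smul, add_smul]
      abel
    | add t t' h h' =>
      obtain ⟨j, hj⟩ := h
      obtain ⟨k, hk⟩ := h'
      refine ⟨j + k, ?_⟩
      rw [map_add, pow_add, Module.End.mul_apply, Module.End.mul_apply, hk, map_zero, add_zero,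
        ← Module.End.mul_apply, ← pow_add, add_comm, pow_add, Module.End.mul_apply, hj, map_zero]

end Tensor

end SMod

end Queer

end

noncomputable section

namespace Queer

namespace SMod

variable {n : ℕ} {ζ : NilCharacter n} {T : Set (Block ζ)}

/-! ### Restriction to a summand of the Levi subalgebra -/

section Res

theorem mul_eq_zero_of_disjoint {S : Set (Block ζ)} (h : Disjoint T S) {A B : Mat n}
    (hA : A ∈ blockMatrices ζ T) (hB : B ∈ blockMatrices ζ S) : A * B = 0 := by
  ext i j
  rw [Matrix.mul_apply, Matrix.zero_apply]
  refine Finset.sum_eq_zero fun k _ => ?_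
  by_contra h0
  have h1 := hA i k (left_ne_zero_of_mul h0)
  have h2 := hB k j (right_ne_zero_of_mul h0)
  exact Set.disjoint_left.1 h (h1.1 ▸ h1.2) h2.2

variable (X : SMod.{u} (levi ζ))

theorem even_even_comm (x : (leviPart ζ T).even) (x' : (leviPart ζ Tᶜ).even) (v : X) :
    X.actEven (inclEven ζ T x) (X.actEven (inclEven ζ Tᶜ x') v) =
      X.actEven (inclEven ζ Tᶜ x') (X.actEven (inclEven ζ T x) v) := by
  have h0 : ⁅inclEven ζ T x, inclEven ζ Tᶜ x'⁆ = 0 := Subtype.ext (by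
    change (x : Mat n) * x' - x' * x = 0
    rw [mul_eq_zero_of_disjoint disjoint_compl_right x.2 x'.2,
      mul_eq_zero_of_disjoint disjoint_compl_left x'.2 x.2, sub_zero])
  have h := X.actEven.map_lie (inclEven ζ T x) (inclEven ζ Tᶜ x')
  rw [h0, map_zero, Ring.lie_def] at h
  exact sub_eq_zero.1 (congrArg (fun f => f v) h).symm

theorem even_odd_comm {S : Set (Block ζ)} (hTS : Disjoint T S) (x : (leviPart ζ T).even)
    (y : (leviPart ζ S).odd) (v : X) :
    X.actEven (inclEven ζ T x) (X.actOdd (inclOdd ζ S y) v) =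
      X.actOdd (inclOdd ζ S y) (X.actEven (inclEven ζ T x) v) := by
  have h := X.even_odd (inclEven ζ T x) (inclOdd ζ S y) v
  rw [h, add_eq_left]
  have h0 : (⟨inclEven ζ T x * inclOdd ζ S y - inclOdd ζ S y * inclEven ζ T x,
      (levi ζ).even_odd_mem _ (inclEven ζ T x).2 _ (inclOdd ζ S y).2⟩ : (levi ζ).odd) = 0 :=
    Subtype.ext (by
      change (x : Mat n) * y - y * x = 0
      rw [mul_eq_zero_of_disjoint hTS x.2 y.2, mul_eq_zero_of_disjoint hTS.symm y.2 x.2, sub_zero])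
  rw [h0, map_zero, LinearMap.zero_apply]

theorem odd_odd_anticomm (y : (leviPart ζ T).odd) (y' : (leviPart ζ Tᶜ).odd) (v : X) :
    X.actOdd (inclOdd ζ T y) (X.actOdd (inclOdd ζ Tᶜ y') v) =
      -X.actOdd (inclOdd ζ Tᶜ y') (X.actOdd (inclOdd ζ T y) v) := by
  have h := X.odd_odd (inclOdd ζ T y) (inclOdd ζ Tᶜ y') v
  have h0 : (⟨inclOdd ζ T y * inclOdd ζ Tᶜ y' + inclOdd ζ Tᶜ y' * inclOdd ζ T y,
      (levi ζ).odd_odd_mem _ (inclOdd ζ T y).2 _ (inclOdd ζ Tᶜ y').2⟩ : (levi ζ).even) = 0 :=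
    Subtype.ext (by
      change (y : Mat n) * y' + y' * y = 0
      rw [mul_eq_zero_of_disjoint disjoint_compl_right y.2 y'.2,
        mul_eq_zero_of_disjoint disjoint_compl_left y'.2 y.2, add_zero])
  rw [h0, map_zero, LinearMap.zero_apply] at h
  exact eq_neg_of_add_eq_zero_left h

/-- The restriction of a supermodule over the Levi subalgebra to a summand. -/
def res (T : Set (Block ζ)) (X : SMod.{u} (levi ζ)) : SMod.{u} (leviPart ζ T) where
  carrier := X
  parity := X.parity
  actEven := X.actEven.comp (inclEven ζ T)
  actOdd := X.actOdd ∘ₗ inclOdd ζ T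
  parity_mul_self := X.parity_mul_self
  parity_actEven x := X.parity_actEven (inclEven ζ T x)
  parity_actOdd y := X.parity_actOdd (inclOdd ζ T y)
  act_even_odd x y := X.act_even_odd (inclEven ζ T x) (inclOdd ζ T y)
  act_odd_odd y z := X.act_odd_odd (inclOdd ζ T y) (inclOdd ζ T z)

theorem homogHom_res {X Y : SMod.{u} (levi ζ)} {ε : ℤˣ} {f : X →ₗ[ℂ] Y}
    (hf : f ∈ homogHom X Y ε) : f ∈ homogHom (res T X) (res T Y) ε :=
  ⟨hf.1, fun x v => hf.2.1 (inclEven ζ T x) v, fun y v => hf.2.2 (inclOdd ζ T y) v⟩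

variable {X}

/-- The centre of the enveloping algebra of a summand consists of central elements of the
enveloping algebra of the even part of the Levi subalgebra. -/
theorem lift_inclEven_mem_center
    {z : UniversalEnvelopingAlgebra ℂ (leviPart ζ T).even}
    (hz : z ∈ Subalgebra.center ℂ (UniversalEnvelopingAlgebra ℂ (leviPart ζ T).even)) :
    UniversalEnvelopingAlgebra.lift ℂ ((UniversalEnvelopingAlgebra.ι ℂ).comp (inclEven ζ T)) z ∈
      Subalgebra.center ℂ (UniversalEnvelopingAlgebra ℂ (levi ζ).even) := by
  refine mem_center_enveloping fun x => ?_
  rw [← incl_projEven_add T x, map_add, add_mul, mul_add]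
  congr 1
  · have h := congrArg (UniversalEnvelopingAlgebra.lift ℂ
      ((UniversalEnvelopingAlgebra.ι ℂ).comp (inclEven ζ T)))
      (Subalgebra.mem_center_iff.1 hz (UniversalEnvelopingAlgebra.ι ℂ (projEven ζ T x)))
    simpa using h
  · clear hz
    generalize projEven ζ Tᶜ x = x'
    induction z using enveloping_induction with
    | ι y =>
      rw [UniversalEnvelopingAlgebra.lift_ι_apply, LieHom.comp_apply]
      have h0 : ⁅inclEven ζ T y, inclEven ζ Tᶜ x'⁆ = 0 := Subtype.ext (by
        change (y : Mat n) * x' - x' * y = 0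
        rw [mul_eq_zero_of_disjoint disjoint_compl_right y.2 x'.2,
          mul_eq_zero_of_disjoint disjoint_compl_left x'.2 y.2, sub_zero])
      have h := (UniversalEnvelopingAlgebra.ι ℂ).map_lie (inclEven ζ T y) (inclEven ζ Tᶜ x')
      rw [h0, map_zero, Ring.lie_def] at h
      exact (sub_eq_zero.1 h.symm).symm
    | algebraMap a => rw [AlgHom.commutes, Algebra.commutes]
    | add a b ha hb => rw [map_add, add_mul, mul_add, ha, hb]
    | mul a b ha hb => rw [map_mul, ← mul_assoc, ha, mul_assoc, hb, mul_assoc]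

theorem IsLocallyWhittaker.res (hX : X.IsLocallyWhittaker ζ) :
    (res T X).IsLocallyWhittaker ζ where
  nil_locally_finite v := by
    obtain ⟨N, hv, hN, h0, h1⟩ := hX.nil_locally_finite v
    exact ⟨N, hv, hN, fun x hx => h0 (inclEven ζ T x) hx, fun y hy => h1 (inclOdd ζ T y) hy⟩
  center_locally_finite v := by
    obtain ⟨N, hv, hN, h⟩ := hX.center_locally_finite v
    refine ⟨N, hv, hN, fun z hz w hw => ?_⟩
    have e := lift_intertwine (inclEven ζ T) (ρ := (SMod.res T X).actEven) (σ := X.actEven)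
      (f := (LinearMap.id : X →ₗ[ℂ] X)) (fun _ _ => rfl) z w
    exact (congrArg (· ∈ N) e).mpr (h _ (lift_inclEven_mem_center hz) w hw)
  locally_nilpotent x hx v := hX.locally_nilpotent (inclEven ζ T x) hx v

end Res

/-! ### Multiplicity spaces -/

section MultSpace

/-- The linear maps from `V` to `X` that commute with the action of a summand, without signs and
without reference to the gradings. -/
def multSpace (V : SMod.{u} (leviPart ζ T)) (X : SMod.{u} (levi ζ)) : Submodule ℂ (V →ₗ[ℂ] X) where
  carrier := {h | (∀ x v, h (V.actEven x v) = X.actEven (inclEven ζ T x) (h v)) ∧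
    ∀ y v, h (V.actOdd y v) = X.actOdd (inclOdd ζ T y) (h v)}
  add_mem' := by
    rintro g h ⟨hg0, hg1⟩ ⟨hh0, hh1⟩
    exact ⟨fun x v => by simp [hg0, hh0], fun y v => by simp [hg1, hh1]⟩
  zero_mem' := by simp
  smul_mem' := by
    rintro c h ⟨h0, h1⟩
    exact ⟨fun x v => by simp [h0], fun y v => by simp [h1]⟩

variable {V : SMod.{u} (leviPart ζ T)} {X : SMod.{u} (levi ζ)}

theorem multSpace_parity {h : V →ₗ[ℂ] X} (hh : h ∈ multSpace V X) :
    X.parity ∘ₗ h ∘ₗ V.parity ∈ multSpace V X := by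
  refine ⟨fun x v => ?_, fun y v => ?_⟩
  · simp only [LinearMap.comp_apply, parity_even, hh.1]
  · simp only [LinearMap.comp_apply, parity_odd, hh.2, map_neg, neg_neg]

theorem multSpace_even (x : (leviPart ζ Tᶜ).even) {h : V →ₗ[ℂ] X} (hh : h ∈ multSpace V X) :
    X.actEven (inclEven ζ Tᶜ x) ∘ₗ h ∈ multSpace V X := by
  refine ⟨fun x' v => ?_, fun y v => ?_⟩
  · simp only [LinearMap.comp_apply, hh.1, even_even_comm]
  · simp only [LinearMap.comp_apply, hh.2, even_odd_comm X disjoint_compl_left]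

theorem multSpace_odd (y : (leviPart ζ Tᶜ).odd) {h : V →ₗ[ℂ] X} (hh : h ∈ multSpace V X) :
    X.actOdd (inclOdd ζ Tᶜ y) ∘ₗ h ∘ₗ V.parity ∈ multSpace V X := by
  refine ⟨fun x v => ?_, fun y' v => ?_⟩
  · simp only [LinearMap.comp_apply, parity_even, hh.1, even_odd_comm X disjoint_compl_right]
  · simp only [LinearMap.comp_apply, parity_odd, map_neg, hh.2, odd_odd_anticomm]

/-- The multiplicity space of `V` in `X` as a supermodule over the complementary summand. An odd
element `y` acts by `h ↦ y h P` with `P` the parity of `V`: since `y` and `P` both anticommute with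
the odd elements of the first summand, `y h P` commutes with them again. -/
def multModule (V : SMod.{u} (leviPart ζ T)) (X : SMod.{u} (levi ζ)) :
    SMod.{u} (leviPart ζ Tᶜ) where
  carrier := multSpace V X
  parity :=
    { toFun := fun h => ⟨X.parity ∘ₗ h.1 ∘ₗ V.parity, multSpace_parity h.2⟩
      map_add' := fun g h => by ext v; simp
      map_smul' := fun c h => by ext v; simp }
  actEven :=
    { toFun := fun x =>
        { toFun := fun h => ⟨X.actEven (inclEven ζ Tᶜ x) ∘ₗ h.1, multSpace_even x h.2⟩
          map_add' := fun g h => by ext v; simp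
          map_smul' := fun c h => by ext v; simp }
      map_add' := fun x y => by ext h v; simp
      map_smul' := fun c x => by ext h v; simp
      map_lie' := fun {x y} => by ext h v; simp [Ring.lie_def] }
  actOdd :=
    { toFun := fun y =>
        { toFun := fun h => ⟨X.actOdd (inclOdd ζ Tᶜ y) ∘ₗ h.1 ∘ₗ V.parity, multSpace_odd y h.2⟩
          map_add' := fun g h => by ext v; simp
          map_smul' := fun c h => by ext v; simp }
      map_add' := fun x y => by ext h v; simp
      map_smul' := fun c x => by ext h v; simp }
  parity_mul_self := by ext h v; simp [parity_parity]
  parity_actEven x := by ext h v; simp [parity_even]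
  parity_actOdd y := by ext h v; simp [parity_odd]
  act_even_odd x y := by
    ext h v
    exact congrArg (fun f => f (h.1 (V.parity v)))
      (X.act_even_odd (inclEven ζ Tᶜ x) (inclOdd ζ Tᶜ y))
  act_odd_odd y z := by
    ext h v
    have := congrArg (fun f => f (h.1 v))
      (X.act_odd_odd (inclOdd ζ Tᶜ y) (inclOdd ζ Tᶜ z))
    change X.actEven (inclEven ζ Tᶜ _) (h.1 v) =
      X.actOdd (inclOdd ζ Tᶜ y) (X.actOdd (inclOdd ζ Tᶜ z) (h.1 (V.parity (V.parity v)))) +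
        X.actOdd (inclOdd ζ Tᶜ z) (X.actOdd (inclOdd ζ Tᶜ y) (h.1 (V.parity (V.parity v))))
    rw [parity_parity]
    exact this

/-- The evaluation of the multiplicity space. -/
def multEval (V : SMod.{u} (leviPart ζ T)) (X : SMod.{u} (levi ζ)) :
    multModule V X →ₗ[ℂ] V →ₗ[ℂ] X :=
  (multSpace V X).subtype

theorem multEval_parity (h : multModule V X) (v : V) :
    multEval V X ((multModule V X).parity h) v = X.parity (multEval V X h (V.parity v)) := rfl

theorem multEval_even (x : (leviPart ζ Tᶜ).even) (h : multModule V X) (v : V) :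
    multEval V X ((multModule V X).actEven x h) v =
      X.actEven (inclEven ζ Tᶜ x) (multEval V X h v) := rfl

theorem multEval_odd (y : (leviPart ζ Tᶜ).odd) (h : multModule V X) (v : V) :
    multEval V X ((multModule V X).actOdd y h) v =
      X.actOdd (inclOdd ζ Tᶜ y) (multEval V X h (V.parity v)) := rfl

theorem multEval_injective : Function.Injective (multEval V X) :=
  (multSpace V X).subtype_injective

theorem multEval_mem (h : multModule V X) : multEval V X h ∈ multSpace V X := h.2

theorem exists_homogeneous {s : SubSuperalgebra n} (M : SMod.{u} s) [Nontrivial M] :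
    ∃ (δ : ℤˣ) (v : M), v ≠ 0 ∧ M.parity v = δ • v := by
  obtain ⟨v, hv⟩ := exists_ne (0 : M)
  by_cases h : M.parity v = v
  · exact ⟨1, v, hv, by rw [h, one_smul]⟩
  · refine ⟨-1, v - M.parity v, sub_ne_zero.2 (Ne.symm h), ?_⟩
    rw [map_sub, parity_parity, Units.neg_smul, one_smul, neg_sub]

/-- Evaluation at a homogeneous vector embeds the multiplicity space of a simple supermodule. -/
theorem multModule_isLocallyWhittaker (hV : V.IsSimple) (hX : X.IsLocallyWhittaker ζ) :
    (multModule V X).IsLocallyWhittaker ζ := by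
  have := hV.1
  obtain ⟨δ, v, hv, hPv⟩ := V.exists_homogeneous
  let f : multModule V X →ₗ[ℂ] X := (multEval V X).flip v
  have hf : f ∈ homogHom (multModule V X) (res Tᶜ X) δ := by
    refine ⟨fun h => ?_, fun x h => rfl, fun y h => ?_⟩
    · change X.parity (multEval V X h (V.parity v)) = δ • X.parity (multEval V X h v)
      rw [hPv, map_zsmul_unit, map_zsmul_unit]
    · change X.actOdd _ (multEval V X h (V.parity v)) = δ • X.actOdd _ (multEval V X h v)
      rw [hPv, map_zsmul_unit, map_zsmul_unit]
  refine hX.res.of_injective hf ((injective_iff_map_eq_zero f).2 fun h hh => ?_)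
  have hm := multEval_mem h
  replace hh : multEval V X h v = 0 := hh
  -- the largest graded submodule of the kernel of `h` contains `v`
  rcases hV.2
    { space := LinearMap.ker (multEval V X h) ⊓ (LinearMap.ker (multEval V X h)).comap V.parity
      parity_mem := fun w hw => ⟨hw.2, by
        change multEval V X h (V.parity (V.parity w)) = 0
        rw [parity_parity]; exact hw.1⟩
      stable := ⟨fun x w hw => ⟨by
          change multEval V X h (V.actEven x w) = 0
          rw [hm.1, show multEval V X h w = 0 from hw.1, map_zero], by
          change multEval V X h (V.parity (V.actEven x w)) = 0
          rw [parity_even, hm.1, show multEval V X h (V.parity w) = 0 from hw.2, map_zero]⟩,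
        fun y w hw => ⟨by
          change multEval V X h (V.actOdd y w) = 0
          rw [hm.2, show multEval V X h w = 0 from hw.1, map_zero], by
          change multEval V X h (V.parity (V.actOdd y w)) = 0
          rw [parity_odd, map_neg, hm.2, show multEval V X h (V.parity w) = 0 from hw.2,
            map_zero, neg_zero]⟩⟩ } with h0 | h0
  · have hmem : v ∈ LinearMap.ker (multEval V X h) ⊓
        (LinearMap.ker (multEval V X h)).comap V.parity := ⟨hh, by
      change multEval V X h (V.parity v) = 0
      rw [hPv, map_zsmul_unit, hh, smul_zero]⟩
    exact absurd ((Submodule.mem_bot ℂ).1 ((show _ = ⊥ from h0) ▸ hmem)) hv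
  · refine multEval_injective ?_
    rw [map_zero]
    refine LinearMap.ext fun w => ?_
    have hw : w ∈ LinearMap.ker (multEval V X h) ⊓
        (LinearMap.ker (multEval V X h)).comap V.parity := h0.ge Submodule.mem_top
    exact hw.1

/-- The evaluation map on the tensor product of `V` and a submodule of its multiplicity space. -/
def evalTensor (W : (multModule V X).Sub) : tensor V W.toSMod →ₗ[ℂ] X :=
  tensorLift (multEval V X ∘ₗ W.incl).flip

theorem evalTensor_tprod (W : (multModule V X).Sub) (v : V) (w : W.toSMod) :
    evalTensor W (tprod V W.toSMod v w) = multEval V X (W.incl w) v := rfl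

theorem evalTensor_mem_homogHom (W : (multModule V X).Sub) :
    evalTensor W ∈ homogHom (tensor V W.toSMod) X 1 := by
  have hW := W.incl_mem_homogHom
  have hP := hW.1
  have hy := hW.2.2
  simp only [one_smul] at hP hy
  refine mem_homogHom_of_incl (T := T) (fun t => ?_) (fun x t => ?_) (fun x t => ?_)
    (fun y t => ?_) (fun y t => ?_) <;>
  induction t using tensor_induction with
  | tprod v w =>
    simp [evalTensor_tprod, hP, hy, hW.2.1, multEval_parity, multEval_even, multEval_odd,
      parity_parity, (multEval_mem (W.incl w)).1, (multEval_mem (W.incl w)).2]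
  | add t t' h h' => simp only [map_add, h, h', smul_add]

end MultSpace

/-! ### Classification of the simple Whittaker supermodules -/

theorem topSub_isSimple {s : SubSuperalgebra n} {M : SMod.{u} s} (hM : M.IsSimple) :
    M.topSub.toSMod.IsSimple :=
  isSimple_of_injective hM (id_mem_homogHom M) Function.injective_id _ LinearMap.range_id.symm

theorem exists_simple_sub_comp_ne_zero {s : SubSuperalgebra n} {M : SMod.{u} s}
    (hM : M.IsSimple ∨ M.IsDouble) {Y : Type*} [AddCommGroup Y] [Module ℂ Y] {f : M →ₗ[ℂ] Y}
    (hf : f ≠ 0) : ∃ U : M.Sub, U.toSMod.IsSimple ∧ f ∘ₗ U.incl ≠ 0 := by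
  rcases hM with hM | ⟨A, B, hc, hA, hB, -⟩
  · refine ⟨M.topSub, topSub_isSimple hM, fun h => hf (LinearMap.ext fun v => ?_)⟩
    exact LinearMap.congr_fun h ⟨v, trivial⟩
  · by_cases h1 : f ∘ₗ A.incl = 0
    · refine ⟨B, hB, fun h2 => hf (LinearMap.ext fun v => ?_)⟩
      obtain ⟨a, ha, b, hb, rfl⟩ :=
        Submodule.mem_sup.1 (hc.sup_eq_top ▸ Submodule.mem_top : v ∈ A.space ⊔ B.space)
      have e1 : f a = 0 := LinearMap.congr_fun h1 ⟨a, ha⟩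
      have e2 : f b = 0 := LinearMap.congr_fun h2 ⟨b, hb⟩
      rw [map_add, e1, e2, add_zero, LinearMap.zero_apply]
    · exact ⟨A, hA, h1⟩

theorem nontrivial_of_isSimple_or_isDouble {s : SubSuperalgebra n} {M : SMod.{u} s}
    (hM : M.IsSimple ∨ M.IsDouble) : Nontrivial M := by
  rcases hM with hM | ⟨A, -, -, hA, -, -⟩
  · exact hM.1
  · have := hA.1
    exact A.incl_injective.nontrivial

theorem exists_simple_sub {s : SubSuperalgebra n} {M : SMod.{u} s}
    (hM : M.IsSimple ∨ M.IsDouble) : ∃ U : M.Sub, U.toSMod.IsSimple := by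
  have := nontrivial_of_isSimple_or_isDouble hM
  obtain ⟨v, hv⟩ := exists_ne (0 : M)
  obtain ⟨U, hU, -⟩ := exists_simple_sub_comp_ne_zero hM (f := LinearMap.id)
    fun h => hv (LinearMap.congr_fun h v)
  exact ⟨U, hU⟩

theorem id_ne_zero {s : SubSuperalgebra n} {M : SMod.{u} s} (hM : M.IsSimple) :
    (LinearMap.id : M →ₗ[ℂ] M) ≠ 0 := by
  have := hM.1
  obtain ⟨v, hv⟩ := exists_ne (0 : M)
  exact fun h => hv (LinearMap.congr_fun h v)

/-- A simple supermodule of type `M` has no nonzero odd endomorphisms. -/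
theorem IsTypeM.odd_eq_zero {s : SubSuperalgebra n} {M : SMod.{u} s} (h : M.IsTypeM)
    (hM : M.IsSimple) {f : M →ₗ[ℂ] M} (hf : f ∈ homogHom M M (-1)) : f = 0 := by
  let i : M.endo := ⟨LinearMap.id, Submodule.mem_sup_left M.id_mem_homogHom⟩
  have hi : i ≠ 0 := fun h => id_ne_zero hM (congrArg Subtype.val h)
  obtain ⟨c, hc⟩ := (finrank_eq_one_iff_of_nonzero' i hi).1 h ⟨f, Submodule.mem_sup_right hf⟩
  have hfc : ∀ v, f v = c • v := fun v => (LinearMap.congr_fun (congrArg Subtype.val hc) v).symm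
  -- an odd endomorphism anticommutes with the parity, a scalar commutes with it
  refine LinearMap.ext fun v => ?_
  have h1 := hf.1 v
  rw [hfc, hfc, map_smul, Units.neg_smul, one_smul, eq_neg_iff_add_eq_zero, ← two_smul ℂ] at h1
  rcases smul_eq_zero.1 ((smul_eq_zero.1 h1).resolve_left two_ne_zero) with h0 | h0
  · rw [hfc, h0, zero_smul, LinearMap.zero_apply]
  · rw [← parity_parity M v, h0, map_zero, map_zero, map_zero]

theorem IsTypeQ.exists_odd {s : SubSuperalgebra n} {M : SMod.{u} s} (h : M.IsTypeQ)
    (hschur : ∀ f ∈ homogHom M M 1, ∃ a : ℂ, f = a • LinearMap.id) :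
    ∃ f ∈ homogHom M M (-1), f ≠ 0 := by
  by_contra! h0
  have hle : M.endo ≤ ℂ ∙ (LinearMap.id : M →ₗ[ℂ] M) := by
    refine sup_le (fun f hf => ?_) fun f hf => ?_
    · obtain ⟨a, rfl⟩ := hschur f hf
      exact Submodule.smul_mem _ a (Submodule.mem_span_singleton_self _)
    · rw [h0 f hf]
      exact Submodule.zero_mem _
  have h1 := (Submodule.finrank_mono hle).trans (finrank_span_le_card _)
  rw [show Module.finrank ℂ M.endo = 2 from h] at h1
  simp at h1

section Tensor

variable {V V' : SMod.{u} (leviPart ζ T)} {W W' : SMod.{u} (leviPart ζ Tᶜ)}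

theorem tensor_isSimple_or_isDouble (hV : V.IsSimple) (hVW : V.IsLocallyWhittaker ζ)
    (hW : W.IsSimple) (hWW : W.IsLocallyWhittaker ζ) :
    (tensor V W).IsSimple ∨ (tensor V W).IsDouble := by
  have hsV := fun f (hf : f ∈ homogHom V V 1) => hVW.exists_eq_smul_id hV hf
  have hsW := fun f (hf : f ∈ homogHom W W 1) => hWW.exists_eq_smul_id hW hf
  by_cases h1 : ∀ f ∈ homogHom V V (-1), f = 0
  · exact Or.inl (tensor_isSimple hV hsV hW (Or.inl h1))
  by_cases h2 : ∀ g ∈ homogHom W W (-1), g = 0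
  · exact Or.inl (tensor_isSimple hV hsV hW (Or.inr h2))
  push Not at h1 h2
  obtain ⟨f, hf, hf0⟩ := h1
  obtain ⟨g, hg, hg0⟩ := h2
  exact Or.inr (tensor_isDouble hV hsV hW hsW hf hf0 hg hg0)

/-- Every simple Whittaker supermodule over the Levi subalgebra arises from a simple submodule `V`
of its restriction to one summand and a simple submodule of the multiplicity space of `V`. -/
theorem exists_iso_sub_tensor (T : Set (Block ζ)) {X : SMod.{u} (levi ζ)} (hX : X.IsSimple)
    (hXW : X.IsLocallyWhittaker ζ) :
    ∃ (V : SMod.{u} (leviPart ζ T)) (W : SMod.{u} (leviPart ζ Tᶜ)),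
      V.IsSimple ∧ V.IsLocallyWhittaker ζ ∧ W.IsSimple ∧ W.IsLocallyWhittaker ζ ∧
        ∃ U : (tensor V W).Sub, U.toSMod.IsSimple ∧ Iso X U.toSMod := by
  have hXn : Nontrivial (res T X) := hX.1
  obtain ⟨A, hA⟩ := hXW.res.exists_simple (M := res T X)
  have hAW : A.toSMod.IsLocallyWhittaker ζ := hXW.res.sub A
  have hHW := multModule_isLocallyWhittaker (X := X) hA hXW
  -- the inclusion of `A` is a nonzero element of the multiplicity space
  have hincl : A.incl ∈ multSpace A.toSMod X := ⟨fun _ _ => rfl, fun _ _ => rfl⟩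
  have hHn : Nontrivial (multModule A.toSMod X) :=
    ⟨⟨⟨A.incl, hincl⟩, 0, fun h => Sub.incl_ne_zero hA (congrArg Subtype.val h)⟩⟩
  obtain ⟨B, hB⟩ := hHW.exists_simple
  have hBW := hHW.sub B
  have hev : evalTensor B ≠ 0 := by
    intro h
    have := hB.1
    obtain ⟨w, hw⟩ := exists_ne (0 : B.toSMod)
    refine hw (B.incl_injective (multEval_injective ?_))
    rw [map_zero, map_zero]
    refine LinearMap.ext fun v => ?_
    rw [← evalTensor_tprod, h, LinearMap.zero_apply, LinearMap.zero_apply]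
  obtain ⟨U, hU, hU0⟩ :=
    exists_simple_sub_comp_ne_zero (tensor_isSimple_or_isDouble hA hAW hB hBW) hev
  exact ⟨A.toSMod, B.toSMod, hA, hAW, hB, hBW, U, hU,
    (iso_of_ne_zero hU hX (homogHom_comp U.incl_mem_homogHom (evalTensor_mem_homogHom B))
      hU0).symm⟩

/-- Isomorphisms of the factors induce an injective homogeneous homomorphism of the tensor
products. -/
theorem exists_injective_tensor (hV : Iso V V') (hW : Iso W W') :
    ∃ (ε : ℤˣ) (F : tensor V W →ₗ[ℂ] tensor V' W'),
      F ∈ homogHom (tensor V W) (tensor V' W') ε ∧ Function.Injective F := by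
  obtain ⟨ε, e, he⟩ := hV
  obtain ⟨δ, d, hd⟩ := hW
  have h1 := tensorMap_mem_homogHom he (id_mem_homogHom W)
  have hi1 : Function.Injective (tensorMap (e : V →ₗ[ℂ] V') (LinearMap.id : W →ₗ[ℂ] W)) := by
    refine Function.LeftInverse.injective
      (g := tensorMap (e.symm : V' →ₗ[ℂ] V) (LinearMap.id : W →ₗ[ℂ] W)) fun t => ?_
    induction t using tensor_induction with
    | tprod v w => simp
    | add t t' h h' => simp only [map_add, h, h']
  rcases Int.units_eq_one_or δ with rfl | rfl
  · suffices hi2 : Function.Injective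
        (tensorMap (LinearMap.id : V' →ₗ[ℂ] V') (d : W →ₗ[ℂ] W')) from
      ⟨_, _, homogHom_comp h1 (tensorMap_mem_homogHom (id_mem_homogHom V') hd),
        hi2.comp hi1⟩
    refine Function.LeftInverse.injective
      (g := tensorMap (LinearMap.id : V' →ₗ[ℂ] V') (d.symm : W' →ₗ[ℂ] W)) fun t => ?_
    induction t using tensor_induction with
    | tprod v w => simp
    | add t t' h h' => simp only [map_add, h, h']
  · suffices hi2 : Function.Injective (tensorMap V'.parity (d : W →ₗ[ℂ] W')) from
      ⟨_, _, homogHom_comp h1 (tensorMap_parity_mem_homogHom (V := V') hd),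
        hi2.comp hi1⟩
    refine Function.LeftInverse.injective
      (g := tensorMap V'.parity (d.symm : W' →ₗ[ℂ] W)) fun t => ?_
    induction t using tensor_induction with
    | tprod v w => simp [parity_parity]
    | add t t' h h' => simp only [map_add, h, h']

theorem iso_sub_of_iso (hM : (tensor V' W').IsSimple ∨ (tensor V' W').IsDouble)
    (hV : Iso V V') (hW : Iso W W') {U : (tensor V W).Sub} {U' : (tensor V' W').Sub}
    (hU : U.toSMod.IsSimple) (hU' : U'.toSMod.IsSimple) : Iso U.toSMod U'.toSMod := by
  obtain ⟨ε, F, hF, hinj⟩ := exists_injective_tensor hV hW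
  have hFU := homogHom_comp U.incl_mem_homogHom hF
  have hFUi : Function.Injective (F ∘ₗ U.incl) := hinj.comp U.incl_injective
  let U'' : (tensor V' W').Sub := mapSub hFU U.toSMod.topSub
  have hrange : U''.space = LinearMap.range (F ∘ₗ U.incl) := Submodule.map_top _
  have hU'' : U''.toSMod.IsSimple := isSimple_of_injective hU hFU hFUi U'' hrange
  have hmem : ∀ v, (F ∘ₗ U.incl) v ∈ U''.space := fun v => Submodule.mem_map_of_mem trivial
  refine Iso.trans (iso_of_ne_zero hU hU'' (U''.codRestrict_mem_homogHom hFU hmem) fun h => ?_)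
    (iso_of_isSimple_sub hM hU'' hU')
  have := hU.1
  obtain ⟨v, hv⟩ := exists_ne (0 : U.toSMod)
  refine hv (hFUi ?_)
  rw [← U''.incl_codRestrict _ hmem, h, LinearMap.zero_apply, map_zero, map_zero]

/-- A nonzero linear map on the space of linear forms is nonzero on some homogeneous form. -/
theorem exists_homogeneous_dual {s : SubSuperalgebra n} (M : SMod.{u} s) {Y : Type*}
    [AddCommGroup Y] [Module ℂ Y] (c : Module.Dual ℂ M →ₗ[ℂ] Y) (hc : c ≠ 0) :
    ∃ (δ : ℤˣ) (φ : Module.Dual ℂ M), (∀ v, φ (M.parity v) = δ • φ v) ∧ c φ ≠ 0 := by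
  obtain ⟨φ, hφ⟩ : ∃ φ, c φ ≠ 0 := by
    by_contra! h
    exact hc (LinearMap.ext h)
  by_cases h : c (φ + φ ∘ₗ M.parity) = 0
  · refine ⟨-1, φ - φ ∘ₗ M.parity, fun v => ?_, fun h' => hφ ?_⟩
    · simp [parity_parity]
    · have h2 : c ((2 : ℂ) • φ) = 0 := by
        rw [show (2 : ℂ) • φ = (φ + φ ∘ₗ M.parity) + (φ - φ ∘ₗ M.parity) by
          rw [two_smul]; abel, map_add, h, h', add_zero]
      rw [map_smul] at h2
      exact (smul_eq_zero.1 h2).resolve_left two_ne_zero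
  · refine ⟨1, φ + φ ∘ₗ M.parity, fun v => ?_, h⟩
    simp [parity_parity, add_comm]

/-- Contraction with a homogeneous linear form detects the first factor. -/
theorem iso_left_of_ne_zero {S : SMod.{u} (leviPart ζ T)} (hS : S.IsSimple) (hV : V.IsSimple)
    {ε : ℤˣ} {j : S →ₗ[ℂ] res T (tensor V W)} (hj : j ∈ homogHom S (res T (tensor V W)) ε)
    (hj0 : j ≠ 0) : Iso S V := by
  obtain ⟨s, hs⟩ : ∃ s, j s ≠ 0 := by
    by_contra! h
    exact hj0 (LinearMap.ext h)
  let c : Module.Dual ℂ W →ₗ[ℂ] V :=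
    { toFun := fun φ => contractRight V φ (j s)
      map_add' := fun φ ψ => by
        generalize (j s : tensor V W) = t
        induction t using tensor_induction with
        | tprod v w => simp [add_smul]
        | add t t' h h' => simp only [map_add, h, h']; abel
      map_smul' := fun a φ => by
        generalize (j s : tensor V W) = t
        induction t using tensor_induction with
        | tprod v w => simp [mul_smul]
        | add t t' h h' => simp only [map_add, h, h', smul_add] }
  have hc : c ≠ 0 := fun h => hs (eq_zero_of_contractRight fun φ => LinearMap.congr_fun h φ)
  obtain ⟨δ, φ, hφ, hφ0⟩ := W.exists_homogeneous_dual c hc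
  let q : tensor V W →ₗ[ℂ] V := contractRight V φ
  have hqP : ∀ t, q ((tensor V W).parity t) = δ • V.parity (q t) := fun t => by
    induction t using tensor_induction with
    | tprod v w => simp [q, hφ]
    | add t t' h h' => simp only [map_add, h, h', smul_add]
  have hq0 : ∀ x t, q ((tensor V W).actEven (inclEven ζ T x) t) = V.actEven x (q t) := fun x t => by
    induction t using tensor_induction with
    | tprod v w => simp [q]
    | add t t' h h' => simp only [map_add, h, h']
  have hq1 : ∀ y t, q ((tensor V W).actOdd (inclOdd ζ T y) t) = V.actOdd y (q t) := fun y t => by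
    induction t using tensor_induction with
    | tprod v w => simp [q]
    | add t t' h h' => simp only [map_add, h, h']
  rcases Int.units_eq_one_or δ with rfl | rfl
  · have hq : q ∈ homogHom (res T (tensor V W)) V 1 :=
      ⟨hqP, hq0, fun y t => by rw [one_smul]; exact hq1 y t⟩
    exact iso_of_ne_zero hS hV (homogHom_comp hj hq) fun h => hφ0 (LinearMap.congr_fun h s)
  · -- an odd contraction commutes with odd elements without a sign, which the parity corrects
    have hP : ∀ t : tensor V W, V.parity (q ((tensor V W).parity t)) =
        (-1 : ℤˣ) • V.parity (V.parity (q t)) := fun t => by rw [hqP, map_zsmul_unit]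
    have h0 : ∀ x (t : tensor V W), V.parity (q ((tensor V W).actEven (inclEven ζ T x) t)) =
        V.actEven x (V.parity (q t)) := fun x t => by rw [hq0, parity_even]
    have h1 : ∀ y (t : tensor V W), V.parity (q ((tensor V W).actOdd (inclOdd ζ T y) t)) =
        (-1 : ℤˣ) • V.actOdd y (V.parity (q t)) := fun y t => by
      rw [hq1, parity_odd, Units.neg_smul, one_smul]
    have hq : V.parity ∘ₗ q ∈ homogHom (res T (tensor V W)) V (-1) := ⟨hP, h0, h1⟩
    exact iso_of_ne_zero hS hV (homogHom_comp hj hq) fun h =>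
      parity_ne_zero hφ0 (LinearMap.congr_fun h s)

/-- Contraction with a homogeneous linear form detects the second factor. -/
theorem iso_right_of_ne_zero {S : SMod.{u} (leviPart ζ Tᶜ)} (hS : S.IsSimple) (hW : W.IsSimple)
    {ε : ℤˣ} {j : S →ₗ[ℂ] res Tᶜ (tensor V W)} (hj : j ∈ homogHom S (res Tᶜ (tensor V W)) ε)
    (hj0 : j ≠ 0) : Iso S W := by
  obtain ⟨s, hs⟩ : ∃ s, j s ≠ 0 := by
    by_contra! h
    exact hj0 (LinearMap.ext h)
  let c : Module.Dual ℂ V →ₗ[ℂ] W :=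
    { toFun := fun ℓ => contractLeft W ℓ (j s)
      map_add' := fun φ ψ => by
        generalize (j s : tensor V W) = t
        induction t using tensor_induction with
        | tprod v w => simp [add_smul]
        | add t t' h h' => simp only [map_add, h, h']; abel
      map_smul' := fun a φ => by
        generalize (j s : tensor V W) = t
        induction t using tensor_induction with
        | tprod v w => simp [mul_smul]
        | add t t' h h' => simp only [map_add, h, h', smul_add] }
  have hc : c ≠ 0 := fun h => hs (eq_zero_of_contractLeft fun ℓ => LinearMap.congr_fun h ℓ)
  obtain ⟨δ, ℓ, hℓ, hℓ0⟩ := V.exists_homogeneous_dual c hc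
  let q : tensor V W →ₗ[ℂ] W := contractLeft W ℓ
  have hq : q ∈ homogHom (res Tᶜ (tensor V W)) W δ := by
    refine ⟨fun t => ?_, fun x t => ?_, fun y t => ?_⟩
    · change q ((tensor V W).parity t) = δ • W.parity (q t)
      induction t using tensor_induction with
      | tprod v w => simp [q, hℓ]
      | add t t' h h' => simp only [map_add, h, h', smul_add]
    · change q ((tensor V W).actEven (inclEven ζ Tᶜ x) t) = W.actEven x (q t)
      induction t using tensor_induction with
      | tprod v w => simp [q]
      | add t t' h h' => simp only [map_add, h, h']
    · change q ((tensor V W).actOdd (inclOdd ζ Tᶜ y) t) = δ • W.actOdd y (q t)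
      induction t using tensor_induction with
      | tprod v w => simp [q, hℓ]
      | add t t' h h' => simp only [map_add, h, h', smul_add]
  exact iso_of_ne_zero hS hW (homogHom_comp hj hq) fun h => hℓ0 (LinearMap.congr_fun h s)

/-- An isomorphism of simple submodules of two outer tensor products determines both factors: a
simple submodule of the restriction to a summand maps nontrivially to the factors of both. -/
theorem iso_of_iso_sub (hV : V.IsSimple) (hVW : V.IsLocallyWhittaker ζ) (hV' : V'.IsSimple)
    (hW : W.IsSimple) (hWW : W.IsLocallyWhittaker ζ) (hW' : W'.IsSimple)
    {U : (tensor V W).Sub} {U' : (tensor V' W').Sub} (hU : U.toSMod.IsSimple)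
    (hUU' : Iso U.toSMod U'.toSMod) : Iso V V' ∧ Iso W W' := by
  obtain ⟨ε, e, he⟩ := hUU'
  have hUW : U.toSMod.IsLocallyWhittaker ζ := (tensor_isLocallyWhittaker hVW hWW).sub U
  have he' := homogHom_comp he U'.incl_mem_homogHom
  have hi' : Function.Injective (U'.incl ∘ₗ (e : U.toSMod →ₗ[ℂ] U'.toSMod)) :=
    U'.incl_injective.comp e.injective
  have key : ∀ (R : Set (Block ζ)), ∃ S : SMod.{u} (leviPart ζ R), S.IsSimple ∧
      (∃ ε, ∃ j ∈ homogHom S (res R (tensor V W)) ε, j ≠ 0) ∧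
      ∃ ε, ∃ j ∈ homogHom S (res R (tensor V' W')) ε, j ≠ 0 := by
    intro R
    have hn : Nontrivial (res R U.toSMod) := hU.1
    obtain ⟨S, hS⟩ := (hUW.res (T := R)).exists_simple
    have := hS.1
    obtain ⟨s, hs⟩ := exists_ne (0 : S.toSMod)
    let i : S.toSMod →ₗ[ℂ] U.toSMod := S.incl
    have hi : Function.Injective i := S.incl_injective
    refine ⟨S.toSMod, hS, ⟨_, U.incl ∘ₗ i, homogHom_comp S.incl_mem_homogHom
      (homogHom_res U.incl_mem_homogHom), fun h => hs ?_⟩, _,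
      (U'.incl ∘ₗ (e : U.toSMod →ₗ[ℂ] U'.toSMod)) ∘ₗ i,
      homogHom_comp S.incl_mem_homogHom (homogHom_res he'), fun h => hs ?_⟩
    · refine (U.incl_injective.comp hi) ((LinearMap.congr_fun h s).trans ?_)
      exact (LinearMap.map_zero (U.incl ∘ₗ i)).symm
    · refine (hi'.comp hi) ((LinearMap.congr_fun h s).trans ?_)
      exact (LinearMap.map_zero ((U'.incl ∘ₗ (e : U.toSMod →ₗ[ℂ] U'.toSMod)) ∘ₗ i)).symm
  obtain ⟨S, hS, ⟨ε₁, j, hj, hj0⟩, ε, j', hj', hj0'⟩ := key T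
  obtain ⟨R, hR, ⟨ε₂, k, hk, hk0⟩, ε, k', hk', hk0'⟩ := key Tᶜ
  exact ⟨(iso_left_of_ne_zero hS hV hj hj0).symm.trans (iso_left_of_ne_zero hS hV' hj' hj0'),
    (iso_right_of_ne_zero hR hW hk hk0).symm.trans (iso_right_of_ne_zero hR hW' hk' hk0')⟩

end Tensor

end SMod

end Queer

end

theorem mainTheorem8 (n : ℕ) (ζ : Queer.NilCharacter n) (T : Set (Queer.Block ζ)) :
    -- the tensor product of two simple Whittaker modules
    (∀ (V : Queer.SMod.{u} (Queer.leviPart ζ T)) (W : Queer.SMod.{u} (Queer.leviPart ζ Tᶜ)),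
      V.IsSimple → V.IsWhittaker ζ → W.IsSimple → W.IsWhittaker ζ →
        ((Queer.tensor V W).IsSimple ∨ (Queer.tensor V W).IsDouble) ∧
        (V.IsTypeM ∨ W.IsTypeM → (Queer.tensor V W).IsSimple) ∧
        (V.IsTypeQ ∧ W.IsTypeQ → (Queer.tensor V W).IsDouble) ∧
        -- its simple submodules exist and are objects of the Whittaker category of the Levi
        (∃ U : (Queer.tensor V W).Sub, U.toSMod.IsSimple) ∧
        (∀ U : (Queer.tensor V W).Sub, U.toSMod.IsSimple → U.toSMod.IsWhittaker ζ)) ∧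
    -- completeness
    (∀ X : Queer.SMod.{u} (Queer.levi ζ), X.IsSimple → X.IsWhittaker ζ →
      ∃ (V : Queer.SMod.{u} (Queer.leviPart ζ T)) (W : Queer.SMod.{u} (Queer.leviPart ζ Tᶜ)),
        V.IsSimple ∧ V.IsWhittaker ζ ∧ W.IsSimple ∧ W.IsWhittaker ζ ∧
        ∃ U : (Queer.tensor V W).Sub, U.toSMod.IsSimple ∧ Queer.SMod.Iso X U.toSMod) ∧
    -- the simple submodule is well defined up to isomorphism, and there are no repetitions
    (∀ (V V' : Queer.SMod.{u} (Queer.leviPart ζ T)) (W W' : Queer.SMod.{u} (Queer.leviPart ζ Tᶜ)),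
      V.IsSimple → V.IsWhittaker ζ → V'.IsSimple → V'.IsWhittaker ζ →
      W.IsSimple → W.IsWhittaker ζ → W'.IsSimple → W'.IsWhittaker ζ →
        ∀ (U : (Queer.tensor V W).Sub) (U' : (Queer.tensor V' W').Sub),
          U.toSMod.IsSimple → U'.toSMod.IsSimple →
            (Queer.SMod.Iso U.toSMod U'.toSMod ↔ Queer.SMod.Iso V V' ∧ Queer.SMod.Iso W W')) := by
  refine ⟨fun V W hV hVW hW hWW => ?_, fun X hX hXW => ?_,
    fun V V' W W' hV hVW hV' hVW' hW hWW hW' hWW' U U' hU hU' => ⟨fun h => ?_, fun h => ?_⟩⟩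
  · have hVL := hVW.isLocallyWhittaker
    have hWL := hWW.isLocallyWhittaker
    have hsV := fun f (hf : f ∈ Queer.SMod.homogHom V V 1) => hVL.exists_eq_smul_id hV hf
    have hsW := fun f (hf : f ∈ Queer.SMod.homogHom W W 1) => hWL.exists_eq_smul_id hW hf
    have hor := Queer.SMod.tensor_isSimple_or_isDouble hV hVL hW hWL
    refine ⟨hor, fun hM => ?_, fun hQ => ?_, Queer.SMod.exists_simple_sub hor, fun U hU =>
      ((Queer.SMod.tensor_isLocallyWhittaker hVL hWL).sub U).isWhittaker hU⟩
    · exact Queer.SMod.tensor_isSimple hV hsV hW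
        (hM.imp (fun h f hf => h.odd_eq_zero hV hf) fun h g hg => h.odd_eq_zero hW hg)
    · obtain ⟨f, hf, hf0⟩ := hQ.1.exists_odd hsV
      obtain ⟨g, hg, hg0⟩ := hQ.2.exists_odd hsW
      exact Queer.SMod.tensor_isDouble hV hsV hW hsW hf hf0 hg hg0
  · obtain ⟨V, W, hV, hVL, hW, hWL, hU⟩ :=
      Queer.SMod.exists_iso_sub_tensor T hX hXW.isLocallyWhittaker
    exact ⟨V, W, hV, hVL.isWhittaker hV, hW, hWL.isWhittaker hW, hU⟩
  · exact Queer.SMod.iso_of_iso_sub hV hVW.isLocallyWhittaker hV' hW hWW.isLocallyWhittaker hW' hU h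
  · exact Queer.SMod.iso_sub_of_iso (Queer.SMod.tensor_isSimple_or_isDouble hV'
      hVW'.isLocallyWhittaker hW' hWW'.isLocallyWhittaker) h.1 h.2 hU hU'
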